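/- **Setting.** Let $\mathcal U$ be a finite ground set with $n$ elements, $f:2^{\mathcal U}\to\mathbb R_{\ge 0}$ a nonnegative submodular function (not necessarily monotone) that is accessed only through a value oracle, and $\mathcal I$ either a size constraint $\{S:|S|\le k\}$ with $1\le k\le n$, or the family of independent sets of a matroid on $\mathcal U$ of rank $k\ge 1$. Let $O\in\arg\max_{S\in\mathcal I}f(S)$ and assume $f(O)>0$. Write $\Delta(x\mid A)=f(A\cup\{x\})-f(A)$. Let $\varepsilon>0$, $\ell=\frac{10}{9\varepsilon}$ and $L=\lfloor \ell\rfloor$, and let $Z_0\in\mathcal I$ be an initial solution with $f(Z_0)\ge\alpha_0 f(O)$ for a constant $\alpha_0>0$. The ground set is extended by $3k$ dummy elements, which do not change the value of $f$; in the extended ground set a set is feasible if its part in $\mathcal U$ is feasible and it has at most $k$ elements. Every "choose any" below is resolved by an arbitrary fixed rule. **Algorithm** (input: oracle $f$, constraint $\mathcal I$, $Z_0$, switch point $t$, error rate $\varepsilon$). 1. *FastLS.* Let $Z$ be $Z_0$ filled up with dummy elements to $k$ elements. While there are $a\in Z$, $e\notin Z$ with $Z-a+e$ feasible and $\Delta(e\mid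 Z)-\Delta(a\mid Z-a)\ge\frac{\varepsilon}{k}f(Z)$, replace $Z$ by $Z-a+e$ for some such pair. 2. *Enumeration of all paths.* Let $G_0=\{\emptyset\}$ (for a matroid, $\emptyset$ is filled up with dummy elements to a basis). For $i=1,\dots,L$ let $G_i=\bigcup_{A\in G_{i-1}}\mathrm{GuidedIG}(W_i,A)$, where $W_i=Z$ if $i\le tL$ and $W_i=\emptyset$ otherwise. 3. Return the part in $\mathcal U$ of a set of largest $f$-value in $\{Z\}\cup G_L$. $\mathrm{GuidedIG}(W,G)$ for a *size constraint*: let $a_1,\dots,a_L$ be the top $L$ elements outside $G\cup W$ with respect to the gain $\Delta(\cdot\mid G)$. For each $u=0,\dots,L$ put $A_{u,l}=G+a_l$ if $u=0$ and $A_{u,l}=G+a_u$ if $u\ge1$ $(1\le l\le L)$; then perform $\lfloor k/L\rfloor-1$ rounds, in each of which, for $i=1,\dots,L$ in turn, an element $x\notin W\cup\bigcup_l A_{u,l}$ maximizing $\Delta(x\mid A_{u,i})$ is added to $A_{u,i}$. Return all sets $A_{u,i}$, $0\le u\le L$, $1\le i\le L$. $\mathrm{GuidedIG}(W,G)$ for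 a *matroid*: start with $A=A_1=\dots=A_L=\emptyset$. Repeat $k$ times: among all $j\in\{1,\dots,L\}$ and $x\notin G\cup A\cup W$ with $A+x$ feasible choose $(j,x)$ maximizing $\Delta(x\mid G\cup A_j)$, and add $x$ to $A$ and to $A_j$. Choose a bijection $\sigma:G\to A$ such that $(G\cup A_j)\setminus\sigma^{-1}(A_j)$ is a basis for every $j$, and return these $L$ sets. **Theorem.** For every $\alpha_0>0$ there is a constant $C$, depending only on $\alpha_0$, such that the above deterministic algorithm, for all inputs as above, terminates with a uniquely determined output $A\in\mathcal I$ and: * under a size constraint with $t=0.372$, if $L$ divides $k$ or $k\ge L^2$, then $f(A)\ge(0.385-\varepsilon)f(O)$; * under a matroid constraint with $t=0.559$, $f(A)\ge(0.305-\varepsilon)f(O)$; * in both cases the number of oracle queries is at most $C\,k\,n\,\ell^{2\ell-1}$. -/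

import Mathlib

namespace GuidedSM

/-! ### Query algorithms

A small imperative language for deterministic algorithms that access a set function `f` only
through a value oracle, and its big-step semantics, which counts the oracle queries. -/

/-- Deterministic algorithms with access to a value oracle for a set function on `U`, returning a
value of the given type: `query S` asks the oracle for the value of `S`, `bind` is sequential
composition, and `loop body s` is the (possibly non-terminating) loop that repeats `body` on the
current state, starting from `s`, until `body` answers `Sum.inr b`, and then returns `b`. -/
inductive Prog (U : Type) : Type → Type 1
  | ret {α : Type} (a : α) : Prog U α
  | query (S : Finset U) : Prog U ℝ
  | bind {α β : Type} (p : Prog U α) (g : α → Prog U β) : Prog U β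
  | loop {σ β : Type} (body : σ → Prog U (σ ⊕ β)) (s : σ) : Prog U β

instance (U : Type) : Monad (Prog U) where
  pure := Prog.ret
  bind := Prog.bind

/-- `Eval f p a q`: run with the oracle `f`, the algorithm `p` halts, returns `a`, and makes
exactly `q` oracle queries. -/
inductive Eval {U : Type} (f : Finset U → ℝ) : {α : Type} → Prog U α → α → ℕ → Prop
  | ret {α : Type} (a : α) : Eval f (Prog.ret a) a 0
  | query (S : Finset U) : Eval f (Prog.query S) (f S) 1
  | bind {α β : Type} {p : Prog U α} {g : α → Prog U β} {a : α} {b : β} {m n : ℕ} :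
      Eval f p a m → Eval f (g a) b n → Eval f (Prog.bind p g) b (m + n)
  | loop_done {σ β : Type} {body : σ → Prog U (σ ⊕ β)} {s : σ} {b : β} {m : ℕ} :
      Eval f (body s) (Sum.inr b) m → Eval f (Prog.loop body s) b m
  | loop_step {σ β : Type} {body : σ → Prog U (σ ⊕ β)} {s s' : σ} {b : β} {m n : ℕ} :
      Eval f (body s) (Sum.inl s') m → Eval f (Prog.loop body s') b n →
      Eval f (Prog.loop body s) b (m + n)

/-- The output and the number of queries are determined by the algorithm and the oracle. -/
theorem Eval.unique {U : Type} {f : Finset U → ℝ} {α : Type} {p : Prog U α} {a b : α} {m n : ℕ}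
    (h₁ : Eval f p a m) (h₂ : Eval f p b n) : a = b ∧ m = n := by
  induction h₁ generalizing n with
  | ret a => cases h₂; exact ⟨rfl, rfl⟩
  | query S => cases h₂; exact ⟨rfl, rfl⟩
  | bind _ _ ih₁ ih₂ =>
    cases h₂ with
    | bind k₁ k₂ =>
      obtain ⟨rfl, rfl⟩ := ih₁ k₁
      obtain ⟨rfl, rfl⟩ := ih₂ k₂
      exact ⟨rfl, rfl⟩
  | loop_done _ ih =>
    cases h₂ with
    | loop_done k =>
      obtain ⟨h, rfl⟩ := ih k
      exact ⟨Sum.inr.inj h, rfl⟩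
    | loop_step k _ => exact absurd (ih k).1 (by simp)
  | loop_step _ _ ih₁ ih₂ =>
    cases h₂ with
    | loop_done k => exact absurd (ih₁ k).1 (by simp)
    | loop_step k₁ k₂ =>
      obtain ⟨h, rfl⟩ := ih₁ k₁
      obtain rfl := Sum.inl.inj h
      obtain ⟨rfl, rfl⟩ := ih₂ k₂
      exact ⟨rfl, rfl⟩

/-- A fixed rule that resolves every "choose any" of the pseudocode (ties in an `argmax`, the swap
of the local search, the exchange bijection). -/
structure TieBreaking : Type 1 where
  pick : ∀ {α : Type} (s : Set α), s.Nonempty → α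
  pick_mem : ∀ {α : Type} (s : Set α) (h : s.Nonempty), pick s h ∈ s

noncomputable instance : Inhabited TieBreaking where
  default := ⟨fun _ h => h.some, fun _ h => h.some_mem⟩

open Classical in
/-- The chosen element of `s`, if there is one. -/
noncomputable def TieBreaking.pick? (τ : TieBreaking) {α : Type} (s : Set α) : Option α :=
  if h : s.Nonempty then some (τ.pick s h) else none

/-- The chosen maximizer of `v` over the finite set `s`, if there is one. -/
noncomputable def TieBreaking.argmax (τ : TieBreaking) {α : Type} (s : Finset α) (v : α → ℝ) :
    Option α :=
  τ.pick? {x | x ∈ s ∧ ∀ y ∈ s, v y ≤ v x}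

/-! ### Instances -/

/-- Submodularity by diminishing returns. -/
def Submodular {U : Type} [DecidableEq U] (f : Finset U → ℝ) : Prop :=
  ∀ S T : Finset U, S ⊆ T → ∀ x ∉ T, f (insert x T) - f T ≤ f (insert x S) - f S

/-- The constraints: all sets with at most `k` elements, or the independent sets of a matroid. -/
inductive Constraint (U : Type) : Type
  | size (k : ℕ) : Constraint U
  | matroid (M : Matroid U) : Constraint U

/-- The feasible sets. -/
def Constraint.Feasible {U : Type} : Constraint U → Finset U → Prop
  | .size k, S => S.card ≤ k
  | .matroid M, S => M.Indep (S : Set U)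

/-- The parameter `k`: the size bound, or the rank of the matroid. -/
noncomputable def Constraint.rank {U : Type} : Constraint U → ℕ
  | .size k => k
  | .matroid M => M.eRank.toNat

/-- `O` is an optimal solution of `max f(S)` over feasible `S`. -/
def IsOptimal {U : Type} (f : Finset U → ℝ) (I : Constraint U) (O : Finset U) : Prop :=
  I.Feasible O ∧ ∀ S, I.Feasible S → f S ≤ f O

/-! ### Dummy elements

The ground set `U` is extended by `d` dummy elements to `U ⊕ Fin d`. A dummy element has marginal
gain zero with respect to every set: the value of a set is that of its part in `U`. -/

section Ext

variable {U : Type} [Fintype U] [DecidableEq U] {d : ℕ}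

/-- Feasibility in the extended ground set: the part in `U` is feasible and there are at most `k`
elements in total. -/
def Constraint.ExtFeasible (I : Constraint U) (S : Finset (U ⊕ Fin d)) : Prop :=
  I.Feasible S.toLeft ∧ S.card ≤ I.rank

/-- Add dummy elements to `S` until there are `k` elements. -/
def pad (k : ℕ) (S : Finset U) : Finset (U ⊕ Fin d) :=
  S.disjSum (Finset.univ.filter fun i : Fin d => (i : ℕ) < k - S.card)

/-- One query for the value of a set in the extended ground set. -/
def oracle (S : Finset (U ⊕ Fin d)) : Prog U ℝ := Prog.query S.toLeft

/-- Query the values of the sets `q i`, one query for each entry `i` of the list. -/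
def queryAll {ι : Type} [DecidableEq ι] :
    List ι → (ι → Finset (U ⊕ Fin d)) → Prog U (ι → ℝ)
  | [], _ => pure fun _ => 0
  | i :: l, q => do
    let v ← oracle (q i)
    let w ← queryAll l q
    pure (Function.update w i v)

/-- The marginal gains `x ↦ f(A + x) - f(A)` of the elements `x ∈ C`. -/
noncomputable def marginals (A C : Finset (U ⊕ Fin d)) : Prog U (U ⊕ Fin d → ℝ) := do
  let b ← oracle A
  let v ← queryAll C.toList fun x => insert x A
  pure fun x => v x - b

/-! ### Local search -/

/-- One test of the while-condition of the local search, with the swap if there is one. -/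
noncomputable def fastLSBody (τ : TieBreaking) (I : Constraint U) (ε : ℝ)
    (Z : Finset (U ⊕ Fin d)) : Prog U (Finset (U ⊕ Fin d) ⊕ Finset (U ⊕ Fin d)) := do
  let v ← oracle Z
  let add ← queryAll (Finset.univ \ Z).toList fun e => insert e Z
  let del ← queryAll Z.toList fun a => Z.erase a
  match τ.pick? {s : (U ⊕ Fin d) × (U ⊕ Fin d) | s.1 ∈ Z ∧ s.2 ∉ Z ∧
      I.ExtFeasible (insert s.2 (Z.erase s.1)) ∧
      ε / I.rank * v ≤ (add s.2 - v) - (v - del s.1)} with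
  | some s => pure (Sum.inl (insert s.2 (Z.erase s.1)))
  | none => pure (Sum.inr Z)

/-- `FastLS(f, I, Z₀, ε)`. -/
noncomputable def fastLS (τ : TieBreaking) (I : Constraint U) (Z₀ : Finset U) (ε : ℝ) :
    Prog U (Finset (U ⊕ Fin d)) :=
  Prog.loop (fastLSBody τ I ε) (pad I.rank Z₀)

/-! ### Guided interlaced greedy, size constraint -/

/-- Add to `A i` an element of maximal marginal gain outside `Z` and all current sets `A l`. -/
noncomputable def interlaceStep (τ : TieBreaking) (Z : Finset (U ⊕ Fin d)) {ℓ : ℕ}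
    (A : Fin ℓ → Finset (U ⊕ Fin d)) (i : Fin ℓ) : Prog U (Fin ℓ → Finset (U ⊕ Fin d)) := do
  let C := (Finset.univ \ Z) \ Finset.univ.biUnion A
  let δ ← marginals (A i) C
  match τ.argmax C δ with
  | some x => pure (Function.update A i (insert x (A i)))
  | none => pure A

/-- `r` rounds, in each of which every `A i`, `i = 1, …, ℓ`, receives one element in turn. -/
noncomputable def interlace (τ : TieBreaking) (Z : Finset (U ⊕ Fin d)) {ℓ : ℕ} (r : ℕ)
    (A : Fin ℓ → Finset (U ⊕ Fin d)) : Prog U (Fin ℓ → Finset (U ⊕ Fin d)) :=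
  (List.range r).foldlM (fun A _ => (List.finRange ℓ).foldlM (interlaceStep τ Z) A) A

/-- The starting sets `A_{u,1}, …, A_{u,ℓ}`, for `u = 0` and for `1 ≤ u ≤ ℓ`. -/
def startSets {ℓ : ℕ} (G : Finset (U ⊕ Fin d)) (a : Fin ℓ → U ⊕ Fin d) (u : Fin (ℓ + 1)) :
    Fin ℓ → Finset (U ⊕ Fin d) :=
  Fin.cases (motive := fun _ => Fin ℓ → Finset (U ⊕ Fin d))
    (fun l => insert (a l) G) (fun u _ => insert (a u) G) u

/-- `GuidedIG-S(f, k, Z, G, ℓ)`. -/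
noncomputable def guidedIGS (τ : TieBreaking) (k : ℕ) (Z G : Finset (U ⊕ Fin d)) (ℓ : ℕ) :
    Prog U (Finset (Finset (U ⊕ Fin d))) := do
  let C := Finset.univ \ (G ∪ Z)
  let δ ← marginals G C
  -- the top `ℓ` elements of `C`
  match τ.pick? {a : Fin ℓ → U ⊕ Fin d | Function.Injective a ∧ (∀ i, a i ∈ C) ∧
      ∀ x ∈ C, (∀ i, a i ≠ x) → ∀ i, δ x ≤ δ (a i)} with
  | none => pure ∅
  | some a =>
    (List.finRange (ℓ + 1)).foldlM (fun out u => do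
      let A ← interlace τ Z (k / ℓ - 1) (startSets G a u)
      pure (out ∪ Finset.univ.image A)) ∅

/-! ### Guided interlaced greedy, matroid constraint -/

open scoped Classical in
/-- One greedy step on the pair consisting of the set `A` of all elements added so far and the
sets `A_1, …, A_ℓ`, which partition it. -/
noncomputable def greedyStep (τ : TieBreaking) (I : Constraint U) (Z G : Finset (U ⊕ Fin d))
    {ℓ : ℕ} (s : Finset (U ⊕ Fin d) × (Fin ℓ → Finset (U ⊕ Fin d))) :
    Prog U (Finset (U ⊕ Fin d) × (Fin ℓ → Finset (U ⊕ Fin d))) := do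
  let X := (Finset.univ \ (G ∪ s.1 ∪ Z)).filter fun x => I.ExtFeasible (insert x s.1)
  let b ← queryAll (List.finRange ℓ) fun j => G ∪ s.2 j
  let v ← queryAll (Finset.univ ×ˢ X).toList fun p : Fin ℓ × (U ⊕ Fin d) =>
    insert p.2 (G ∪ s.2 p.1)
  match τ.argmax (Finset.univ ×ˢ X) fun p => v p - b p.1 with
  | some p => pure (insert p.2 s.1, Function.update s.2 p.1 (insert p.2 (s.2 p.1)))
  | none => pure s

/-- `(G ∪ B) \ σ⁻¹(B)`, for `σ` a bijection from `G` onto a superset of `B`. -/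
def exchange (G : Finset (U ⊕ Fin d)) (σ : U ⊕ Fin d → U ⊕ Fin d) (B : Finset (U ⊕ Fin d)) :
    Finset (U ⊕ Fin d) :=
  (G ∪ B) \ G.filter fun g => σ g ∈ B

/-- `GuidedIG-M(f, I, Z, G, ℓ)`. Here `Maximal I.ExtFeasible` says that a set is a basis. -/
noncomputable def guidedIGM (τ : TieBreaking) (I : Constraint U) (Z G : Finset (U ⊕ Fin d))
    (ℓ : ℕ) : Prog U (Finset (Finset (U ⊕ Fin d))) := do
  let s ← (List.range I.rank).foldlM (fun s _ => greedyStep τ I Z G s)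
    ((∅, fun _ => ∅) : Finset (U ⊕ Fin d) × (Fin ℓ → Finset (U ⊕ Fin d)))
  match τ.pick? {σ : U ⊕ Fin d → U ⊕ Fin d | Set.BijOn σ G s.1 ∧
      ∀ j, Maximal I.ExtFeasible (exchange G σ (s.2 j))} with
  | some σ => pure (Finset.univ.image fun j => exchange G σ (s.2 j))
  | none => pure ∅

/-! ### The deterministic algorithm -/

/-- The subroutine that matches the type of the constraint. -/
noncomputable def guidedIG (τ : TieBreaking) (I : Constraint U) (Z G : Finset (U ⊕ Fin d))
    (ℓ : ℕ) : Prog U (Finset (Finset (U ⊕ Fin d))) :=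
  match I with
  | .size k => guidedIGS τ k Z G ℓ
  | .matroid M => guidedIGM τ (.matroid M) Z G ℓ

/-- The empty starting set; for a matroid it is filled up with dummy elements to a basis. -/
noncomputable def emptyStart : Constraint U → Finset (U ⊕ Fin d)
  | .size _ => ∅
  | .matroid M => pad (Constraint.matroid M).rank ∅

end Ext

/-- The number of rounds: the largest integer `ℓ ≤ 10 / (9 ε)`. -/
noncomputable def rounds (ε : ℝ) : ℕ := ⌊10 / (9 * ε)⌋₊

/-- The deterministic algorithm with constraint `I`, initial solution `Z₀`, switch point `t` and
error rate `ε`: local search for `Z`, then all paths of the guided interpolated greedy algorithm,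
with guidance set `Z` in the rounds `i ≤ t ℓ` and `∅` afterwards; the best set is returned.
The ground set is extended by `3 k` dummy elements. -/
noncomputable def guidedDet {U : Type} [Fintype U] [DecidableEq U] (τ : TieBreaking)
    (I : Constraint U) (Z₀ : Finset U) (t ε : ℝ) : Prog U (Finset U) := do
  let Z : Finset (U ⊕ Fin (3 * I.rank)) ← fastLS τ I Z₀ ε
  let ℓ := rounds ε
  let 𝒢 ← (List.range ℓ).foldlM (fun 𝒢 i => do
    let W := if ((i + 1 : ℕ) : ℝ) ≤ t * ℓ then Z else ∅
    𝒢.toList.foldlM (fun out A => do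
      let new ← guidedIG τ I W A ℓ
      pure (out ∪ new)) ∅) {emptyStart I}
  let v ← queryAll (insert Z 𝒢).toList id
  match τ.argmax (insert Z 𝒢) v with
  | some A => pure A.toLeft
  | none => pure Z.toLeft

end GuidedSM

set_option linter.unusedSectionVars false

namespace GuidedSM

/-! ### Reasoning about query algorithms -/

/-! Let o = f(O), x = f(O ∪ Z), y = f(O ∩ Z) and D = f(O \ Z) - f(O ∪ Z); submodularity gives D ≥ o
- x - y. Summing the failed swaps of the local search along an exchange bijection between Z and O
gives x + y ≤ (2 + ε) f(Z), and failed swaps with dummies give y ≤ (1 + ε) f(Z) (`runs_fastLS`). So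
either Z is already good enough, or x and y are small, D is large, and building a solution that
avoids Z pays off.

A round starting from G is analysed by averaging over the sets A that it returns. Greedy choice
makes the gains pay for the elements of O \ W. For a size constraint this is a charging argument
(`Certificate`, `IsRound.certificate`); for a matroid it compares the greedy basis with O through an
exchange bijection (`IsGreedy.union_sub_le_sum`), and a multiple exchange theorem
(`exists_exchange_partition`) turns the greedy parts into bases again. Since the added parts are
disjoint outside O ∪ W ∪ G, f(O ∪ W ∪ A) decreases little on average. The result is a linear
recursion for the pair f(A), f(O ∪ W ∪ A).

No single set need be good in both coordinates, so the bounds (`StepBound`, `FamilyBound`) provide a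
set for every nonnegative weighting of the pair. The recursion has nonnegative coefficients, hence a
weighting after a round pulls back to one before it: weights are fixed backwards from the last
round, where only f(A) counts, and sets are then chosen forwards. The algorithm need not know the
weights because it keeps all paths (`runs_enumerate`). When guidance stops, all sets are disjoint
from Z, so the reference set O ∪ Z can be replaced by O at the price of the constant o - x.

The recursions are bounded below in closed form (`PathBound.size`, `PathBound.matroid`). If the
output were too small, then f(Z) would be too, which bounds x and y; what remains is an inequality
linear in o, x, y, D. It is checked exactly for fewer than 20 rounds and through exponential
estimates otherwise. The query bound combines a geometric sum over the paths with the bound k / (ε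
α₀) on the number of swaps. -/

/-- With the oracle `f`, the algorithm `p` halts after at most `B` queries, and its output
satisfies `Q`. -/
def Runs {U : Type} (f : Finset U → ℝ) {α : Type} (p : Prog U α) (Q : α → Prop) (B : ℕ) : Prop :=
  ∃ (a : α) (q : ℕ), Eval f p a q ∧ Q a ∧ q ≤ B

section Runs

variable {U : Type} {f : Finset U → ℝ} {α β : Type}

theorem Runs.mono {p : Prog U α} {Q Q' : α → Prop} {B B' : ℕ} (h : Runs f p Q B)
    (hQ : ∀ a, Q a → Q' a) (hB : B ≤ B') : Runs f p Q' B' := by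
  obtain ⟨a, q, h₁, h₂, h₃⟩ := h
  exact ⟨a, q, h₁, hQ a h₂, h₃.trans hB⟩

theorem Runs.pure {a : α} {Q : α → Prop} {B : ℕ} (h : Q a) :
    Runs f (Pure.pure a : Prog U α) Q B :=
  ⟨a, 0, Eval.ret a, h, Nat.zero_le _⟩

theorem Runs.bind {p : Prog U α} {g : α → Prog U β} {Q : α → Prop} {R : β → Prop} {B C : ℕ}
    (hp : Runs f p Q B) (hg : ∀ a, Q a → Runs f (g a) R C) : Runs f (p >>= g) R (B + C) := by
  obtain ⟨a, q, h₁, h₂, h₃⟩ := hp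
  obtain ⟨b, q', k₁, k₂, k₃⟩ := hg a h₂
  exact ⟨b, q + q', Eval.bind h₁ k₁, k₂, add_le_add h₃ k₃⟩

theorem Runs.query (S : Finset U) : Runs f (Prog.query S) (fun v => v = f S) 1 :=
  ⟨f S, 1, Eval.query S, rfl, le_rfl⟩

/-- The invariant refers to the processed prefix, and each step sees how the list splits. For a list
without repetitions a step can thus use that its element has not occurred before. -/
theorem Runs.foldlM {σ ι : Type} {body : σ → ι → Prog U σ} {cost : ι → ℕ}
    (Inv : List ι → σ → Prop) (l : List ι)
    (step : ∀ pre x suf s, l = pre ++ x :: suf → Inv pre s →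
      Runs f (body s x) (Inv (pre ++ [x])) (cost x))
    {s : σ} (hs : Inv [] s) : Runs f (l.foldlM body s) (Inv l) (l.map cost).sum := by
  suffices H : ∀ (suf pre : List ι) (s : σ), l = pre ++ suf → Inv pre s →
      Runs f (suf.foldlM body s) (Inv l) (suf.map cost).sum from H l [] s rfl hs
  intro suf
  induction suf with
  | nil =>
    intro pre s hl h
    rw [List.append_nil] at hl
    exact Runs.pure (hl ▸ h)
  | cons x suf ih =>
    intro pre s hl h
    rw [List.map_cons, List.sum_cons]
    exact (step pre x suf s hl h).bind fun s' h' =>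
      ih (pre ++ [x]) s' (by simp [hl]) h'

theorem Runs.foldlM_range {σ : Type} {body : σ → ℕ → Prog U σ} {cost : ℕ → ℕ}
    (Inv : ℕ → σ → Prop) (n : ℕ)
    (step : ∀ i s, i < n → Inv i s → Runs f (body s i) (Inv (i + 1)) (cost i))
    {s : σ} (hs : Inv 0 s) :
    Runs f ((List.range n).foldlM body s) (Inv n) (∑ i ∈ Finset.range n, cost i) := by
  have h := Runs.foldlM (f := f) (body := body) (cost := cost)
    (fun pre s => Inv pre.length s) (List.range n) (by
      intro pre x suf s hl h
      have hlen : n = pre.length + (suf.length + 1) := by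
        simpa using congrArg List.length hl
      have hx : x = pre.length := by
        have h1 : (List.range n)[pre.length]? = some x := by rw [hl]; simp
        rw [List.getElem?_range (by omega)] at h1
        exact (Option.some_inj.1 h1).symm
      rw [List.length_append, List.length_singleton, ← hx]
      exact step x s (by omega) (hx ▸ h)) hs
  refine h.mono (fun a ha => by simpa using ha) (le_of_eq ?_)
  clear hs step h
  induction n with
  | zero => simp
  | succ n ih => simp [List.range_succ, Finset.sum_range_succ, ih]

/-- A loop with an invariant and a natural-number variant. -/
theorem Runs.loop {σ : Type} {body : σ → Prog U (σ ⊕ β)} {Inv : σ → Prop} {Q : β → Prop}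
    (rank : σ → ℕ) {c : ℕ}
    (step : ∀ s, Inv s → Runs f (body s)
      (Sum.elim (fun s' => Inv s' ∧ rank s' < rank s) Q) c)
    {s : σ} (hs : Inv s) : Runs f (Prog.loop body s) Q ((rank s + 1) * c) := by
  induction hn : rank s using Nat.strong_induction_on generalizing s with
  | _ n ih =>
    obtain ⟨a, q, h₁, h₂, h₃⟩ := step s hs
    cases a with
    | inr b => exact ⟨b, q, Eval.loop_done h₁, h₂, by nlinarith⟩
    | inl s' =>
      obtain ⟨b, q', k₁, k₂, k₃⟩ := ih (rank s') (hn ▸ h₂.2) h₂.1 rfl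
      have h4 : rank s' + 1 ≤ n := hn ▸ h₂.2
      exact ⟨b, q + q', Eval.loop_step h₁ k₁, k₂, by nlinarith⟩

end Runs

/-! ### Submodular functions -/

section Submod

variable {V : Type} [DecidableEq V] {F : Finset V → ℝ}

/-- Diminishing returns, iterated over the elements of S \ T added once to S ∩ T and once to T. -/
theorem Submodular.union_add_inter_le (hF : Submodular F) (S T : Finset V) :
    F (S ∪ T) + F (S ∩ T) ≤ F S + F T := by
  have key : ∀ D : Finset V, ∀ A B : Finset V, A ⊆ B → Disjoint D B →
      F (D ∪ B) - F B ≤ F (D ∪ A) - F A := by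
    intro D
    induction D using Finset.induction_on with
    | empty => intro A B _ _; simp
    | insert x D hx ih =>
      intro A B hAB hD
      rw [Finset.disjoint_insert_left] at hD
      have h1 := ih A B hAB hD.2
      have h2 := hF (D ∪ A) (D ∪ B) (Finset.union_subset_union_right hAB) x
        (by simp [hx, hD.1])
      rw [Finset.insert_union, Finset.insert_union]
      linarith
  have h := key (S \ T) (S ∩ T) T Finset.inter_subset_right Finset.sdiff_disjoint
  rw [Finset.sdiff_union_self_eq_union, Finset.sdiff_union_inter] at h
  linarith

/-- The lattice inequality for D ∪ A and B; the condition on D makes their intersection equal to A.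
-/
theorem Submodular.union_sub_le (hF : Submodular F) {A B D : Finset V} (hAB : A ⊆ B)
    (hD : D ∩ B ⊆ A) : F (D ∪ B) - F B ≤ F (D ∪ A) - F A := by
  have h := hF.union_add_inter_le (D ∪ A) B
  have h1 : D ∪ A ∪ B = D ∪ B := by
    rw [Finset.union_assoc, Finset.union_eq_right.2 hAB]
  have h2 : (D ∪ A) ∩ B = A := by
    rw [Finset.union_inter_distrib_right, Finset.inter_eq_left.2 hAB, Finset.union_eq_right.2 hD]
  rw [h1, h2] at h
  linarith

theorem Submodular.insert_sub_le (hF : Submodular F) {A B : Finset V} (hAB : A ⊆ B) {x : V}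
    (hx : x ∉ B ∨ x ∈ A) : F (insert x B) - F B ≤ F (insert x A) - F A := by
  rcases hx with hx | hx
  · exact hF A B hAB x hx
  · rw [Finset.insert_eq_of_mem hx, Finset.insert_eq_of_mem (hAB hx)]; simp

theorem Submodular.union_sub_le_sum (hF : Submodular F) (S T : Finset V) :
    F (T ∪ S) - F S ≤ ∑ x ∈ T, (F (insert x S) - F S) := by
  induction T using Finset.induction_on with
  | empty => simp
  | insert x T hx ih =>
    rw [Finset.sum_insert hx, Finset.insert_union]
    have : F (insert x (T ∪ S)) - F (T ∪ S) ≤ F (insert x S) - F S := by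
      refine hF.insert_sub_le Finset.subset_union_right ?_
      by_cases h : x ∈ S <;> simp [h, hx]
    linarith

theorem Submodular.sum_sub_erase_le (hF : Submodular F) (S D : Finset V) (hD : D ⊆ S) :
    ∑ a ∈ D, (F S - F (S.erase a)) ≤ F S - F (S \ D) := by
  induction D using Finset.induction_on with
  | empty => simp
  | insert x D hx ih =>
    rw [Finset.insert_subset_iff] at hD
    rw [Finset.sum_insert hx]
    have h := hF.union_add_inter_le (S \ D) (S.erase x)
    have h1 : S \ D ∪ S.erase x = S := by
      ext y; simp only [Finset.mem_union, Finset.mem_sdiff, Finset.mem_erase]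
      constructor
      · tauto
      · intro hy
        by_cases hyx : y = x
        · subst hyx; exact Or.inl ⟨hy, hx⟩
        · exact Or.inr ⟨hyx, hy⟩
    have h2 : S \ D ∩ S.erase x = S \ insert x D := by
      ext y; simp only [Finset.mem_inter, Finset.mem_sdiff, Finset.mem_erase, Finset.mem_insert]
      tauto
    rw [h1, h2] at h
    have := ih hD.2
    linarith

/-- The pieces meet only inside X, so each new piece is added by the lattice inequality with
intersection exactly X. This drives the averaging over the returned sets and, applied to the rank
function, the counting condition for basis exchange. -/
theorem Submodular.le_sum_union (hF : Submodular F) {ι : Type} [DecidableEq ι] (s : Finset ι)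
    (X : Finset V) (P : ι → Finset V) (hP : ∀ i j, i ≠ j → P i ∩ P j ⊆ X) :
    F (X ∪ s.biUnion P) - F X ≤ ∑ i ∈ s, (F (X ∪ P i) - F X) := by
  induction s using Finset.induction_on with
  | empty => simp
  | insert i s hi ih =>
    rw [Finset.sum_insert hi]
    have h := hF.union_add_inter_le (X ∪ P i) (X ∪ s.biUnion P)
    have h1 : X ∪ P i ∪ (X ∪ s.biUnion P) = X ∪ (insert i s).biUnion P := by
      rw [Finset.biUnion_insert]; ext y; simp only [Finset.mem_union]; tauto
    have h2 : (X ∪ P i) ∩ (X ∪ s.biUnion P) = X := by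
      rw [← Finset.union_inter_distrib_left, Finset.union_eq_left]
      intro y hy
      simp only [Finset.mem_inter, Finset.mem_biUnion] at hy
      obtain ⟨hy1, j, hj, hy2⟩ := hy
      exact hP i j (fun h => hi (h ▸ hj)) (Finset.mem_inter.2 ⟨hy1, hy2⟩)
    rw [h1, h2] at h
    linarith

/-- Losses grow as a set shrinks, so disjoint pieces removed separately cost no more than when
removed together. For nonnegative `F` the total is thus at most `F X`, however many pieces there
are. -/
theorem Submodular.sum_sdiff_le (hF : Submodular F) {ι : Type} [DecidableEq ι] (s : Finset ι)
    (X : Finset V) (B : ι → Finset V) (hB : ∀ i j, i ≠ j → Disjoint (B i) (B j)) :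
    ∑ i ∈ s, (F X - F (X \ B i)) ≤ F X - F (X \ s.biUnion B) := by
  induction s using Finset.induction_on with
  | empty => simp
  | insert i s hi ih =>
    rw [Finset.sum_insert hi]
    have hd : Disjoint (B i) (s.biUnion B) := by
      rw [Finset.disjoint_biUnion_right]
      exact fun j hj => hB i j fun h => hi (h ▸ hj)
    have h := hF.union_add_inter_le (X \ B i) (X \ s.biUnion B)
    have h1 : X \ B i ∪ X \ s.biUnion B = X := by
      rw [← Finset.sdiff_inter_distrib_right, Finset.disjoint_iff_inter_eq_empty.1 hd,
        Finset.sdiff_empty]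
    have h2 : X \ B i ∩ (X \ s.biUnion B) = X \ (insert i s).biUnion B := by
      rw [Finset.biUnion_insert, Finset.sdiff_union_distrib]
    rw [h1, h2] at h
    linarith

end Submod

/-! ### The extended ground set -/

section Ext

variable {U : Type} [Fintype U] [DecidableEq U] {d : ℕ} {f : Finset U → ℝ}

/-- The extension of `f` to the ground set with dummy elements. -/
def extend (f : Finset U → ℝ) (S : Finset (U ⊕ Fin d)) : ℝ := f S.toLeft

theorem toLeft_insert_inr (S : Finset (U ⊕ Fin d)) (i : Fin d) :
    (insert (Sum.inr i) S).toLeft = S.toLeft := by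
  ext; simp

theorem toLeft_union (S T : Finset (U ⊕ Fin d)) : (S ∪ T).toLeft = S.toLeft ∪ T.toLeft := by
  ext; simp

theorem toLeft_inter (S T : Finset (U ⊕ Fin d)) : (S ∩ T).toLeft = S.toLeft ∩ T.toLeft := by
  ext; simp

theorem extend_insert_inr (S : Finset (U ⊕ Fin d)) (i : Fin d) :
    extend f (insert (Sum.inr i) S) = extend f S := by
  simp only [extend, toLeft_insert_inr]

theorem extend_disjSum (S : Finset U) (T : Finset (Fin d)) :
    extend f (S.disjSum T) = f S := by
  simp [extend]

theorem submodular_extend (hf : Submodular f) :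
    Submodular (extend f : Finset (U ⊕ Fin d) → ℝ) := by
  intro S T hST x hx
  cases x with
  | inr i => simp [extend_insert_inr]
  | inl u =>
    have h : ∀ R : Finset (U ⊕ Fin d), (insert (Sum.inl u) R).toLeft = insert u R.toLeft := by
      intro R; ext; simp
    simp only [extend, h]
    exact hf _ _ (Finset.toLeft_subset_toLeft hST) u (by simpa using hx)

theorem runs_oracle (S : Finset (U ⊕ Fin d)) :
    Runs f (oracle S) (fun v => v = extend f S) 1 := Runs.query _

theorem runs_queryAll {ι : Type} [DecidableEq ι] (l : List ι) (q : ι → Finset (U ⊕ Fin d)) :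
    Runs f (queryAll l q) (fun v => ∀ i ∈ l, v i = extend f (q i)) l.length := by
  induction l with
  | nil => exact Runs.pure (by simp)
  | cons i l ih =>
    rw [List.length_cons, add_comm]
    refine (runs_oracle (q i)).bind fun v hv => ?_
    refine (ih.bind (C := 0) fun w hw => Runs.pure fun j hj => ?_).mono (fun _ h => h) (by simp)
    by_cases h : j = i
    · subst h; simp [hv]
    · rw [Function.update_of_ne h]
      exact hw j (by simpa [h] using hj)

theorem runs_marginals (A C : Finset (U ⊕ Fin d)) :
    Runs f (marginals A C) (fun δ => ∀ x ∈ C, δ x = extend f (insert x A) - extend f A)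
      (C.card + 1) := by
  rw [add_comm]
  refine (runs_oracle A).bind fun b hb => ?_
  refine ((runs_queryAll C.toList _).bind (C := 0) fun v hv => Runs.pure fun x hx => ?_).mono
    (fun _ h => h) (by simp)
  show v x - b = _
  rw [hv x (by simpa using hx), hb]

theorem TieBreaking.pick?_eq_some {τ : TieBreaking} {α : Type} {s : Set α} {a : α}
    (h : τ.pick? s = some a) : a ∈ s := by
  unfold TieBreaking.pick? at h
  split_ifs at h with hs
  rw [← Option.some_inj.1 h]
  exact τ.pick_mem s hs

theorem TieBreaking.pick?_eq_none {τ : TieBreaking} {α : Type} {s : Set α}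
    (h : τ.pick? s = none) : s = ∅ := by
  unfold TieBreaking.pick? at h
  split_ifs at h with hs
  exact Set.not_nonempty_iff_eq_empty.1 hs

theorem TieBreaking.argmax_eq_some {τ : TieBreaking} {α : Type} {s : Finset α} {v : α → ℝ} {a : α}
    (h : τ.argmax s v = some a) : a ∈ s ∧ ∀ y ∈ s, v y ≤ v a :=
  TieBreaking.pick?_eq_some (s := {x | x ∈ s ∧ ∀ y ∈ s, v y ≤ v x}) h

theorem TieBreaking.argmax_eq_none {τ : TieBreaking} {α : Type} {s : Finset α} {v : α → ℝ}
    (h : τ.argmax s v = none) : s = ∅ := by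
  by_contra hs
  obtain ⟨x, hx, hmax⟩ := s.exists_max_image v (Finset.nonempty_iff_ne_empty.2 hs)
  have := TieBreaking.pick?_eq_none h
  exact (Set.eq_empty_iff_forall_notMem.1 this x) ⟨hx, hmax⟩

end Ext


/-! ### Matroid exchange theorems -/

section Partition

variable {V : Type} [DecidableEq V] {ι : Type} [Fintype ι] [DecidableEq ι]

/-- Matroid partition for monotone integer-valued submodular functions, with prescribed
elements `B i`. -/
theorem exists_partition_of_le_sum [Nonempty ι] (ρ : ι → Finset V → ℤ)
    (hsub : ∀ i S T, ρ i (S ∪ T) + ρ i (S ∩ T) ≤ ρ i S + ρ i T)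
    (hmono : ∀ i S q, ρ i S ≤ ρ i (insert q S)) (Q : Finset V) :
    ∀ (B : ι → Finset V) (c : ℤ), (∀ S ⊆ Q, c + S.card ≤ ∑ i, ρ i (B i ∪ S)) →
    ∃ P : ι → Finset V, (∀ i j, i ≠ j → Disjoint (P i) (P j)) ∧ Finset.univ.biUnion P = Q ∧
      c + Q.card ≤ ∑ i, ρ i (B i ∪ P i) := by
  induction Q using Finset.induction_on with
  | empty =>
    intro B c h
    exact ⟨fun _ => ∅, by simp, by ext; simp, h ∅ le_rfl⟩
  | insert q Q hq ih =>
    intro B c h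
    -- Some `B j` can absorb `q` so that the counting condition improves by one. Otherwise every `j`
    -- has a violating set `S j`; it is tight, and `q` adds nothing to `ρ j` on top of it. Tightness
    -- passes to the union T of these sets, where `q` then adds nothing to any `ρ i`, contradicting
    -- the hypothesis for `insert q T`.
    have hstep : ∃ j, ∀ S ⊆ Q,
        c + 1 + S.card ≤ ∑ i, ρ i (Function.update B j (insert q (B j)) i ∪ S) := by
      by_contra! hcon
      choose S hSQ hS using hcon
      have hsum : ∀ j, ∑ i, ρ i (Function.update B j (insert q (B j)) i ∪ S j) =
          ∑ i, ρ i (B i ∪ S j) + (ρ j (insert q (B j ∪ S j)) - ρ j (B j ∪ S j)) := by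
        intro j
        rw [← Finset.add_sum_erase _ _ (Finset.mem_univ j),
          ← Finset.add_sum_erase Finset.univ (fun i => ρ i (B i ∪ S j)) (Finset.mem_univ j)]
        have : ∑ i ∈ Finset.univ.erase j, ρ i (Function.update B j (insert q (B j)) i ∪ S j) =
            ∑ i ∈ Finset.univ.erase j, ρ i (B i ∪ S j) :=
          Finset.sum_congr rfl fun i hi => by
            rw [Function.update_of_ne (Finset.ne_of_mem_erase hi)]
        rw [this, Function.update_self, Finset.insert_union]
        ring
      have hlow : ∀ T ⊆ Q, c + T.card ≤ ∑ i, ρ i (B i ∪ T) := fun T hT =>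
        h T (hT.trans (Finset.subset_insert q Q))
      have htight : ∀ j, ∑ i, ρ i (B i ∪ S j) = c + (S j).card := fun j => by
        have h1 := hS j
        rw [hsum] at h1
        have h2 := hmono j (B j ∪ S j) q
        have h3 := hlow (S j) (hSQ j)
        omega
      have hgain : ∀ j, ρ j (insert q (B j ∪ S j)) - ρ j (B j ∪ S j) ≤ 0 := fun j => by
        have h1 := hS j
        rw [hsum, htight] at h1
        omega
      -- Uncrossing: the lower bounds for the union and the intersection of two tight sets force
      -- both to be tight.
      have hU : ∀ s : Finset ι, s.Nonempty →
          ∑ i, ρ i (B i ∪ s.biUnion S) = c + (s.biUnion S).card := by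
        intro s
        induction s using Finset.induction_on with
        | empty => simp
        | insert j s hj ihs =>
          intro _
          rcases s.eq_empty_or_nonempty with rfl | hs
          · simpa using htight j
          · rw [Finset.biUnion_insert]
            have h1 : ∑ i, ρ i (B i ∪ (S j ∪ s.biUnion S)) + ∑ i, ρ i (B i ∪ (S j ∩ s.biUnion S)) ≤
                ∑ i, ρ i (B i ∪ S j) + ∑ i, ρ i (B i ∪ s.biUnion S) := by
              rw [← Finset.sum_add_distrib, ← Finset.sum_add_distrib]
              refine Finset.sum_le_sum fun i _ => ?_
              have := hsub i (B i ∪ S j) (B i ∪ s.biUnion S)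
              rwa [← Finset.union_union_distrib_left, ← Finset.union_inter_distrib_left] at this
            have h2 := hlow (S j ∩ s.biUnion S) (Finset.inter_subset_left.trans (hSQ j))
            have h3 := hlow (S j ∪ s.biUnion S) (Finset.union_subset (hSQ j)
              (Finset.biUnion_subset.2 fun i _ => hSQ i))
            have h4 := Finset.card_union_add_card_inter (S j) (s.biUnion S)
            have h5 := ihs hs
            have h6 := htight j
            omega
      set T := Finset.univ.biUnion S with hT
      have hTQ : T ⊆ Q := Finset.biUnion_subset.2 fun i _ => hSQ i
      have h1 := h (insert q T) (Finset.insert_subset_insert q hTQ)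
      have h2 : ∑ i, ρ i (B i ∪ insert q T) ≤ ∑ i, ρ i (B i ∪ T) := by
        refine Finset.sum_le_sum fun i _ => ?_
        have h3 := hsub i (insert q (B i ∪ S i)) (B i ∪ T)
        have hST : S i ⊆ T := Finset.subset_biUnion_of_mem S (Finset.mem_univ i)
        have h4 : insert q (B i ∪ S i) ∪ (B i ∪ T) = B i ∪ insert q T := by
          ext y; have := @hST y
          simp only [Finset.mem_union, Finset.mem_insert]; tauto
        have h5 : ρ i (B i ∪ S i) ≤ ρ i (insert q (B i ∪ S i) ∩ (B i ∪ T)) := by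
          by_cases hqT : q ∈ B i ∪ T
          · have : insert q (B i ∪ S i) ∩ (B i ∪ T) = insert q (B i ∪ S i) := by
              rw [Finset.inter_eq_left, Finset.insert_subset_iff]
              exact ⟨hqT, Finset.union_subset_union_right hST⟩
            rw [this]; exact hmono i _ q
          · refine le_of_eq (congrArg _ ?_)
            rw [Finset.insert_inter_of_notMem hqT, Finset.inter_eq_left.2
              (Finset.union_subset_union_right hST)]
        have h6 := hgain i
        rw [h4] at h3
        omega
      have h3 := hU Finset.univ Finset.univ_nonempty
      rw [← hT] at h3
      rw [Finset.card_insert_of_notMem fun hh => hq (hTQ hh)] at h1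
      push_cast at h1
      omega
    obtain ⟨j, hj⟩ := hstep
    obtain ⟨P, hP1, hP2, hP3⟩ := ih _ _ hj
    have hqP : ∀ i, q ∉ P i := fun i hi =>
      hq (hP2 ▸ Finset.mem_biUnion.2 ⟨i, Finset.mem_univ i, hi⟩)
    refine ⟨Function.update P j (insert q (P j)), ?_, ?_, ?_⟩
    · intro a b hab
      by_cases ha : a = j
      · subst ha
        rw [Function.update_self, Function.update_of_ne hab.symm, Finset.disjoint_insert_left]
        exact ⟨hqP b, hP1 _ _ hab⟩
      · by_cases hb : b = j
        · subst hb
          rw [Function.update_self, Function.update_of_ne ha, Finset.disjoint_insert_right]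
          exact ⟨hqP a, hP1 _ _ hab⟩
        · rw [Function.update_of_ne ha, Function.update_of_ne hb]
          exact hP1 _ _ hab
    · rw [← hP2]
      ext y
      simp only [Finset.mem_biUnion, Finset.mem_univ, true_and, Finset.mem_insert]
      constructor
      · rintro ⟨i, hi⟩
        by_cases hij : i = j
        · subst hij
          rw [Function.update_self, Finset.mem_insert] at hi
          exact hi.imp_right fun h => ⟨i, h⟩
        · rw [Function.update_of_ne hij] at hi
          exact Or.inr ⟨i, hi⟩
      · rintro (rfl | ⟨i, hi⟩)
        · exact ⟨j, by simp⟩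
        · refine ⟨i, ?_⟩
          by_cases hij : i = j
          · subst hij; simp [hi]
          · rwa [Function.update_of_ne hij]
    · rw [Finset.card_insert_of_notMem hq]
      refine le_trans (by push_cast; omega) (hP3.trans (Finset.sum_le_sum fun i _ => ?_))
      refine le_of_eq (congrArg _ ?_)
      by_cases hij : i = j
      · subst hij; simp
      · rw [Function.update_of_ne hij, Function.update_of_ne hij]

end Partition

/-! ### Rank of finite sets and exchange between bases. -/

section Matroid

variable {V : Type} [DecidableEq V] (N : Matroid V)

/-- The rank of a finite set. -/
noncomputable def rk (S : Finset V) : ℤ := (N.eRk S).toNat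

theorem coe_toNat_eRk (S : Finset V) : ((N.eRk S).toNat : ℕ∞) = N.eRk S := by
  refine ENat.natCast_toNat (ne_top_of_le_ne_top ?_ (N.eRk_le_encard S))
  rw [Set.encard_coe_eq_coe_finsetCard]
  exact ENat.natCast_ne_top _

theorem rk_union_add_rk_inter_le (S T : Finset V) :
    rk N (S ∪ T) + rk N (S ∩ T) ≤ rk N S + rk N T := by
  have h := N.eRk_inter_add_eRk_union_le S T
  rw [← Finset.coe_union, ← Finset.coe_inter, ← coe_toNat_eRk N (S ∪ T),
    ← coe_toNat_eRk N (S ∩ T), ← coe_toNat_eRk N S, ← coe_toNat_eRk N T] at h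
  simp only [rk]
  norm_cast at h ⊢
  omega

variable {N} in
theorem rk_mono {S T : Finset V} (h : S ⊆ T) : rk N S ≤ rk N T := by
  have h := N.eRk_mono (Finset.coe_subset.2 h)
  rw [← coe_toNat_eRk, ← coe_toNat_eRk N T] at h
  simp only [rk]
  exact_mod_cast h

theorem rk_le_card (S : Finset V) : rk N S ≤ S.card := by
  have h := N.eRk_le_encard S
  rw [← coe_toNat_eRk, Set.encard_coe_eq_coe_finsetCard] at h
  simp only [rk]
  exact_mod_cast h

variable {N} in
theorem indep_iff_rk_eq_card {S : Finset V} : N.Indep S ↔ rk N S = S.card := by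
  rw [Matroid.indep_iff_eRk_eq_encard_of_finite S.finite_toSet, ← coe_toNat_eRk,
    Set.encard_coe_eq_coe_finsetCard, rk]
  norm_cast

theorem rk_insert_le (x : V) (S : Finset V) : rk N (insert x S) ≤ rk N S + 1 := by
  have h := N.eRk_insert_le_add_one x S
  rw [← Finset.coe_insert, ← coe_toNat_eRk, ← coe_toNat_eRk N S] at h
  simp only [rk]
  exact_mod_cast h

theorem rk_le_of_forall_indep {k : ℕ} (hk : ∀ S : Finset V, N.Indep S → S.card ≤ k)
    (S : Finset V) : rk N S ≤ k := by
  obtain ⟨I, hI⟩ := N.exists_isBasis' (S : Set V)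
  have hfin : I.Finite := S.finite_toSet.subset hI.subset
  obtain ⟨I, rfl⟩ := hfin.exists_finset_coe
  have h := hI.eRk_eq_encard
  rw [← coe_toNat_eRk, Set.encard_coe_eq_coe_finsetCard] at h
  have h' := hk I hI.indep
  simp only [rk]
  norm_cast at h ⊢
  omega

theorem submodular_rk : Submodular fun S => (rk N S : ℝ) := by
  intro S T hST x hx
  have h := rk_union_add_rk_inter_le N T (insert x S)
  have h1 : T ∪ insert x S = insert x T := by
    rw [Finset.union_insert, Finset.union_eq_left.2 hST]
  have h2 : T ∩ insert x S = S := by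
    rw [Finset.inter_insert_of_notMem hx, Finset.inter_eq_right.2 hST]
  rw [h1, h2] at h
  have h' : (rk N (insert x T) : ℝ) + rk N S ≤ rk N T + rk N (insert x S) := by exact_mod_cast h
  simp only
  linarith

variable {N}

/-- Multiple symmetric exchange: a partition of a basis `A` can be matched by a partition of a
basis `G`. -/
theorem exists_exchange_partition {ι : Type} [Fintype ι] [DecidableEq ι] [Nonempty ι] {k : ℕ}
    (hk : ∀ S : Finset V, N.Indep S → S.card ≤ k) {G A : Finset V} (hG : N.Indep G)
    (hA : N.Indep A) (hGk : G.card = k) (hAk : A.card = k) (P : ι → Finset V)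
    (hPA : Finset.univ.biUnion P = A) (hP : ∀ i j, i ≠ j → Disjoint (P i) (P j)) :
    ∃ B : ι → Finset V, (∀ i j, i ≠ j → Disjoint (B i) (B j)) ∧ Finset.univ.biUnion B = G ∧
      ∀ j, (B j).card = (P j).card ∧ ((G \ B j) ∪ P j).card = k ∧
        N.Indep (((G \ B j) ∪ P j : Finset V) : Set V) := by
  have hsd : ∀ S ⊆ G, rk N (G \ S) = k - S.card := by
    intro S hS
    have : N.Indep ((G \ S : Finset V) : Set V) :=
      hG.subset (Finset.coe_subset.2 Finset.sdiff_subset)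
    rw [indep_iff_rk_eq_card.1 this, Finset.card_sdiff_of_subset hS, hGk,
      Nat.cast_sub (hGk ▸ Finset.card_le_card hS)]
  -- For S ⊆ G the chosen function is the rank that `P i` adds to G \ S; it is at most |S|, with
  -- equality iff (G \ S) ∪ P i has rank `k`. Written with |S ∩ G| it is submodular and monotone in
  -- every S, because deleting one element lowers the rank by at most one.
  obtain ⟨B, hB1, hB2, hB3⟩ := exists_partition_of_le_sum
    (fun i S => rk N ((G \ S) ∪ P i) - k + ((S ∩ G).card : ℤ)) (by
      intro i S T
      have h := rk_union_add_rk_inter_le N ((G \ S) ∪ P i) ((G \ T) ∪ P i)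
      have h1 : (G \ S) ∪ P i ∪ ((G \ T) ∪ P i) = (G \ (S ∩ T)) ∪ P i := by
        ext; simp only [Finset.mem_union, Finset.mem_sdiff, Finset.mem_inter]; tauto
      have h2 : ((G \ S) ∪ P i) ∩ ((G \ T) ∪ P i) = (G \ (S ∪ T)) ∪ P i := by
        ext; simp only [Finset.mem_union, Finset.mem_sdiff, Finset.mem_inter]; tauto
      have h3 := Finset.card_union_add_card_inter (S ∩ G) (T ∩ G)
      rw [← Finset.union_inter_distrib_right, ← Finset.inter_inter_distrib_right] at h3
      rw [h1, h2] at h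
      omega) (by
      intro i S q
      by_cases hq : q ∈ G ∧ q ∉ S
      · have h1 := rk_insert_le N q ((G \ insert q S) ∪ P i)
        have h2 : insert q ((G \ insert q S) ∪ P i) = insert q ((G \ S) ∪ P i) := by
          ext y; simp only [Finset.mem_union, Finset.mem_sdiff, Finset.mem_insert]; tauto
        have h3 : rk N ((G \ S) ∪ P i) ≤ rk N (insert q ((G \ S) ∪ P i)) :=
          rk_mono (Finset.subset_insert _ _)
        rw [Finset.insert_inter_of_mem hq.1, Finset.card_insert_of_notMem (by simp [hq.2])]
        rw [h2] at h1
        push_cast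
        omega
      · have h1 : G \ insert q S = G \ S := by
          ext y; simp only [Finset.mem_sdiff, Finset.mem_insert]
          constructor
          · tauto
          · rintro ⟨hy, hyS⟩
            refine ⟨hy, ?_⟩
            rintro (rfl | h)
            · exact hq ⟨hy, hyS⟩
            · exact hyS h
        rw [h1]
        have : (S ∩ G).card ≤ (insert q S ∩ G).card :=
          Finset.card_le_card (Finset.inter_subset_inter_right (Finset.subset_insert _ _))
        omega) G (fun _ => ∅) 0 (by
      intro S hS
      -- The counting condition: together the parts of the basis `A` restore the rank |S| that is
      -- missing from G \ S.
      have h := (submodular_rk N).le_sum_union Finset.univ (G \ S) P fun i j hij => by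
        rw [Finset.disjoint_iff_inter_eq_empty.1 (hP i j hij)]; exact Finset.empty_subset _
      rw [hPA] at h
      have h1 : rk N A ≤ rk N (G \ S ∪ A) := rk_mono Finset.subset_union_right
      rw [indep_iff_rk_eq_card.1 hA, hAk] at h1
      have h2 : rk N (G \ S ∪ A) - rk N (G \ S) ≤ ∑ i, (rk N (G \ S ∪ P i) - rk N (G \ S)) := by
        exact_mod_cast h
      rw [hsd S hS] at h2
      simp only [Finset.empty_union, Finset.inter_eq_left.2 hS]
      have h3 : ∑ i, (rk N (G \ S ∪ P i) - ((k : ℤ) - S.card)) =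
          ∑ i, (rk N (G \ S ∪ P i) - (k : ℤ) + S.card) :=
        Finset.sum_congr rfl fun _ _ => by ring
      omega)
  have hBG : ∀ j, B j ⊆ G := fun j => hB2 ▸ Finset.subset_biUnion_of_mem B (Finset.mem_univ j)
  simp only [Finset.empty_union, zero_add, hGk] at hB3
  have hcard : ∀ j, ((B j ∩ G).card : ℤ) = (B j).card := fun j => by
    rw [Finset.inter_eq_left.2 (hBG j)]
  have hle : ∀ j, rk N (G \ B j ∪ P j) - k + ((B j ∩ G).card : ℤ) ≤ (B j).card := fun j => by
    have := rk_le_of_forall_indep N hk (G \ B j ∪ P j)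
    have := hcard j
    omega
  have hBcard : ∑ j, (B j).card = k := by
    rw [← hGk, ← hB2, Finset.card_biUnion fun i _ j _ hij => hB1 i j hij]
  have hPcard : ∑ j, (P j).card = k := by
    rw [← hAk, ← hPA, Finset.card_biUnion fun i _ j _ hij => hP i j hij]
  -- The bounds `hle` are attained in total, hence each of them is. The same device below turns |B
  -- j| ≤ |P j| into equality, since both families partition sets of `k` elements.
  have heq : ∀ j, rk N (G \ B j ∪ P j) = k := by
    intro j
    have h1 : ∑ j, (rk N (G \ B j ∪ P j) - k + ((B j ∩ G).card : ℤ)) = ∑ j, ((B j).card : ℤ) := by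
      refine le_antisymm (Finset.sum_le_sum fun j _ => hle j) ?_
      rw [← Nat.cast_sum, hBcard]
      exact hB3
    have h2 := (Finset.sum_eq_sum_iff_of_le fun j _ => hle j).1 h1 j (Finset.mem_univ j)
    have := hcard j
    omega
  have hcle : ∀ j, (G \ B j ∪ P j).card ≤ k - (B j).card + (P j).card := fun j => by
    refine (Finset.card_union_le _ _).trans ?_
    rw [Finset.card_sdiff_of_subset (hBG j), hGk]
  have hBk : ∀ j, (B j).card ≤ k := fun j => hGk ▸ Finset.card_le_card (hBG j)
  have hBP : ∀ j, (B j).card ≤ (P j).card := fun j => by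
    have h1 := rk_le_card N (G \ B j ∪ P j)
    have h2 := heq j
    have h3 := hcle j
    have h4 := hBk j
    omega
  have hBP' : ∀ j, (B j).card = (P j).card := fun j =>
    (Finset.sum_eq_sum_iff_of_le fun j _ => hBP j).1 (hBcard.trans hPcard.symm) j
      (Finset.mem_univ j)
  refine ⟨B, hB1, hB2, fun j => ?_⟩
  have h0 : (G \ B j ∪ P j).card = k := by
    have h1 := rk_le_card N (G \ B j ∪ P j)
    have h2 := heq j
    have h3 := hcle j
    have h4 := hBk j
    have h5 := hBP' j
    omega
  exact ⟨hBP' j, h0, indep_iff_rk_eq_card.2 (by rw [heq j, h0])⟩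

/-- Exchange bijection between two bases. -/
theorem exists_exchange_bijOn {k : ℕ} (hk : ∀ S : Finset V, N.Indep S → S.card ≤ k)
    {X Y : Finset V} (hX : N.Indep X) (hY : N.Indep Y) (hXk : X.card = k) (hYk : Y.card = k) :
    ∃ β : V → V, Set.BijOn β Y X ∧ ∀ e ∈ Y,
      N.Indep ((insert e (X.erase (β e)) : Finset V) : Set V) ∧ (e ∈ X → β e = e) := by
  rcases Y.eq_empty_or_nonempty with rfl | hne
  · have : X = ∅ := by
      rw [← Finset.card_eq_zero, hXk, ← hYk, Finset.card_empty]
    subst this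
    exact ⟨id, by simp, by simp⟩
  have : Nonempty Y := hne.to_subtype
  obtain ⟨B, hB1, hB2, hB3⟩ := exists_exchange_partition (ι := Y) hk hX hY hXk hYk
    (fun e => {e.1}) (by ext y; simp) (by
      intro i j hij
      simpa using fun h => hij (Subtype.ext h))
  have hone : ∀ e : Y, ∃ b, B e = {b} := fun e => Finset.card_eq_one.1 (by simp [(hB3 e).1])
  choose b hb using hone
  have hinj : Function.Injective b := by
    intro i j hij
    by_contra h
    have := hB1 i j h
    rw [hb, hb, hij] at this
    simp at this
  have hmem : ∀ e, b e ∈ X := fun e => by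
    rw [← hB2]
    exact Finset.mem_biUnion.2 ⟨e, Finset.mem_univ e, by simp [hb]⟩
  have hval : ∀ e (he : e ∈ Y), (fun e => if h : e ∈ Y then b ⟨e, h⟩ else e) e = b ⟨e, he⟩ :=
    fun e he => by simp [he]
  refine ⟨fun e => if h : e ∈ Y then b ⟨e, h⟩ else e, ⟨?_, ?_, ?_⟩, ?_⟩
  · intro e he
    rw [hval e he]
    exact hmem _
  · intro e he e' he' h
    rw [hval e he, hval e' he'] at h
    exact congrArg Subtype.val (hinj h)
  · intro x hx
    rw [Finset.mem_coe, ← hB2, Finset.mem_biUnion] at hx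
    obtain ⟨e, -, he⟩ := hx
    rw [hb, Finset.mem_singleton] at he
    exact ⟨e.1, e.2, by rw [hval e.1 e.2, he]⟩
  · intro e he
    rw [hval e he]
    obtain ⟨-, h2, h3⟩ := hB3 ⟨e, he⟩
    rw [hb, Finset.sdiff_singleton_eq_erase] at h2 h3
    constructor
    · rwa [Finset.union_comm, ← Finset.insert_eq] at h3
    -- If `e` already lies in `X` and another element were removed, the exchanged set would have
    -- only `k - 1` elements.
    · intro heX
      by_contra hne
      have : X.erase (b ⟨e, he⟩) ∪ {e} = X.erase (b ⟨e, he⟩) :=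
        Finset.union_eq_left.2 (by simpa [heX] using fun h => hne h.symm)
      simp only at h2
      rw [this, Finset.card_erase_of_mem (hmem _), hXk] at h2
      have : 0 < X.card := Finset.card_pos.2 ⟨_, hmem ⟨e, he⟩⟩
      omega

end Matroid

/-! ### Feasible sets with dummies as the independent sets of a matroid. -/

section ExtMatroid

variable {U : Type} [Fintype U] [DecidableEq U] {d : ℕ}

theorem Constraint.Feasible.subset {I : Constraint U} {S T : Finset U} (hT : I.Feasible T)
    (h : S ⊆ T) : I.Feasible S := by
  cases I with
  | size k => exact (Finset.card_le_card h).trans hT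
  | matroid M => exact Matroid.Indep.subset hT (Finset.coe_subset.2 h)

theorem Constraint.feasible_empty (I : Constraint U) : I.Feasible ∅ := by
  cases I with
  | size k => simp [Constraint.Feasible]
  | matroid M => simp [Constraint.Feasible]

theorem Constraint.Feasible.card_le_rank {I : Constraint U} {S : Finset U} (hS : I.Feasible S) :
    S.card ≤ I.rank := by
  cases I with
  | size k => exact hS
  | matroid M =>
    have h := Matroid.Indep.encard_le_eRank hS
    rw [Set.encard_coe_eq_coe_finsetCard] at h
    have hfin : M.eRank ≠ ⊤ := ne_top_of_le_ne_top (Set.toFinite M.E).encard_lt_top.ne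
      (M.eRank_le_encard_ground)
    rw [← ENat.natCast_toNat hfin] at h
    exact_mod_cast h

theorem Constraint.Feasible.exists_insert {I : Constraint U} {S T : Finset U} (hS : I.Feasible S)
    (hT : I.Feasible T) (h : S.card < T.card) : ∃ x ∈ T, x ∉ S ∧ I.Feasible (insert x S) := by
  cases I with
  | size k =>
    obtain ⟨x, hx, hxS⟩ := Finset.exists_mem_notMem_of_card_lt_card h
    refine ⟨x, hx, hxS, ?_⟩
    have h1 : T.card ≤ k := hT
    have := Finset.card_insert_le x S
    show (insert x S).card ≤ k
    omega
  | matroid M =>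
    obtain ⟨x, hx, hxS⟩ := Matroid.Indep.exists_insert_of_encard_lt (M := M) hS hT (by
      rw [Set.encard_coe_eq_coe_finsetCard, Set.encard_coe_eq_coe_finsetCard]
      exact_mod_cast h)
    exact ⟨x, hx.1, hx.2, by simpa [Constraint.Feasible] using hxS⟩

theorem Constraint.extFeasible_empty (I : Constraint U) :
    I.ExtFeasible (∅ : Finset (U ⊕ Fin d)) := by
  refine ⟨?_, by simp⟩
  rw [show (∅ : Finset (U ⊕ Fin d)).toLeft = ∅ by ext; simp]
  exact I.feasible_empty

theorem Constraint.ExtFeasible.subset {I : Constraint U} {S T : Finset (U ⊕ Fin d)}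
    (hT : I.ExtFeasible T) (h : S ⊆ T) : I.ExtFeasible S :=
  ⟨hT.1.subset (Finset.toLeft_subset_toLeft h), (Finset.card_le_card h).trans hT.2⟩

theorem Constraint.ExtFeasible.insert_inr {I : Constraint U} {S : Finset (U ⊕ Fin d)}
    (hS : I.ExtFeasible S) (h : S.card < I.rank) (i : Fin d) :
    I.ExtFeasible (insert (Sum.inr i) S) :=
  ⟨by rw [toLeft_insert_inr]; exact hS.1, (Finset.card_insert_le _ _).trans h⟩

/-- A dummy of T outside S can always be added, since S is below the cardinality bound. If there is
none, the surplus of T lies in `U`, where the augmentation property of the constraint applies. -/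
theorem Constraint.ExtFeasible.exists_insert {I : Constraint U} {S T : Finset (U ⊕ Fin d)}
    (hS : I.ExtFeasible S) (hT : I.ExtFeasible T) (h : S.card < T.card) :
    ∃ x ∈ T, x ∉ S ∧ I.ExtFeasible (insert x S) := by
  have hSk : S.card < I.rank := h.trans_le hT.2
  by_cases hr : T.toRight ⊆ S.toRight
  · have h1 := Finset.card_toLeft_add_card_toRight (u := S)
    have h2 := Finset.card_toLeft_add_card_toRight (u := T)
    have h3 := Finset.card_le_card hr
    obtain ⟨x, hx, hxS, hf⟩ := hS.1.exists_insert hT.1 (by omega)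
    refine ⟨Sum.inl x, by simpa using hx, by simpa using hxS, ?_, ?_⟩
    · convert hf using 1; ext; simp
    · exact (Finset.card_insert_le _ _).trans hSk
  · obtain ⟨i, hi, hiS⟩ := Finset.not_subset.1 hr
    exact ⟨Sum.inr i, by simpa using hi, by simpa using hiS, hS.insert_inr hSk i⟩

/-- The matroid of the feasible sets in the extended ground set. -/
noncomputable def extMatroid (I : Constraint U) (d : ℕ) : Matroid (U ⊕ Fin d) :=
  (IndepMatroid.ofFinset Set.univ I.ExtFeasible
    I.extFeasible_empty
    (fun _ _ hJ h => hJ.subset h)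
    (fun _ _ hS hT h => hS.exists_insert hT h)
    (fun _ _ => Set.subset_univ _)).matroid

theorem extMatroid_indep {I : Constraint U} {S : Finset (U ⊕ Fin d)} :
    (extMatroid I d).Indep S ↔ I.ExtFeasible S := by
  rw [extMatroid, IndepMatroid.matroid_Indep, IndepMatroid.ofFinset_indep]

theorem card_le_of_extMatroid_indep {I : Constraint U} (S : Finset (U ⊕ Fin d))
    (hS : (extMatroid I d).Indep S) : S.card ≤ I.rank :=
  (extMatroid_indep.1 hS).2

theorem maximal_extFeasible {I : Constraint U} {S : Finset (U ⊕ Fin d)} (hS : I.ExtFeasible S)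
    (hk : S.card = I.rank) : Maximal I.ExtFeasible S :=
  ⟨hS, fun _ hT hST => (Finset.eq_of_subset_of_card_le hST (hk ▸ hT.2)).ge⟩

/-- A feasible set with fewer than `k` elements misses some dummy, which could be added. Hence all
bases have `k` elements. -/
theorem Maximal.card_eq {I : Constraint U} {S : Finset (U ⊕ Fin d)}
    (hS : Maximal I.ExtFeasible S) (hd : I.rank ≤ d) : S.card = I.rank := by
  refine le_antisymm hS.1.2 (not_lt.1 fun h => ?_)
  have hlt : S.toRight.card < (Finset.univ : Finset (Fin d)).card := by
    have := Finset.card_toLeft_add_card_toRight (u := S)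
    rw [Finset.card_univ, Fintype.card_fin]
    omega
  obtain ⟨i, -, hi⟩ := Finset.exists_mem_notMem_of_card_lt_card hlt
  have := hS.2 (hS.1.insert_inr h i) (Finset.subset_insert _ _)
  exact hi (by simpa using this (Finset.mem_insert_self _ _))

theorem card_pad {k : ℕ} {S : Finset U} (hS : S.card ≤ k) (hd : k ≤ d) :
    (pad k S : Finset (U ⊕ Fin d)).card = k := by
  rw [pad, Finset.card_disjSum, Fin.card_filter_val_lt]
  omega

theorem toLeft_pad (k : ℕ) (S : Finset U) : (pad k S : Finset (U ⊕ Fin d)).toLeft = S := by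
  simp [pad]

theorem extFeasible_pad {I : Constraint U} {S : Finset U} (hS : I.Feasible S) (hd : I.rank ≤ d) :
    I.ExtFeasible (pad I.rank S : Finset (U ⊕ Fin d)) :=
  ⟨by rwa [toLeft_pad], (card_pad hS.card_le_rank hd).le⟩

end ExtMatroid


/-! ### Local search -/

section LocalSearch

variable {U : Type} [Fintype U] [DecidableEq U] {d : ℕ} {f : Finset U → ℝ}

/-- No feasible swap improves `Z` by `δ` or more. -/
def IsLocalOpt (f : Finset U → ℝ) (I : Constraint U) (δ : ℝ) (Z : Finset (U ⊕ Fin d)) : Prop :=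
  ∀ a ∈ Z, ∀ e ∉ Z, I.ExtFeasible (insert e (Z.erase a)) →
    (extend f (insert e Z) - extend f Z) - (extend f Z - extend f (Z.erase a)) < δ

/-- Pigeonhole. A spare dummy keeps the candidate sets nonempty, makes the maximal marginal gains
nonnegative, and is a neutral partner for swaps. -/
theorem exists_inr_notMem {S : Finset (U ⊕ Fin d)} (h : S.card < d) :
    ∃ i : Fin d, Sum.inr i ∉ S := by
  have hlt : S.toRight.card < (Finset.univ : Finset (Fin d)).card := by
    have := Finset.card_toLeft_add_card_toRight (u := S)
    rw [Finset.card_univ, Fintype.card_fin]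
    omega
  obtain ⟨i, -, hi⟩ := Finset.exists_mem_notMem_of_card_lt_card hlt
  exact ⟨i, by simpa using hi⟩

/-- The failed swaps are summed along an exchange bijection, which maps O \ Z onto Z \ O. By
submodularity the insertions contribute at least f(O ∪ Z) - f(Z), and the deletions cost at most
f(Z) - f(Z ∩ O). -/
theorem IsLocalOpt.union_add_inter_le (hf : Submodular f) {I : Constraint U} {δ : ℝ}
    {Z O : Finset (U ⊕ Fin d)} (h : IsLocalOpt f I δ Z) (hδ : 0 ≤ δ) (hZ : I.ExtFeasible Z)
    (hO : I.ExtFeasible O) (hZk : Z.card = I.rank) (hOk : O.card = I.rank) :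
    extend f (O ∪ Z) + extend f (Z ∩ O) ≤ 2 * extend f Z + I.rank * δ := by
  have hF := submodular_extend (d := d) hf
  obtain ⟨β, hβ, hβ'⟩ := exists_exchange_bijOn (N := extMatroid I d) card_le_of_extMatroid_indep
    (extMatroid_indep.2 hZ) (extMatroid_indep.2 hO) hZk hOk
  have hinj : Set.InjOn β (O \ Z : Finset (U ⊕ Fin d)) :=
    hβ.injOn.mono (Finset.coe_subset.2 Finset.sdiff_subset)
  have himage : (O \ Z).image β = Z \ O := by
    refine Finset.eq_of_subset_of_card_le ?_ ?_
    · intro z hz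
      obtain ⟨e, he, rfl⟩ := Finset.mem_image.1 hz
      obtain ⟨heO, heZ⟩ := Finset.mem_sdiff.1 he
      have hz : β e ∈ Z := hβ.mapsTo heO
      refine Finset.mem_sdiff.2 ⟨hz, fun hO' => heZ ?_⟩
      rwa [hβ.injOn hO' heO ((hβ' _ hO').2 hz)] at hz
    · rw [Finset.card_image_of_injOn hinj, Finset.card_sdiff_comm (hZk.trans hOk.symm)]
  have h1 := hF.union_sub_le_sum Z (O \ Z)
  have h2 := hF.sum_sub_erase_le Z (Z \ O) Finset.sdiff_subset
  rw [← himage, Finset.sum_image hinj, himage, Finset.sdiff_sdiff_self_left] at h2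
  rw [Finset.sdiff_union_self_eq_union] at h1
  have h3 : ∑ e ∈ O \ Z, ((extend f (insert e Z) - extend f Z) -
      (extend f Z - extend f (Z.erase (β e)))) ≤ ∑ e ∈ O \ Z, δ := by
    refine Finset.sum_le_sum fun e he => ?_
    obtain ⟨heO, heZ⟩ := Finset.mem_sdiff.1 he
    exact (h _ (hβ.mapsTo heO) e heZ (extMatroid_indep.1 (hβ' e heO).1)).le
  rw [Finset.sum_sub_distrib, Finset.sum_const, nsmul_eq_mul] at h3
  have h4 : ((O \ Z).card : ℝ) * δ ≤ I.rank * δ := by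
    refine mul_le_mul_of_nonneg_right ?_ hδ
    exact_mod_cast hOk ▸ Finset.card_le_card Finset.sdiff_subset
  linarith

/-- Swapping an element of Z for a spare dummy is feasible and inserts no value, so a deletion
raises the value by less than `δ`; the deletions over Z \ O are then summed. -/
theorem IsLocalOpt.inter_le (hf : Submodular f) {I : Constraint U} {δ : ℝ}
    {Z : Finset (U ⊕ Fin d)} (h : IsLocalOpt f I δ Z) (hδ : 0 ≤ δ) (hZ : I.ExtFeasible Z)
    (hZk : Z.card = I.rank) (hd : I.rank < d) (O : Finset (U ⊕ Fin d)) :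
    extend f (Z ∩ O) ≤ extend f Z + I.rank * δ := by
  obtain ⟨i, hi⟩ := exists_inr_notMem (hZk ▸ hd)
  have h2 := (submodular_extend (d := d) hf).sum_sub_erase_le Z (Z \ O) Finset.sdiff_subset
  rw [Finset.sdiff_sdiff_self_left] at h2
  have h3 : ∑ a ∈ Z \ O, (-δ) ≤ ∑ a ∈ Z \ O, (extend f Z - extend f (Z.erase a)) := by
    refine Finset.sum_le_sum fun a ha => ?_
    have haZ := (Finset.mem_sdiff.1 ha).1
    have h4 := h a haZ _ hi ((hZ.subset (Finset.erase_subset a Z)).insert_inr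
      (hZk ▸ Finset.card_erase_lt_of_mem haZ) i)
    rw [extend_insert_inr] at h4
    linarith
  rw [Finset.sum_const, nsmul_eq_mul] at h3
  have h4 : ((Z \ O).card : ℝ) * δ ≤ I.rank * δ := by
    refine mul_le_mul_of_nonneg_right ?_ hδ
    exact_mod_cast hZk ▸ Finset.card_le_card Finset.sdiff_subset
  linarith

/-- Inserting `e` gains at least as much after `a` has left. The difference tested by the local
search is therefore a lower bound for the true improvement. -/
theorem Submodular.sub_add_sub_le_swap {V : Type} [DecidableEq V] {F : Finset V → ℝ}
    (hF : Submodular F) {Z : Finset V} {a e : V} (he : e ∉ Z) :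
    (F (insert e Z) - F Z) - (F Z - F (Z.erase a)) ≤ F (insert e (Z.erase a)) - F Z := by
  have := hF (Z.erase a) Z (Finset.erase_subset a Z) e he
  linarith

theorem runs_fastLSBody (τ : TieBreaking) (I : Constraint U) (ε : ℝ) (Z : Finset (U ⊕ Fin d)) :
    Runs f (fastLSBody τ I ε Z) (Sum.elim
      (fun Z' => ∃ a ∈ Z, ∃ e ∉ Z, Z' = insert e (Z.erase a) ∧ I.ExtFeasible Z' ∧
        ε / I.rank * extend f Z ≤
          (extend f (insert e Z) - extend f Z) - (extend f Z - extend f (Z.erase a)))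
      (fun Z' => Z' = Z ∧ IsLocalOpt f I (ε / I.rank * extend f Z) Z))
      (Fintype.card U + d + 1) := by
  have hcard : Fintype.card U + d + 1 =
      1 + ((Finset.univ \ Z).toList.length + (Z.toList.length + 0)) := by
    have h1 := Finset.card_sdiff_add_card_eq_card (Finset.subset_univ Z)
    rw [Finset.card_univ, Fintype.card_sum, Fintype.card_fin] at h1
    rw [Finset.length_toList, Finset.length_toList]
    omega
  rw [hcard]
  refine (runs_oracle Z).bind fun v hv => ?_
  refine (runs_queryAll _ _).bind fun add hadd => ?_
  refine (runs_queryAll _ _).bind fun del hdel => ?_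
  simp only [Finset.mem_toList, Finset.mem_sdiff, Finset.mem_univ, true_and] at hadd hdel
  split
  next s hs =>
    obtain ⟨h1, h2, h3, h4⟩ := TieBreaking.pick?_eq_some hs
    refine Runs.pure ⟨s.1, h1, s.2, h2, rfl, h3, ?_⟩
    rwa [hadd _ h2, hdel _ h1, hv] at h4
  next hs =>
    refine Runs.pure ⟨rfl, fun a ha e he hI => ?_⟩
    have := Set.eq_empty_iff_forall_notMem.1 (TieBreaking.pick?_eq_none hs) (a, e)
    by_contra hlt
    refine this ⟨ha, he, hI, ?_⟩
    rw [hadd _ he, hdel _ ha, hv]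
    exact not_lt.1 hlt

/-- The local search halts and returns a basis that guarantees the value needed for guidance. -/
theorem runs_fastLS (τ : TieBreaking) {I : Constraint U} {ε α₀ : ℝ} {O Z₀ : Finset U}
    (hf0 : ∀ S, 0 ≤ f S) (hf : Submodular f) (hε : 0 < ε) (hα₀ : 0 < α₀)
    (hO : IsOptimal f I O) (hfO : 0 < f O) (hZ₀ : I.Feasible Z₀) (hZO : α₀ * f O ≤ f Z₀)
    (hk : 1 ≤ I.rank) (hd : I.rank < d) :
    Runs f (fastLS τ I Z₀ ε : Prog U (Finset (U ⊕ Fin d)))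
      (fun Z => I.ExtFeasible Z ∧ Z.card = I.rank ∧
        f (O ∪ Z.toLeft) + f (O ∩ Z.toLeft) ≤ (2 + ε) * extend f Z ∧
        f (O ∩ Z.toLeft) ≤ (1 + ε) * extend f Z)
      ((⌊I.rank / (ε * α₀)⌋₊ + 1) * (Fintype.card U + d + 1)) := by
  have hk' : (0 : ℝ) < I.rank := by exact_mod_cast hk
  -- A lower bound for the improvement of every swap, as values stay above α₀ f(O). They also stay
  -- below f(O), so the floor of (f(O) - f(Z)) / c is a variant of the loop.
  set c : ℝ := ε / I.rank * (α₀ * f O) with hc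
  have hc0 : 0 < c := by positivity
  have hmax : ∀ Z : Finset (U ⊕ Fin d), I.ExtFeasible Z → extend f Z ≤ f O := fun Z hZ =>
    hO.2 _ hZ.1
  refine Runs.mono (Runs.loop (Inv := fun Z => I.ExtFeasible Z ∧ Z.card = I.rank ∧
    α₀ * f O ≤ extend f Z) (fun Z => ⌊(f O - extend f Z) / c⌋₊) ?_ ?_) (fun _ h => h)
    (B := (⌊(f O - extend f (pad I.rank Z₀ : Finset (U ⊕ Fin d))) / c⌋₊ + 1) *
      (Fintype.card U + d + 1)) ?_
  · rintro Z ⟨hZ, hZk, hZα⟩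
    refine (runs_fastLSBody τ I ε Z).mono ?_ le_rfl
    rintro (Z' | Z')
    · rintro ⟨a, ha, e, he, rfl, hZ', hgain⟩
      have h1 := (submodular_extend (d := d) hf).sub_add_sub_le_swap (a := a) he
      have h2 : c ≤ ε / I.rank * extend f Z :=
        mul_le_mul_of_nonneg_left hZα (by positivity)
      have h3 := hmax _ hZ'
      refine ⟨⟨hZ', ?_, by linarith⟩, ?_⟩
      · rw [Finset.card_insert_of_notMem fun h => he (Finset.mem_of_mem_erase h),
          Finset.card_erase_of_mem ha]
        omega
      · have h4 : (f O - extend f (insert e (Z.erase a))) / c + 1 ≤ (f O - extend f Z) / c := by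
          rw [← sub_nonneg, ← sub_sub, ← sub_div, sub_nonneg, le_div_iff₀ hc0]
          linarith
        have h5 : 0 ≤ (f O - extend f (insert e (Z.erase a))) / c :=
          div_nonneg (by linarith) hc0.le
        rw [← Nat.succ_le_iff, Nat.succ_eq_add_one, ← Nat.floor_add_one h5]
        exact Nat.floor_le_floor h4
    · rintro ⟨rfl, hloc⟩
      have hδ : 0 ≤ ε / I.rank * extend f Z' :=
        mul_nonneg (by positivity) (hf0 _)
      have hkδ : I.rank * (ε / I.rank * extend f Z') = ε * extend f Z' := by
        field_simp
      have h1 := hloc.union_add_inter_le hf hδ hZ (extFeasible_pad hO.1 hd.le) hZk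
        (card_pad hO.1.card_le_rank hd.le)
      have h2 := hloc.inter_le hf hδ hZ hZk hd (pad I.rank O)
      rw [hkδ] at h1 h2
      simp only [extend, toLeft_union, toLeft_inter, toLeft_pad] at h1 h2 ⊢
      rw [Finset.inter_comm] at h1 h2
      exact ⟨hZ, hZk, by linarith, by linarith⟩
  · refine ⟨extFeasible_pad hZ₀ hd.le, card_pad hZ₀.card_le_rank hd.le, ?_⟩
    rwa [extend, toLeft_pad]
  · refine Nat.mul_le_mul_right _ (Nat.succ_le_succ (Nat.floor_le_floor ?_))
    rw [hc, div_le_div_iff₀ hc0 (by positivity), sub_mul]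
    have h1 : f O * (ε * α₀) = I.rank * (ε / I.rank * (α₀ * f O)) := by field_simp
    have h2 : 0 ≤ extend f (pad I.rank Z₀ : Finset (U ⊕ Fin d)) * (ε * α₀) :=
      mul_nonneg (hf0 _) (by positivity)
    linarith

end LocalSearch


/-! ### Guided interlaced greedy, size constraint -/

section Interlace

variable {U : Type} [Fintype U] [DecidableEq U] {d : ℕ} {f : Finset U → ℝ} {L : ℕ}

/-- The outcome `A'` of one round of interlaced greedy, started from `A`. -/
def IsRound (f : Finset U → ℝ) (W : Finset (U ⊕ Fin d)) (A A' : Fin L → Finset (U ⊕ Fin d)) :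
    Prop :=
  ∃ x : Fin L → U ⊕ Fin d, Function.Injective x ∧ ∀ l, A' l = insert (x l) (A l) ∧ x l ∉ W ∧
    (∀ j, x l ∉ A j) ∧ ∀ y ∉ W, (∀ j, y ∉ A' j) →
      extend f (insert y (A l)) - extend f (A l) ≤ extend f (insert (x l) (A l)) - extend f (A l)

theorem card_univ_sum (S : Finset (U ⊕ Fin d)) : S.card ≤ Fintype.card U + d := by
  have := Finset.card_le_univ S
  rwa [Fintype.card_sum, Fintype.card_fin] at this

theorem runs_interlaceStep (τ : TieBreaking) (W : Finset (U ⊕ Fin d))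
    (A : Fin L → Finset (U ⊕ Fin d)) (i : Fin L)
    (hd : (W ∪ Finset.univ.biUnion A).card < d) :
    Runs f (interlaceStep τ W A i) (fun A' => ∃ x, x ∉ W ∧ (∀ j, x ∉ A j) ∧
      A' = Function.update A i (insert x (A i)) ∧ ∀ y ∉ W, (∀ j, y ∉ A j) →
      extend f (insert y (A i)) - extend f (A i) ≤ extend f (insert x (A i)) - extend f (A i))
      (Fintype.card U + d + 1) := by
  have hC : ∀ y, y ∈ (Finset.univ \ W) \ Finset.univ.biUnion A ↔ y ∉ W ∧ ∀ j, y ∉ A j := by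
    intro y; simp
  refine ((runs_marginals (A i) _).bind (C := 0) fun δ hδ => ?_).mono (fun _ h => h)
    (Nat.succ_le_succ (card_univ_sum _))
  split
  next x hx =>
    obtain ⟨h1, h2⟩ := TieBreaking.argmax_eq_some hx
    obtain ⟨h3, h4⟩ := (hC x).1 h1
    refine Runs.pure ⟨x, h3, h4, rfl, fun y hy hyA => ?_⟩
    have hyC := (hC y).2 ⟨hy, hyA⟩
    rw [← hδ y hyC, ← hδ x h1]
    exact h2 y hyC
  next hx =>
    have h1 := TieBreaking.argmax_eq_none hx
    obtain ⟨e, he⟩ := exists_inr_notMem hd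
    have h2 := (hC (Sum.inr e)).2 (by simpa using he)
    rw [h1] at h2
    simp at h2

theorem runs_interlace_round (τ : TieBreaking) (W : Finset (U ⊕ Fin d))
    (A : Fin L → Finset (U ⊕ Fin d)) (hd : W.card + (Finset.univ.biUnion A).card + L < d) :
    Runs f ((List.finRange L).foldlM (interlaceStep τ W) A) (IsRound f W A)
      (L * (Fintype.card U + d + 1)) := by
  refine (Runs.foldlM (cost := fun _ => Fintype.card U + d + 1) (fun pre B =>
    ∃ x : Fin L → U ⊕ Fin d, (∀ i ∈ pre, ∀ j ∈ pre, x i = x j → i = j) ∧ (∀ l ∉ pre, B l = A l) ∧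
      ∀ l ∈ pre, B l = insert (x l) (A l) ∧ x l ∉ W ∧
    (∀ j, x l ∉ A j) ∧ ∀ y ∉ W, (∀ j, y ∉ B j) →
      extend f (insert y (A l)) - extend f (A l) ≤
        extend f (insert (x l) (A l)) - extend f (A l)) (List.finRange L) ?_ ?_).mono ?_ ?_
  · rintro pre i suf B hl ⟨x, hinj, hB, hpre⟩
    have hi : i ∉ pre := by
      have := List.nodup_finRange L
      rw [hl, List.nodup_append] at this
      exact fun h => this.2.2 i h i (by simp) rfl
    have hsub : Finset.univ.biUnion B ⊆ Finset.univ.biUnion A ∪ Finset.univ.image x := by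
      intro y hy
      obtain ⟨l, -, hl⟩ := Finset.mem_biUnion.1 hy
      by_cases hlp : l ∈ pre
      · rw [(hpre l hlp).1, Finset.mem_insert] at hl
        rcases hl with rfl | hl
        · exact Finset.mem_union_right _ (Finset.mem_image_of_mem _ (Finset.mem_univ l))
        · exact Finset.mem_union_left _ (Finset.mem_biUnion.2 ⟨l, Finset.mem_univ l, hl⟩)
      · rw [hB l hlp] at hl
        exact Finset.mem_union_left _ (Finset.mem_biUnion.2 ⟨l, Finset.mem_univ l, hl⟩)
    have hcard : (W ∪ Finset.univ.biUnion B).card < d := by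
      have h1 := Finset.card_union_le W (Finset.univ.biUnion B)
      have h2 := (Finset.card_le_card hsub).trans (Finset.card_union_le _ _)
      have h3 : (Finset.univ.image x).card ≤ L := Finset.card_image_le.trans (by simp)
      omega
    have hAB : ∀ j, A j ⊆ B j := fun j => by
      by_cases hj : j ∈ pre
      · rw [(hpre j hj).1]; exact Finset.subset_insert _ _
      · rw [hB j hj]
    refine (runs_interlaceStep τ W B i hcard).mono ?_ le_rfl
    rintro B' ⟨z, hzW, hzB, rfl, hz⟩
    have hmono : ∀ j, B j ⊆ Function.update B i (insert z (B i)) j := fun j => by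
      by_cases hj : j = i
      · subst hj; simp
      · rw [Function.update_of_ne hj]
    have hne : ∀ j ∈ pre, j ≠ i := fun j hj h => hi (h ▸ hj)
    have hzx : ∀ j ∈ pre, x j ≠ z := fun j hj h => hzB j (by
      rw [(hpre j hj).1, h]; exact Finset.mem_insert_self _ _)
    refine ⟨Function.update x i z, ?_, ?_, ?_⟩
    · intro a ha b hb hab
      simp only [List.mem_append, List.mem_singleton] at ha hb
      rcases ha with ha | rfl <;> rcases hb with hb | rfl
      · rw [Function.update_of_ne (hne a ha), Function.update_of_ne (hne b hb)] at hab
        exact hinj a ha b hb hab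
      · rw [Function.update_of_ne (hne a ha), Function.update_self] at hab
        exact absurd hab (hzx a ha)
      · rw [Function.update_of_ne (hne b hb), Function.update_self] at hab
        exact absurd hab.symm (hzx b hb)
      · rfl
    · intro l hlp
      simp only [List.mem_append, List.mem_singleton, not_or] at hlp
      rw [Function.update_of_ne hlp.2]
      exact hB l hlp.1
    · intro l hlp
      simp only [List.mem_append, List.mem_singleton] at hlp
      rcases hlp with hlp | rfl
      · obtain ⟨h1, h2, h3, h4⟩ := hpre l hlp
        rw [Function.update_of_ne (hne l hlp), Function.update_of_ne (hne l hlp)]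
        exact ⟨h1, h2, h3, fun y hy hyB => h4 y hy fun j hj => hyB j (hmono j hj)⟩
      · rw [Function.update_self, Function.update_self]
        rw [hB l hi] at hz hmono ⊢
        exact ⟨rfl, hzW, fun j hj => hzB j (hAB j hj), fun y hy hyB => hz y hy fun j hj =>
          hyB j (hmono j hj)⟩
  · exact ⟨fun _ => Sum.inr ⟨0, by omega⟩, by simp, by simp, by simp⟩
  · rintro A' ⟨x, hinj, -, hx⟩
    exact ⟨x, fun i j h => hinj i (List.mem_finRange i) j (List.mem_finRange j) h,
      fun l => hx l (List.mem_finRange l)⟩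
  · simp

/-- Structure of the sets `A_1, …, A_L` that grow from `G` by `j` elements each. -/
structure IsInterlaced (W G Y : Finset (U ⊕ Fin d)) (j : ℕ) (A : Fin L → Finset (U ⊕ Fin d)) :
    Prop where
  subset : ∀ l, G ⊆ A l
  card_eq : ∀ l, (A l).card = G.card + j
  avoid : ∀ l, ∀ x ∈ A l, x ∈ G ∨ x ∉ W
  inter : ∀ l l', l ≠ l' → A l ∩ A l' ⊆ Y
  card_biUnion : (Finset.univ.biUnion A).card ≤ G.card + L * j

/-- The gain of each set pays for the marginal gains of the elements of `Q \ R`, `L + 1` of them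
for each element added; the gain `g` of the last element is still available. -/
def Certificate (f : Finset U → ℝ) (G Q : Finset (U ⊕ Fin d)) (n : ℕ)
    (A : Fin L → Finset (U ⊕ Fin d)) : Prop :=
  ∃ R ⊆ Q, (∀ y ∈ R, ∀ l, y ∉ A l) ∧ R.card ≤ (n + 1) * (L + 1) ∧ ∀ l, ∃ g : ℝ, 0 ≤ g ∧
    (∀ y ∈ R, extend f (insert y (A l)) - extend f (A l) ≤ g) ∧
    g + 1 / (L + 1) * ∑ y ∈ Q \ R, (extend f (insert y (A l)) - extend f (A l)) ≤
      extend f (A l) - extend f G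

theorem IsRound.isInterlaced {W G Y : Finset (U ⊕ Fin d)} {j : ℕ}
    {A A' : Fin L → Finset (U ⊕ Fin d)} (h : IsRound f W A A') (hA : IsInterlaced W G Y j A) :
    IsInterlaced W G Y (j + 1) A' := by
  obtain ⟨x, hinj, hx⟩ := h
  refine ⟨fun l => ?_, fun l => ?_, fun l y hy => ?_, fun l l' hll' y hy => ?_, ?_⟩
  · rw [(hx l).1]; exact (hA.subset l).trans (Finset.subset_insert _ _)
  · rw [(hx l).1, Finset.card_insert_of_notMem ((hx l).2.2.1 l), hA.card_eq l, add_assoc]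
  · rw [(hx l).1, Finset.mem_insert] at hy
    rcases hy with rfl | hy
    · exact Or.inr (hx l).2.1
    · exact hA.avoid l y hy
  · rw [(hx l).1, (hx l').1, Finset.mem_inter, Finset.mem_insert, Finset.mem_insert] at hy
    rcases hy with ⟨rfl | hy, hy' | hy'⟩
    · exact absurd (hinj hy') hll'
    · exact absurd hy' ((hx l).2.2.1 l')
    · exact absurd (hy' ▸ hy) ((hx l').2.2.1 l)
    · exact hA.inter l l' hll' (Finset.mem_inter.2 ⟨hy, hy'⟩)
  · have hsub : Finset.univ.biUnion A' ⊆ Finset.univ.biUnion A ∪ Finset.univ.image x := by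
      intro y hy
      obtain ⟨l, -, hl⟩ := Finset.mem_biUnion.1 hy
      rw [(hx l).1, Finset.mem_insert] at hl
      rcases hl with rfl | hl
      · exact Finset.mem_union_right _ (Finset.mem_image_of_mem _ (Finset.mem_univ l))
      · exact Finset.mem_union_left _ (Finset.mem_biUnion.2 ⟨l, Finset.mem_univ l, hl⟩)
    have h1 := (Finset.card_le_card hsub).trans (Finset.card_union_le _ _)
    have h2 : (Finset.univ.image x).card ≤ L := Finset.card_image_le.trans (by simp)
    have h3 := hA.card_biUnion
    rw [Nat.mul_succ]
    omega

/-- The gain `g` of the previous element bounds the marginals of all of R. It pays for a set T of at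
most L + 1 elements of R, among them all those taken by any of the sets in this round. What is left
of R was available to every set throughout the round, so the gain of the new element bounds its
marginals and becomes the next budget. -/
theorem IsRound.certificate (hf : Submodular f) {W G Q : Finset (U ⊕ Fin d)} {n : ℕ}
    {A A' : Fin L → Finset (U ⊕ Fin d)} (h : IsRound f W A A') (hQW : Disjoint Q W)
    (hd : (W ∪ Finset.univ.biUnion A').card < d) (hA : Certificate f G Q (n + 1) A) :
    Certificate f G Q n A' := by
  have hF := submodular_extend (d := d) hf
  obtain ⟨x, hinj, hx⟩ := h
  obtain ⟨R, hRQ, hRA, hRcard, hR⟩ := hA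
  have hXcard : (Finset.univ.image x).card ≤ L := Finset.card_image_le.trans (by simp)
  -- At most L elements of R are taken in the round. T contains them and is filled up to L + 1
  -- elements, so that R shrinks by L + 1 per round or is exhausted.
  obtain ⟨T, hTR, hXT, hTcard, hRT⟩ : ∃ T ⊆ R, R ∩ Finset.univ.image x ⊆ T ∧ T.card ≤ L + 1 ∧
      (R \ T).card ≤ (n + 1) * (L + 1) := by
    rcases le_or_gt R.card (L + 1) with h | h
    · exact ⟨R, le_rfl, Finset.inter_subset_left, h, by simp⟩
    · obtain ⟨T, h1, h2, h3⟩ := Finset.exists_subsuperset_card_eq (n := L + 1)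
        (Finset.inter_subset_left (s₁ := R) (s₂ := Finset.univ.image x))
        ((Finset.card_le_card Finset.inter_subset_right).trans (by omega)) h.le
      refine ⟨T, h2, h1, h3.le, ?_⟩
      rw [Finset.card_sdiff_of_subset h2, h3]
      have : (n + 1 + 1) * (L + 1) = (n + 1) * (L + 1) + (L + 1) := by ring
      omega
  have hR'A : ∀ y ∈ R \ T, ∀ l, y ∉ A' l := by
    intro y hy l hyl
    obtain ⟨hyR, hyT⟩ := Finset.mem_sdiff.1 hy
    rw [(hx l).1, Finset.mem_insert] at hyl
    rcases hyl with rfl | hyl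
    · exact hyT (hXT (Finset.mem_inter.2 ⟨hyR, Finset.mem_image_of_mem _ (Finset.mem_univ l)⟩))
    · exact hRA y hyR l hyl
  refine ⟨R \ T, Finset.sdiff_subset.trans hRQ, hR'A, hRT, fun l => ?_⟩
  obtain ⟨g, hg0, hg, hgain⟩ := hR l
  obtain ⟨h1, -, h2, h3⟩ := hx l
  have hsub : A l ⊆ A' l := by rw [h1]; exact Finset.subset_insert _ _
  have hg'0 : 0 ≤ extend f (A' l) - extend f (A l) := by
    obtain ⟨e, he⟩ := exists_inr_notMem hd
    have := h3 (Sum.inr e) (by simp at he; exact he.1) (by simp at he; simpa using he.2)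
    rwa [extend_insert_inr, sub_self, ← h1] at this
  have hdec : ∀ y, extend f (insert y (A' l)) - extend f (A' l) ≤ max 0
      (extend f (insert y (A l)) - extend f (A l)) ∧ (y ≠ x l → 
      extend f (insert y (A' l)) - extend f (A' l) ≤
        extend f (insert y (A l)) - extend f (A l)) := by
    intro y
    have hy : y ≠ x l → extend f (insert y (A' l)) - extend f (A' l) ≤
        extend f (insert y (A l)) - extend f (A l) := by
      intro hne
      refine hF.insert_sub_le hsub ?_
      rw [h1, Finset.mem_insert]
      tauto
    refine ⟨?_, hy⟩
    by_cases hyx : y = x l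
    · rw [Finset.insert_eq_of_mem (by rw [h1, hyx]; exact Finset.mem_insert_self _ _), sub_self]
      exact le_max_left _ _
    · exact (hy hyx).trans (le_max_right _ _)
  refine ⟨extend f (A' l) - extend f (A l), hg'0, fun y hy => ?_, ?_⟩
  · have hyx : y ≠ x l := fun h => hR'A y hy l (by rw [h1, h]; exact Finset.mem_insert_self _ _)
    refine ((hdec y).2 hyx).trans ?_
    have := h3 y (Finset.disjoint_left.1 hQW (hRQ (Finset.mem_sdiff.1 hy).1)) (hR'A y hy)
    rwa [← h1] at this
  · have hsplit : Q \ (R \ T) = (Q \ R) ∪ T := by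
      ext y
      have := @hTR y; have := @hRQ y
      simp only [Finset.mem_sdiff, Finset.mem_union]; tauto
    have hdisj : Disjoint (Q \ R) T :=
      Finset.disjoint_left.2 fun y hy hyT => (Finset.mem_sdiff.1 hy).2 (hTR hyT)
    have hxl : 0 ≤ extend f (insert (x l) (A l)) - extend f (A l) := h1 ▸ hg'0
    rw [hsplit, Finset.sum_union hdisj]
    -- An element already paid for without having been taken may now be `x l`. Its marginal then
    -- drops to zero, which is a decrease because the gain of `x l` is nonnegative.
    have hs1 : ∑ y ∈ Q \ R, (extend f (insert y (A' l)) - extend f (A' l)) ≤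
        ∑ y ∈ Q \ R, (extend f (insert y (A l)) - extend f (A l)) := by
      refine Finset.sum_le_sum fun y _ => ?_
      by_cases hyx : y = x l
      · exact (hdec y).1.trans (max_le (hyx ▸ hxl) le_rfl)
      · exact (hdec y).2 hyx
    have hs2 : ∑ y ∈ T, (extend f (insert y (A' l)) - extend f (A' l)) ≤ (L + 1) * g := by
      refine (Finset.sum_le_card_nsmul _ _ g fun y hy =>
        (hdec y).1.trans (max_le hg0 (hg y (hTR hy)))).trans ?_
      rw [nsmul_eq_mul]
      exact mul_le_mul_of_nonneg_right (by exact_mod_cast hTcard) hg0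
    have hL : (0 : ℝ) < L + 1 := by positivity
    have hs3 : 1 / ((L : ℝ) + 1) * (∑ y ∈ Q \ R, (extend f (insert y (A' l)) - extend f (A' l)) +
        ∑ y ∈ T, (extend f (insert y (A' l)) - extend f (A' l))) ≤
        1 / (L + 1) * (∑ y ∈ Q \ R, (extend f (insert y (A l)) - extend f (A l)) + (L + 1) * g) :=
      mul_le_mul_of_nonneg_left (add_le_add hs1 hs2) (by positivity)
    have hs4 : 1 / ((L : ℝ) + 1) * ((L + 1) * g) = g := by field_simp
    rw [mul_add _ _ (((L : ℝ) + 1) * g), hs4] at hs3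
    linarith

/-- At most L + 1 elements of Q are still unpaid, and the budget of the last added element covers
them. -/
theorem Certificate.le (hf : Submodular f) {G Q : Finset (U ⊕ Fin d)}
    {A : Fin L → Finset (U ⊕ Fin d)} (hA : Certificate f G Q 0 A) (l : Fin L) :
    1 / (L + 1) * (extend f (Q ∪ A l) - extend f (A l)) ≤ extend f (A l) - extend f G := by
  obtain ⟨R, hRQ, -, hRcard, hR⟩ := hA
  obtain ⟨g, hg0, hg, hgain⟩ := hR l
  have hL : (0 : ℝ) < L + 1 := by positivity
  have h1 := (submodular_extend (d := d) hf).union_sub_le_sum (A l) Q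
  have h2 : ∑ y ∈ R, (extend f (insert y (A l)) - extend f (A l)) ≤ (L + 1) * g := by
    refine (Finset.sum_le_card_nsmul _ _ g hg).trans ?_
    rw [nsmul_eq_mul]
    exact mul_le_mul_of_nonneg_right (by exact_mod_cast (by simpa using hRcard)) hg0
  rw [← Finset.sum_sdiff hRQ] at h1
  have h3 := mul_le_mul_of_nonneg_left (h1.trans (add_le_add_right h2 _))
    (by positivity : 0 ≤ 1 / ((L : ℝ) + 1))
  have h4 : 1 / ((L : ℝ) + 1) * ((L + 1) * g) = g := by field_simp
  rw [mul_add _ _ (((L : ℝ) + 1) * g), h4] at h3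
  linarith

theorem runs_interlace (hf : Submodular f) (τ : TieBreaking) (W G Y : Finset (U ⊕ Fin d)) (r : ℕ)
    {A : Fin L → Finset (U ⊕ Fin d)} (hA : IsInterlaced W G Y 1 A)
    (hd : W.card + G.card + L * (r + 1) < d) :
    Runs f (interlace τ W r A) (fun A' => IsInterlaced W G Y (r + 1) A' ∧
      ∀ Q, Disjoint Q W → Certificate f G Q r A → Certificate f G Q 0 A')
      (r * (L * (Fintype.card U + d + 1))) := by
  refine (Runs.foldlM_range (cost := fun _ => L * (Fintype.card U + d + 1)) (fun j A' =>
    IsInterlaced W G Y (j + 1) A' ∧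
      ∀ Q, Disjoint Q W → Certificate f G Q r A → Certificate f G Q (r - j) A') r ?_ ?_).mono ?_ ?_
  · rintro j B hj ⟨hB, hBQ⟩
    have hle : L * (j + 1 + 1) ≤ L * (r + 1) := Nat.mul_le_mul_left _ (by omega)
    have hb := hB.card_biUnion
    rw [Nat.mul_succ] at hle
    refine (runs_interlace_round τ W B (by omega)).mono (fun A' hA' => ?_) le_rfl
    have hint := hA'.isInterlaced hB
    refine ⟨hint, fun Q hQ hQA => ?_⟩
    refine hA'.certificate hf hQ ?_ ?_
    · have h1 := Finset.card_union_le W (Finset.univ.biUnion A')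
      have h2 := hint.card_biUnion
      rw [Nat.mul_succ] at h2
      omega
    · have := hBQ Q hQ hQA
      rwa [show r - j = r - (j + 1) + 1 by omega] at this
  · exact ⟨hA, fun Q _ h => h⟩
  · rintro A' ⟨h1, h2⟩
    exact ⟨h1, by simpa using h2⟩
  · simp

theorem exists_top {V : Type} [DecidableEq V] (C : Finset V) (δ : V → ℝ) :
    ∀ L ≤ C.card, ∃ T ⊆ C, T.card = L ∧ ∀ x ∈ C, x ∉ T → ∀ y ∈ T, δ x ≤ δ y := by
  intro L
  induction L with
  | zero => intro _; exact ⟨∅, by simp, by simp, by simp⟩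
  | succ L ih =>
    intro hL
    obtain ⟨T, hTC, hT, htop⟩ := ih (by omega)
    have hne : (C \ T).Nonempty := by
      rw [← Finset.card_pos, Finset.card_sdiff_of_subset hTC]
      omega
    obtain ⟨z, hz, hmax⟩ := (C \ T).exists_max_image δ hne
    obtain ⟨hzC, hzT⟩ := Finset.mem_sdiff.1 hz
    refine ⟨insert z T, Finset.insert_subset hzC hTC, ?_, fun x hx hxT y hy => ?_⟩
    · rw [Finset.card_insert_of_notMem hzT, hT]
    · rw [Finset.mem_insert, not_or] at hxT
      rw [Finset.mem_insert] at hy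
      rcases hy with rfl | hy
      · exact hmax x (Finset.mem_sdiff.2 ⟨hx, hxT.2⟩)
      · exact htop x hx hxT.2 y hy

theorem exists_top_fun {V : Type} [DecidableEq V] (C : Finset V) (δ : V → ℝ) (h : L ≤ C.card) :
    ∃ a : Fin L → V, Function.Injective a ∧ (∀ i, a i ∈ C) ∧
      ∀ x ∈ C, (∀ i, a i ≠ x) → ∀ i, δ x ≤ δ (a i) := by
  obtain ⟨T, hTC, hT, htop⟩ := exists_top C δ L h
  refine ⟨fun i => ((T.equivFinOfCardEq hT).symm i).1, fun i j hij => ?_, fun i => ?_,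
    fun x hx hxa i => ?_⟩
  · exact (T.equivFinOfCardEq hT).symm.injective (Subtype.ext hij)
  · exact hTC (Subtype.property _)
  · refine htop x hx (fun hxT => hxa (T.equivFinOfCardEq hT ⟨x, hxT⟩) ?_) _ (Subtype.property _)
    simp

/-- The common part of the sets that are started with index `u`. -/
def startBase (G : Finset (U ⊕ Fin d)) (a : Fin L → U ⊕ Fin d) (u : Fin (L + 1)) :
    Finset (U ⊕ Fin d) :=
  Fin.cases (motive := fun _ => Finset (U ⊕ Fin d)) G (fun u => insert (a u) G) u

theorem isInterlaced_startSets {W G : Finset (U ⊕ Fin d)} {a : Fin L → U ⊕ Fin d}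
    (hinj : Function.Injective a) (ha : ∀ i, a i ∉ G ∪ W) (u : Fin (L + 1)) :
    IsInterlaced W G (startBase G a u) 1 (startSets G a u) := by
  simp only [Finset.mem_union, not_or] at ha
  have key : ∀ b : Fin L → Fin L, ∀ Y, (∀ l l', l ≠ l' →
      insert (a (b l)) G ∩ insert (a (b l')) G ⊆ Y) →
      IsInterlaced W G Y 1 (fun l => insert (a (b l)) G) := by
    intro b Y hY
    refine ⟨fun l => Finset.subset_insert _ _, fun l => ?_, fun l x hx => ?_, hY, ?_⟩
    · rw [Finset.card_insert_of_notMem (ha _).1]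
    · rcases Finset.mem_insert.1 hx with rfl | hx
      · exact Or.inr (ha _).2
      · exact Or.inl hx
    · have hsub : (Finset.univ.biUnion fun l => insert (a (b l)) G) ⊆
          G ∪ Finset.univ.image a := by
        intro y hy
        obtain ⟨l, -, hl⟩ := Finset.mem_biUnion.1 hy
        rcases Finset.mem_insert.1 hl with rfl | hl
        · exact Finset.mem_union_right _ (Finset.mem_image_of_mem _ (Finset.mem_univ _))
        · exact Finset.mem_union_left _ hl
      have h1 := (Finset.card_le_card hsub).trans (Finset.card_union_le _ _)
      have h2 : (Finset.univ.image a).card ≤ L := Finset.card_image_le.trans (by simp)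
      omega
  refine Fin.cases ?_ (fun u => ?_) u
  · refine key id G fun l l' hll' y hy => ?_
    simp only [Finset.mem_inter, Finset.mem_insert, id] at hy
    rcases hy with ⟨rfl | hy, hy' | hy'⟩
    · exact absurd (hinj hy') hll'
    all_goals assumption
  · exact key (fun _ => u) _ fun l l' _ => Finset.inter_subset_left

/-- For a suitable `u`, the starting sets satisfy the certificate. -/
theorem exists_certificate_startSets (hf : Submodular f) {W G Q : Finset (U ⊕ Fin d)}
    {a : Fin L → U ⊕ Fin d} {n : ℕ}
    (htop : ∀ x ∉ G ∪ W, (∀ i, a i ≠ x) → ∀ i, extend f (insert x G) - extend f G ≤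
      extend f (insert (a i) G) - extend f G)
    (hQ : Disjoint Q (G ∪ W)) (hQcard : Q.card ≤ (n + 1) * (L + 1))
    (hd : W.card + G.card + L < d) :
    ∃ u : Fin (L + 1), Certificate f G Q n (startSets G a u) ∧ startBase G a u ⊆ G ∪ Q := by
  have hF := submodular_extend (d := d) hf
  have h0 : ∀ i, 0 ≤ extend f (insert (a i) G) - extend f G := by
    intro i
    obtain ⟨e, he⟩ := exists_inr_notMem (S := G ∪ W ∪ Finset.univ.image a) (d := d) (by
      have h1 := Finset.card_union_le (G ∪ W) (Finset.univ.image a)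
      have h2 := Finset.card_union_le G W
      have h3 : (Finset.univ.image a).card ≤ L := Finset.card_image_le.trans (by simp)
      omega)
    rw [Finset.mem_union, not_or] at he
    have := htop _ he.1 (fun j hj => he.2 (Finset.mem_image.2 ⟨j, Finset.mem_univ j, hj⟩)) i
    rwa [extend_insert_inr, sub_self] at this
  have hQG : ∀ y ∈ Q, y ∉ G ∪ W := fun y hy => Finset.disjoint_left.1 hQ hy
  -- If top elements lie in Q, the best of these dominates all marginals of Q, and every set may
  -- start with it: the overlap is in Q and hence harmless for averaging. Otherwise each `a l`
  -- dominates all of Q, and distinct starting elements work.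
  by_cases hne : (Finset.univ.filter fun i => a i ∈ Q).Nonempty
  · obtain ⟨u, hu, hmax⟩ := (Finset.univ.filter fun i => a i ∈ Q).exists_max_image
      (fun i => extend f (insert (a i) G) - extend f G) hne
    have huQ : a u ∈ Q := (Finset.mem_filter.1 hu).2
    have hbest : ∀ y ∈ Q, extend f (insert y G) - extend f G ≤
        extend f (insert (a u) G) - extend f G := by
      intro y hy
      by_cases hya : ∃ i, a i = y
      · obtain ⟨i, rfl⟩ := hya
        exact hmax i (Finset.mem_filter.2 ⟨Finset.mem_univ i, hy⟩)
      · exact htop y (hQG y hy) (not_exists.1 hya) u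
    refine ⟨u.succ, ⟨Q.erase (a u), Finset.erase_subset _ _, ?_,
      (Finset.card_le_card (Finset.erase_subset _ _)).trans hQcard, fun l =>
      ⟨_, h0 u, fun y hy => ?_, ?_⟩⟩, ?_⟩
    · intro y hy l hyl
      rcases Finset.mem_insert.1 hyl with h | h
      · exact (Finset.mem_erase.1 hy).1 h
      · exact hQG y (Finset.mem_of_mem_erase hy) (Finset.mem_union_left _ h)
    · refine (hF.insert_sub_le (Finset.subset_insert _ _) (Or.inl fun hyl => ?_)).trans
        (hbest y (Finset.mem_of_mem_erase hy))
      rcases Finset.mem_insert.1 hyl with h | h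
      · exact (Finset.mem_erase.1 hy).1 h
      · exact hQG y (Finset.mem_of_mem_erase hy) (Finset.mem_union_left _ h)
    · have : Q \ Q.erase (a u) = {a u} := by
        rw [Finset.sdiff_erase_self huQ]
      rw [this, Finset.sum_singleton]
      show _ + _ * (extend f (insert (a u) (insert (a u) G)) - extend f (insert (a u) G)) ≤ _
      rw [Finset.insert_idem, sub_self, mul_zero, add_zero]
      exact le_rfl
    · show insert (a u) G ⊆ _
      exact Finset.insert_subset (Finset.mem_union_right _ huQ) Finset.subset_union_left
  · have hnot : ∀ i, a i ∉ Q := fun i hi =>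
      hne ⟨i, Finset.mem_filter.2 ⟨Finset.mem_univ i, hi⟩⟩
    have hyA : ∀ y ∈ Q, ∀ l, y ∉ insert (a l) G := by
      intro y hy l hyl
      rcases Finset.mem_insert.1 hyl with h | h
      · exact hnot l (h ▸ hy)
      · exact hQG y hy (Finset.mem_union_left _ h)
    refine ⟨0, ⟨Q, le_rfl, hyA, hQcard, fun l => ⟨_, h0 l, fun y hy => ?_, ?_⟩⟩, ?_⟩
    · exact (hF.insert_sub_le (Finset.subset_insert _ _) (Or.inl (hyA y hy l))).trans
        (htop y (hQG y hy) (fun i hi => hnot i (hi ▸ hy)) l)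
    · rw [Finset.sdiff_self, Finset.sum_empty, mul_zero, add_zero]
      exact le_rfl
    · exact Finset.subset_union_left

end Interlace


/-! ### The gain of one round -/

section StepBound

variable {U : Type} [Fintype U] [DecidableEq U] {d : ℕ} {f : Finset U → ℝ} {L : ℕ}

/-- Whatever nonnegative weights `α` and `γ` are given to `f(A)` and `f(O ∪ W ∪ A)`, some `A` in
the family `new` is at least as good as the linear bound in terms of the previous set `G`. -/
def StepBound (f : Finset U → ℝ) (O : Finset U) (a₁ a₂ a₃ a₄ a₅ : ℝ) (W G : Finset (U ⊕ Fin d))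
    (new : Finset (Finset (U ⊕ Fin d))) : Prop :=
  ∀ α γ : ℝ, 0 ≤ α → 0 ≤ γ → ∃ A ∈ new,
    a₁ * α * extend f G + (a₂ * α + a₃ * γ) * f (O ∪ W.toLeft ∪ G.toLeft) +
      a₄ * γ * f (O ∪ W.toLeft) + a₅ * α * (f (O \ W.toLeft) - f (O ∪ W.toLeft)) ≤
    α * extend f A + γ * f (O ∪ W.toLeft ∪ A.toLeft)

theorem StepBound.mono {O : Finset U} {a₁ a₂ a₃ a₄ a₅ : ℝ} {W G : Finset (U ⊕ Fin d)}
    {new new' : Finset (Finset (U ⊕ Fin d))} (h : StepBound f O a₁ a₂ a₃ a₄ a₅ W G new)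
    (hsub : new ⊆ new') : StepBound f O a₁ a₂ a₃ a₄ a₅ W G new' := fun α γ hα hγ => by
  obtain ⟨A, hA, h'⟩ := h α γ hα hγ
  exact ⟨A, hsub hA, h'⟩

/-- Diminishing returns: as `a` avoids `w`, it adds at least as much to O \ w as to O ∪ w. This is
the benefit of guidance, since it brings in f(O \ w) - f(O ∪ w). -/
theorem Submodular.guided_le (hf : Submodular f) (O w a : Finset U) (h : Disjoint a w) :
    f (O \ w) + f (O ∪ w ∪ a) ≤ f (O \ w ∪ a) + f (O ∪ w) := by
  have key := hf.union_add_inter_le (O \ w ∪ a) (O ∪ w)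
  have h1 : O \ w ∪ a ∪ (O ∪ w) = O ∪ w ∪ a := by
    ext y; simp only [Finset.mem_union, Finset.mem_sdiff]; tauto
  have h2 : (O \ w ∪ a) ∩ (O ∪ w) = O \ w := by
    ext y
    have hy : y ∈ a → y ∉ w := fun hy => Finset.disjoint_left.1 h hy
    simp only [Finset.mem_inter, Finset.mem_union, Finset.mem_sdiff]; tauto
  rw [h1, h2] at key
  linarith

/-- The same comparison with O in place of O \ w; it serves to change the reference set when
guidance ends. -/
theorem Submodular.union_guided_le (hf : Submodular f) (O w a : Finset U) (h : Disjoint a w) :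
    f O + f (O ∪ w ∪ a) ≤ f (O ∪ a) + f (O ∪ w) := by
  have key := hf.union_add_inter_le (O ∪ a) (O ∪ w)
  have h1 : O ∪ a ∪ (O ∪ w) = O ∪ w ∪ a := by
    ext y; simp only [Finset.mem_union]; tauto
  have h2 : (O ∪ a) ∩ (O ∪ w) = O := by
    ext y
    have hy : y ∈ a → y ∉ w := fun hy => Finset.disjoint_left.1 h hy
    simp only [Finset.mem_inter, Finset.mem_union]; tauto
  rw [h1, h2] at key
  linarith

/-- Averaging over sets that are pairwise disjoint outside `X`. -/
theorem Submodular.sub_one_mul_le_sum {V : Type} [DecidableEq V] {F : Finset V → ℝ}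
    (hF : Submodular F) (hF0 : ∀ S, 0 ≤ F S) (X : Finset V) (P : Fin L → Finset V)
    (hP : ∀ i j, i ≠ j → P i ∩ P j ⊆ X) :
    (L - 1) * F X ≤ ∑ i, F (X ∪ P i) := by
  have h := hF.le_sum_union Finset.univ X P hP
  rw [Finset.sum_sub_distrib, Finset.sum_const, Finset.card_univ, Fintype.card_fin,
    nsmul_eq_mul] at h
  have := hF0 (X ∪ Finset.univ.biUnion P)
  linarith

/-- Solving `hgain` for f(A l) and applying `Submodular.guided_le` bounds f(A l) below in terms of
f(G), D and f(O ∪ W ∪ A l). In `U`, two of the sets meet only inside O ∪ W ∪ G, so the last values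
average to at least (1 - 1/L) f(O ∪ W ∪ G). The weighted sum of both coordinates is averaged, so one
index serves for both. -/
theorem stepBound_of_interlaced (hf0 : ∀ S, 0 ≤ f S) (hf : Submodular f) (hL : 1 ≤ L)
    {O : Finset U} {W G Y : Finset (U ⊕ Fin d)} {j : ℕ} {A : Fin L → Finset (U ⊕ Fin d)}
    (hA : IsInterlaced W G Y j A) (hGW : Disjoint G.toLeft W.toLeft)
    (hY : Y ⊆ G ∪ (O \ W.toLeft).disjSum ∅)
    (hgain : ∀ l, 1 / (L + 1) * (extend f ((O \ W.toLeft).disjSum ∅ ∪ A l) - extend f (A l)) ≤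
      extend f (A l) - extend f G)
    {new : Finset (Finset (U ⊕ Fin d))} (hnew : ∀ l, A l ∈ new) :
    StepBound f O ((L + 1) / (L + 2)) ((1 - 1 / L) * (1 / (L + 2))) (1 - 1 / L) 0 (1 / (L + 2))
      W G new := by
  intro α γ hα hγ
  have hLpos : (0 : ℝ) < L := by exact_mod_cast hL
  set w := W.toLeft with hw
  set D := f (O \ w) - f (O ∪ w) with hD
  set c : Fin L → ℝ := fun l => f (O ∪ w ∪ (A l).toLeft) with hc
  have hdisj : ∀ l, Disjoint (A l).toLeft w := by
    intro l
    rw [Finset.disjoint_left]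
    intro x hx hxw
    rcases hA.avoid l (Sum.inl x) (by simpa using hx) with h | h
    · exact Finset.disjoint_left.1 hGW (by simpa using h) hxw
    · exact h (by simpa [hw] using hxw)
  have h1 : ∀ l, (L + 1) / (L + 2) * extend f G + 1 / (L + 2) * (D + c l) ≤ extend f (A l) := by
    intro l
    have h2 := hgain l
    have h3 := hf.guided_le O w (A l).toLeft (hdisj l)
    have h4 : extend f ((O \ w).disjSum ∅ ∪ A l) = f (O \ w ∪ (A l).toLeft) := by
      rw [extend, toLeft_union, Finset.toLeft_disjSum]
    rw [h4] at h2
    have h5 : D + c l ≤ f (O \ w ∪ (A l).toLeft) := by simp only [hD, hc]; linarith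
    have h6 := mul_le_mul_of_nonneg_left h5 (by positivity : 0 ≤ 1 / ((L : ℝ) + 1))
    have h7 : (L + 1) * extend f G + (D + c l) ≤ (L + 2) * extend f (A l) := by
      have h8 := mul_le_mul_of_nonneg_left (h6.trans (by linarith :
        1 / ((L : ℝ) + 1) * f (O \ w ∪ (A l).toLeft) ≤
          extend f (A l) - extend f G + 1 / (L + 1) * extend f (A l)))
          (by positivity : 0 ≤ (L : ℝ) + 1)
      have h9 : ((L : ℝ) + 1) * (1 / (L + 1) * (D + c l)) = D + c l := by field_simp
      have h10 : ((L : ℝ) + 1) * (extend f (A l) - extend f G + 1 / (L + 1) * extend f (A l)) =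
        (L + 2) * extend f (A l) - (L + 1) * extend f G := by field_simp; ring
      rw [h9, h10] at h8
      linarith
    have h8 : (L + 1) / (L + 2) * extend f G + 1 / (L + 2) * (D + c l) =
        ((L + 1) * extend f G + (D + c l)) / (L + 2) := by ring
    rw [h8, div_le_iff₀ (by positivity)]
    linarith
  have h2 : (L - 1) * f (O ∪ w ∪ G.toLeft) ≤ ∑ l, c l := by
    have h := hf.sub_one_mul_le_sum hf0 (O ∪ w ∪ G.toLeft) (fun l => (A l).toLeft) (by
      intro l l' hll' y hy
      rw [← toLeft_inter] at hy
      have h3 := hY (hA.inter l l' hll' (Finset.mem_toLeft.1 hy))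
      simp only [Finset.mem_union, Finset.inl_mem_disjSum, Finset.mem_sdiff] at h3
      simp only [Finset.mem_union, Finset.mem_toLeft]
      tauto)
    refine h.trans (le_of_eq (Finset.sum_congr rfl fun l _ => ?_))
    rw [Finset.union_assoc (O ∪ w), Finset.union_eq_right.2
      (Finset.toLeft_subset_toLeft (hA.subset l))]
  have hne : (Finset.univ : Finset (Fin L)).Nonempty := ⟨⟨0, hL⟩, Finset.mem_univ _⟩
  obtain ⟨l, -, hl⟩ := Finset.exists_le_of_sum_le hne (s := Finset.univ)
    (f := fun _ => (L + 1) / (L + 2) * α * extend f G +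
      ((1 - 1 / L) * (1 / (L + 2)) * α + (1 - 1 / L) * γ) * f (O ∪ w ∪ G.toLeft) +
      0 * γ * f (O ∪ w) + 1 / (L + 2) * α * D)
    (g := fun l => α * extend f (A l) + γ * c l) (by
      have h3 : ∑ l, (α * ((L + 1) / (L + 2) * extend f G + 1 / (L + 2) * (D + c l)) + γ * c l) ≤
          ∑ l, (α * extend f (A l) + γ * c l) :=
        Finset.sum_le_sum fun l _ =>
          add_le_add_left (mul_le_mul_of_nonneg_left (h1 l) hα) _
      refine le_trans ?_ h3
      have h4 : ∑ l, (α * ((L + 1) / (L + 2) * extend f G + 1 / (L + 2) * (D + c l)) + γ * c l) =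
          ∑ l : Fin L, (α * ((L + 1) / (L + 2) * extend f G + 1 / (L + 2) * D)) +
            (α * (1 / (L + 2)) + γ) * ∑ l, c l := by
        rw [Finset.mul_sum, ← Finset.sum_add_distrib]
        exact Finset.sum_congr rfl fun l _ => by ring
      have h5 := mul_le_mul_of_nonneg_left h2
        (by positivity : 0 ≤ α * (1 / ((L : ℝ) + 2)) + γ)
      rw [h4, Finset.sum_const, Finset.sum_const, Finset.card_univ, Fintype.card_fin,
        nsmul_eq_mul, nsmul_eq_mul]
      refine le_trans (le_of_eq ?_) (add_le_add_right h5 _)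
      field_simp
      ring)
  exact ⟨A l, hnew l, hl⟩

/-- One call of the subroutine for the size constraint. -/
theorem runs_guidedIGS (hf0 : ∀ S, 0 ≤ f S) (hf : Submodular f) (τ : TieBreaking) {k : ℕ}
    (hL : 1 ≤ L) (hLk : L ≤ k) (hk : k ≤ k / L * (L + 1)) {O : Finset U} (hO : O.card ≤ k)
    {W G : Finset (U ⊕ Fin d)} (hd : W.card + G.card + L * (k / L) < d) :
    Runs f (guidedIGS τ k W G L) (fun new =>
      (∀ A ∈ new, A.card = G.card + k / L ∧ ∀ x ∈ A, x ∈ G ∨ x ∉ W) ∧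
      new.card ≤ (L + 1) * L ∧ (Disjoint G.toLeft W.toLeft →
        StepBound f O ((L + 1) / (L + 2)) ((1 - 1 / L) * (1 / (L + 2))) (1 - 1 / L) 0 (1 / (L + 2))
        W G new))
      ((Fintype.card U + d + 1) * (1 + (L + 1) * k)) := by
  set N := Fintype.card U + d with hN
  have hm : 1 ≤ k / L := (Nat.one_le_div_iff hL).2 hLk
  have hLm : L ≤ L * (k / L) := Nat.le_mul_of_pos_right L hm
  have hmk : L * (k / L) ≤ k := Nat.mul_div_le k L
  have hC : ∀ x, x ∈ Finset.univ \ (G ∪ W) ↔ x ∉ G ∪ W := by simp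
  have hCcard : L ≤ (Finset.univ \ (G ∪ W)).card := by
    have h1 := Finset.card_sdiff_add_card_eq_card (Finset.subset_univ (G ∪ W))
    have h2 := Finset.card_union_le G W
    rw [Finset.card_univ, Fintype.card_sum, Fintype.card_fin] at h1
    omega
  refine Runs.mono (B := (N + 1) + (L + 1) * ((k / L - 1) * (L * (N + 1)))) ?_ (fun _ h => h) ?_
  · refine ((runs_marginals G (Finset.univ \ (G ∪ W))).mono (fun _ h => h)
      (Nat.succ_le_succ (card_univ_sum _))).bind fun δ hδ => ?_
    split
    next hnone =>
      exfalso
      obtain ⟨a, ha⟩ := exists_top_fun (Finset.univ \ (G ∪ W)) δ hCcard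
      exact Set.eq_empty_iff_forall_notMem.1 (TieBreaking.pick?_eq_none hnone) a ha
    next a ha =>
      obtain ⟨hinj, haC, htop⟩ := TieBreaking.pick?_eq_some ha
      have haC' : ∀ i, a i ∉ G ∪ W := fun i => (hC _).1 (haC i)
      have htop' : ∀ x ∉ G ∪ W, (∀ i, a i ≠ x) → ∀ i, extend f (insert x G) - extend f G ≤
          extend f (insert (a i) G) - extend f G := by
        intro x hx hxa i
        rw [← hδ x ((hC x).2 hx), ← hδ _ (haC i)]
        exact htop x ((hC x).2 hx) hxa i
      set Q := (O \ W.toLeft).disjSum (∅ : Finset (Fin d)) \ G with hQ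
      have hQW : Disjoint Q (G ∪ W) := by
        rw [Finset.disjoint_left]
        rintro (y | y) hy hy'
        · simp only [hQ, Finset.mem_sdiff, Finset.inl_mem_disjSum, Finset.mem_toLeft] at hy
          simp only [Finset.mem_union] at hy'
          tauto
        · simp [hQ] at hy
      -- Each set receives k / L elements, and each of these can be charged L + 1 times. Charging L
      -- + 1 instead of L absorbs the rounding in k / L, by `hk`.
      have hQcard : Q.card ≤ (k / L - 1 + 1) * (L + 1) := by
        rw [Nat.sub_add_cancel hm]
        refine le_trans (Finset.card_le_card Finset.sdiff_subset) ?_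
        rw [Finset.card_disjSum, Finset.card_empty, add_zero]
        exact (Finset.card_le_card Finset.sdiff_subset).trans (hO.trans hk)
      refine (Runs.foldlM (cost := fun _ => (k / L - 1) * (L * (N + 1))) (fun pre out =>
        (∀ A ∈ out, A.card = G.card + k / L ∧ ∀ x ∈ A, x ∈ G ∨ x ∉ W) ∧
        out.card ≤ pre.length * L ∧ ∀ u ∈ pre, ∃ A : Fin L → Finset (U ⊕ Fin d),
          (∀ l, A l ∈ out) ∧ IsInterlaced W G (startBase G a u) (k / L - 1 + 1) A ∧
          ∀ Q, Disjoint Q W → Certificate f G Q (k / L - 1) (startSets G a u) →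
            Certificate f G Q 0 A) (List.finRange (L + 1)) ?_ ?_).mono ?_ ?_
      · rintro pre u suf out - ⟨h1, h2, h3⟩
        refine ((runs_interlace hf τ W G _ (k / L - 1) (isInterlaced_startSets hinj haC' u) (by
          rw [Nat.sub_add_cancel hm]; exact hd)).bind (C := 0) fun A hA => Runs.pure ?_).mono
          (fun _ h => h) le_rfl
        refine ⟨fun B hB => ?_, ?_, fun v hv => ?_⟩
        · rcases Finset.mem_union.1 hB with hB | hB
          · exact h1 B hB
          · obtain ⟨l, -, rfl⟩ := Finset.mem_image.1 hB
            have := hA.1.card_eq l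
            rw [Nat.sub_add_cancel hm] at this
            exact ⟨this, hA.1.avoid l⟩
        · have h4 := Finset.card_union_le out (Finset.univ.image A)
          have h5 : (Finset.univ.image A).card ≤ L := Finset.card_image_le.trans (by simp)
          rw [List.length_append, List.length_singleton, Nat.succ_mul]
          omega
        · rw [List.mem_append, List.mem_singleton] at hv
          rcases hv with hv | rfl
          · obtain ⟨B, hB, hB'⟩ := h3 v hv
            exact ⟨B, fun l => Finset.mem_union_left _ (hB l), hB'⟩
          · exact ⟨A, fun l => Finset.mem_union_right _ (Finset.mem_image_of_mem _
              (Finset.mem_univ l)), hA⟩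
      · exact ⟨by simp, by simp, by simp⟩
      · rintro new ⟨h1, h2, h3⟩
        refine ⟨h1, by simpa using h2, fun hGW => ?_⟩
        obtain ⟨u, hu, hbase⟩ := exists_certificate_startSets hf (n := k / L - 1) htop' hQW
          hQcard (by omega)
        obtain ⟨A, hAnew, hA, hAQ⟩ := h3 u (List.mem_finRange u)
        have hcert := hAQ Q (Finset.disjoint_of_subset_right Finset.subset_union_right hQW) hu
        refine stepBound_of_interlaced hf0 hf hL hA hGW (hbase.trans
          (Finset.union_subset_union_right Finset.sdiff_subset)) (fun l => ?_) hAnew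
        have := hcert.le hf l
        have hQA : Q ∪ A l = (O \ W.toLeft).disjSum ∅ ∪ A l := by
          ext y
          have hy : y ∈ G → y ∈ A l := fun hy => hA.subset l hy
          simp only [hQ, Finset.mem_union, Finset.mem_sdiff]; tauto
        rwa [hQA] at this
      · simp
  · have h1 : (k / L - 1) * (L * (N + 1)) ≤ k * (N + 1) := by
      rw [← mul_assoc]
      refine Nat.mul_le_mul_right _ (le_trans ?_ hmk)
      rw [mul_comm]
      exact Nat.mul_le_mul_left _ (Nat.sub_le _ _)
    calc (N + 1) + (L + 1) * ((k / L - 1) * (L * (N + 1)))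
        ≤ (N + 1) + (L + 1) * (k * (N + 1)) := by gcongr
      _ = (N + 1) * (1 + (L + 1) * k) := by ring

end StepBound


/-! ### Guided interlaced greedy, matroid constraint -/

section Greedy

variable {U : Type} [Fintype U] [DecidableEq U] {d : ℕ} {f : Finset U → ℝ} {L : ℕ}

/-- The state of the greedy algorithm after `i` steps; the gain of the element `x` bounds the
marginal gain of all elements that could take the place of `x`. -/
structure IsGreedy (f : Finset U → ℝ) (I : Constraint U) (W G : Finset (U ⊕ Fin d)) (i : ℕ)
    (s : Finset (U ⊕ Fin d) × (Fin L → Finset (U ⊕ Fin d))) : Prop where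
  feasible : I.ExtFeasible s.1
  card_eq : s.1.card = i
  avoid : Disjoint s.1 (G ∪ W)
  biUnion_eq : Finset.univ.biUnion s.2 = s.1
  disjoint : ∀ i j, i ≠ j → Disjoint (s.2 i) (s.2 j)
  exists_gain : ∃ g : U ⊕ Fin d → ℝ, (∀ x ∈ s.1, 0 ≤ g x ∧ ∀ y ∉ G ∪ W, y ∉ s.1.erase x →
    I.ExtFeasible (insert y (s.1.erase x)) → ∀ j,
      extend f (insert y (G ∪ s.2 j)) - extend f (G ∪ s.2 j) ≤ g x) ∧
    ∑ x ∈ s.1, g x = ∑ j, (extend f (G ∪ s.2 j) - extend f G)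

theorem isGreedy_zero (I : Constraint U) (W G : Finset (U ⊕ Fin d)) :
    IsGreedy f I W G 0 ((∅, fun _ => ∅) : Finset (U ⊕ Fin d) × (Fin L → Finset (U ⊕ Fin d))) where
  feasible := I.extFeasible_empty
  card_eq := rfl
  avoid := Finset.disjoint_empty_left _
  biUnion_eq := by ext; simp
  disjoint := by simp
  exists_gain := ⟨0, by simp, by simp⟩

/-- Earlier gains remain valid: whatever can replace an old element afterwards could replace it
before, by heredity, and marginals only decrease. The gain of the new element bounds its competitors
by maximality. -/
theorem IsGreedy.succ_of_max (hf : Submodular f) {I : Constraint U} {W G : Finset (U ⊕ Fin d)} {i : ℕ}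
    {s : Finset (U ⊕ Fin d) × (Fin L → Finset (U ⊕ Fin d))} (hs : IsGreedy f I W G i s)
    {j : Fin L} {x : U ⊕ Fin d} (hxs : x ∉ s.1) (hx : x ∉ G ∪ W)
    (hI : I.ExtFeasible (insert x s.1))
    (hmax : ∀ y ∉ G ∪ W, y ∉ s.1 → I.ExtFeasible (insert y s.1) → ∀ l,
      extend f (insert y (G ∪ s.2 l)) - extend f (G ∪ s.2 l) ≤
        extend f (insert x (G ∪ s.2 j)) - extend f (G ∪ s.2 j))
    (h0 : 0 ≤ extend f (insert x (G ∪ s.2 j)) - extend f (G ∪ s.2 j)) :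
    IsGreedy f I W G (i + 1) (insert x s.1, Function.update s.2 j (insert x (s.2 j))) := by
  have hF := submodular_extend (d := d) hf
  have hmem : ∀ l, s.2 l ⊆ s.1 := fun l =>
    hs.biUnion_eq ▸ Finset.subset_biUnion_of_mem s.2 (Finset.mem_univ l)
  have hmono : ∀ l, s.2 l ⊆ Function.update s.2 j (insert x (s.2 j)) l := fun l => by
    by_cases hl : l = j
    · subst hl; simp
    · rw [Function.update_of_ne hl]
  refine ⟨hI, ?_, ?_, ?_, ?_, ?_⟩
  · rw [Finset.card_insert_of_notMem hxs, hs.card_eq]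
  · exact Finset.disjoint_insert_left.2 ⟨hx, hs.avoid⟩
  · simp only
    rw [← hs.biUnion_eq]
    ext y
    simp only [Finset.mem_biUnion, Finset.mem_univ, true_and, Finset.mem_insert]
    constructor
    · rintro ⟨l, hl⟩
      by_cases hlj : l = j
      · subst hlj
        rw [Function.update_self, Finset.mem_insert] at hl
        exact hl.imp_right fun h => ⟨l, h⟩
      · rw [Function.update_of_ne hlj] at hl
        exact Or.inr ⟨l, hl⟩
    · rintro (rfl | ⟨l, hl⟩)
      · exact ⟨j, by simp⟩
      · exact ⟨l, hmono l hl⟩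
  · intro a b hab
    have hxl : ∀ l, x ∉ s.2 l := fun l h => hxs (hmem l h)
    simp only
    by_cases ha : a = j
    · subst ha
      rw [Function.update_self, Function.update_of_ne hab.symm, Finset.disjoint_insert_left]
      exact ⟨hxl b, hs.disjoint _ _ hab⟩
    · by_cases hb : b = j
      · subst hb
        rw [Function.update_self, Function.update_of_ne ha, Finset.disjoint_insert_right]
        exact ⟨hxl a, hs.disjoint _ _ hab⟩
      · rw [Function.update_of_ne ha, Function.update_of_ne hb]
        exact hs.disjoint _ _ hab
  · obtain ⟨g, hg, hsum⟩ := hs.exists_gain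
    set c := extend f (insert x (G ∪ s.2 j)) - extend f (G ∪ s.2 j) with hc
    have hstep : ∀ y z l, z ∉ G ∪ W → (y ≠ x → y ∈ s.1) → (0:ℝ) ≤ Function.update g x c y →
        (extend f (insert z (G ∪ s.2 l)) - extend f (G ∪ s.2 l) ≤ Function.update g x c y) →
        extend f (insert z (G ∪ Function.update s.2 j (insert x (s.2 j)) l)) -
          extend f (G ∪ Function.update s.2 j (insert x (s.2 j)) l) ≤
          Function.update g x c y := by
      intro y z l hz _ h1 h2
      -- An element already present has marginal zero; nonnegative gains cover this case.
      by_cases hzl : z ∈ G ∪ Function.update s.2 j (insert x (s.2 j)) l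
      · rw [Finset.insert_eq_of_mem hzl, sub_self]; exact h1
      · exact (hF.insert_sub_le (Finset.union_subset_union_right (hmono l))
          (Or.inl hzl)).trans h2
    refine ⟨Function.update g x c, fun y hy => ?_, ?_⟩
    · rcases Finset.mem_insert.1 hy with rfl | hy
      · refine ⟨by rw [Function.update_self]; exact h0, fun z hz hzs hzI l => ?_⟩
        rw [Finset.erase_insert hxs] at hzs hzI
        refine hstep y z l hz (fun h => absurd rfl h) (by rw [Function.update_self]; exact h0) ?_
        rw [Function.update_self]
        exact hmax z hz hzs hzI l
      · have hyx : y ≠ x := fun h => hxs (h ▸ hy)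
        have hsub : s.1.erase y ⊆ (insert x s.1).erase y :=
          Finset.erase_subset_erase y (Finset.subset_insert x s.1)
        have hgy := hg y hy
        refine ⟨by rw [Function.update_of_ne hyx]; exact hgy.1, fun z hz hzs hzI l => ?_⟩
        refine hstep y z l hz (fun _ => hy) (by rw [Function.update_of_ne hyx]; exact hgy.1) ?_
        rw [Function.update_of_ne hyx]
        exact hgy.2 z hz (fun h => hzs (hsub h))
          (hzI.subset (Finset.insert_subset_insert z hsub)) l
    · have h4 : ∑ y ∈ s.1, Function.update g x c y = ∑ y ∈ s.1, g y :=
        Finset.sum_congr rfl fun y hy =>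
          Function.update_of_ne (fun h : y = x => hxs (h ▸ hy)) c g
      rw [Finset.sum_insert hxs, Function.update_self, h4, hsum,
        ← Finset.add_sum_erase _ _ (Finset.mem_univ j),
        ← Finset.add_sum_erase Finset.univ (fun l => extend f (G ∪ Function.update s.2 j
          (insert x (s.2 j)) l) - extend f G) (Finset.mem_univ j)]
      have h3 : ∑ l ∈ Finset.univ.erase j, (extend f (G ∪ Function.update s.2 j
          (insert x (s.2 j)) l) - extend f G) =
          ∑ l ∈ Finset.univ.erase j, (extend f (G ∪ s.2 l) - extend f G) :=
        Finset.sum_congr rfl fun l hl => by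
          rw [Function.update_of_ne (Finset.ne_of_mem_erase hl)]
      rw [h3, Function.update_self, Finset.union_insert]
      ring

theorem runs_greedyStep (hf : Submodular f) (τ : TieBreaking) {I : Constraint U}
    {W G : Finset (U ⊕ Fin d)} {i : ℕ}
    {s : Finset (U ⊕ Fin d) × (Fin L → Finset (U ⊕ Fin d))} (hL : 1 ≤ L)
    (hs : IsGreedy f I W G i s) (hi : i < I.rank) (hd : G.card + i + W.card < d) :
    Runs f (greedyStep τ I W G s) (IsGreedy f I W G (i + 1))
      (L * (Fintype.card U + d + 1)) := by
  classical
  set X := (Finset.univ \ (G ∪ s.1 ∪ W)).filter fun x => I.ExtFeasible (insert x s.1) with hX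
  have hXmem : ∀ x, x ∈ X ↔ x ∉ G ∪ W ∧ x ∉ s.1 ∧ I.ExtFeasible (insert x s.1) := by
    intro x
    simp only [hX, Finset.mem_filter, Finset.mem_sdiff, Finset.mem_univ, true_and,
      Finset.mem_union]
    tauto
  -- While fewer than `k` elements are chosen, a spare dummy is a feasible candidate. Hence the step
  -- cannot fail, and its gain is nonnegative.
  obtain ⟨e, he⟩ := exists_inr_notMem (S := G ∪ s.1 ∪ W) (d := d) (by
    have h1 := Finset.card_union_le (G ∪ s.1) W
    have h2 := Finset.card_union_le G s.1
    have h3 := hs.card_eq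
    omega)
  have heX : Sum.inr e ∈ X := by
    simp only [hX, Finset.mem_filter, Finset.mem_sdiff, Finset.mem_univ, true_and]
    exact ⟨he, hs.feasible.insert_inr (hs.card_eq ▸ hi) e⟩
  refine Runs.mono (B := (List.finRange L).length +
    ((Finset.univ ×ˢ X : Finset (Fin L × (U ⊕ Fin d))).toList.length + 0)) ?_ (fun _ h => h) ?_
  · unfold greedyStep
    refine (runs_queryAll _ _).bind fun b hb => ?_
    refine Runs.bind (Q := fun v => ∀ p : Fin L × (U ⊕ Fin d), p.2 ∈ X →
      v p = extend f (insert p.2 (G ∪ s.2 p.1))) ((runs_queryAll _ _).mono ?_ le_rfl)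
      fun v hv => ?_
    · intro v hv p hp
      refine hv p ?_
      rw [Finset.mem_toList, Finset.mem_product]
      refine ⟨Finset.mem_univ _, ?_⟩
      convert hp
    · split
      next p hp =>
        obtain ⟨h1, h2⟩ := TieBreaking.argmax_eq_some hp
        have hpX : p.2 ∈ X := by convert (Finset.mem_product.1 h1).2
        have hmaxX : ∀ y ∈ X, ∀ l, extend f (insert y (G ∪ s.2 l)) - extend f (G ∪ s.2 l) ≤
            extend f (insert p.2 (G ∪ s.2 p.1)) - extend f (G ∪ s.2 p.1) := by
          intro y hy l
          rw [← hb l (List.mem_finRange l), ← hb p.1 (List.mem_finRange p.1), ← hv p hpX,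
            ← hv (l, y) hy]
          refine h2 (l, y) (Finset.mem_product.2 ⟨Finset.mem_univ _, ?_⟩)
          convert hy
        obtain ⟨h3, h4, h5⟩ := (hXmem _).1 hpX
        refine Runs.pure (hs.succ_of_max hf h4 h3 h5
          (fun y hy hys hyI l => hmaxX y ((hXmem y).2 ⟨hy, hys, hyI⟩) l) ?_)
        have := hmaxX _ heX p.1
        rwa [extend_insert_inr, sub_self] at this
      next hp =>
        exfalso
        have h1 := TieBreaking.argmax_eq_none hp
        have h2 : ((⟨0, hL⟩, Sum.inr e) : Fin L × (U ⊕ Fin d)) ∈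
            (Finset.univ ×ˢ X : Finset (Fin L × (U ⊕ Fin d))) :=
          Finset.mem_product.2 ⟨Finset.mem_univ _, heX⟩
        refine Finset.notMem_empty (((⟨0, hL⟩, Sum.inr e) : Fin L × (U ⊕ Fin d))) ?_
        rw [← h1]
        convert h2
  · rw [List.length_finRange, Finset.length_toList, Finset.card_product, Finset.card_univ,
      Fintype.card_fin, add_zero, mul_add, mul_one, add_comm]
    gcongr
    exact card_univ_sum X

/-- The total gain of the greedy algorithm pays for every independent set. -/
theorem IsGreedy.union_sub_le_sum (hf : Submodular f) {I : Constraint U}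
    {W G : Finset (U ⊕ Fin d)} {s : Finset (U ⊕ Fin d) × (Fin L → Finset (U ⊕ Fin d))}
    (hs : IsGreedy f I W G I.rank s) (hd : I.rank ≤ d) {Q : Finset U} (hQ : I.Feasible Q)
    (hQW : Disjoint Q W.toLeft) (j : Fin L) :
    f (Q ∪ (G ∪ s.2 j).toLeft) - extend f (G ∪ s.2 j) ≤
      ∑ l, (extend f (G ∪ s.2 l) - extend f G) := by
  obtain ⟨g, hg, hsum⟩ := hs.exists_gain
  have hQ' := extFeasible_pad hQ hd
  -- After padding to a basis, every element `e` of Q could take the place of `β e` in the greedy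
  -- basis, so its marginal is at most the gain recorded for `β e`. As `β` is a bijection, the
  -- recorded gains are summed exactly once.
  obtain ⟨β, hβ, hβ'⟩ := exists_exchange_bijOn (N := extMatroid I d) card_le_of_extMatroid_indep
    (extMatroid_indep.2 hs.feasible) (extMatroid_indep.2 hQ') hs.card_eq
    (card_pad hQ.card_le_rank hd)
  have h1 := (submodular_extend (d := d) hf).union_sub_le_sum (G ∪ s.2 j) (pad I.rank Q)
  have h2 : extend f (pad I.rank Q ∪ (G ∪ s.2 j)) = f (Q ∪ (G ∪ s.2 j).toLeft) := by
    rw [extend, toLeft_union, toLeft_pad]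
  rw [h2] at h1
  refine h1.trans ?_
  rw [← hsum]
  have himage : (pad I.rank Q).image β = s.1 := by
    rw [← Finset.coe_inj, Finset.coe_image]
    exact hβ.image_eq
  rw [← himage, Finset.sum_image hβ.injOn]
  refine Finset.sum_le_sum fun e he => ?_
  have hβe : β e ∈ s.1 := hβ.mapsTo he
  obtain ⟨hg0, hg1⟩ := hg _ hβe
  cases e with
  | inr i => rw [extend_insert_inr, sub_self]; exact hg0
  | inl u =>
    by_cases hu : Sum.inl u ∈ G ∪ s.2 j
    · rw [Finset.insert_eq_of_mem hu, sub_self]; exact hg0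
    · refine hg1 _ ?_ ?_ (extMatroid_indep.1 (hβ' _ he).1) j
      · have huQ : u ∈ Q := by
          have := Finset.mem_toLeft.2 he
          rwa [toLeft_pad] at this
        have := Finset.disjoint_left.1 hQW huQ
        simp only [Finset.mem_union, Finset.mem_toLeft] at hu this ⊢
        tauto
      -- Common elements are fixed by `β`, so `e` is not among the elements that stay.
      · intro h
        obtain ⟨h3, h4⟩ := Finset.mem_erase.1 h
        exact h3 ((hβ' _ he).2 h4).symm

theorem exists_bijOn_of_card_eq {V : Type} [DecidableEq V] {S T : Finset V}
    (h : S.card = T.card) : ∃ σ : V → V, Set.BijOn σ S T := by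
  have e := Finset.equivOfCardEq h
  refine ⟨fun x => if hx : x ∈ S then e ⟨x, hx⟩ else x, fun x hx => ?_, fun x hx y hy hxy => ?_,
    fun y hy => ?_⟩
  · simp only [Finset.mem_coe] at hx
    simp [hx]
  · simp only [Finset.mem_coe] at hx hy
    simp only [hx, hy, dif_pos] at hxy
    exact congrArg Subtype.val (e.injective (Subtype.ext hxy))
  · refine ⟨e.symm ⟨y, hy⟩, Subtype.property _, ?_⟩
    simp

/-- Bijections between corresponding parts of two partitions glue. -/
theorem exists_bijOn_of_partition {V : Type} [DecidableEq V] {ι : Type} [Fintype ι]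
    {S T : Finset V} {B P : ι → Finset V} (hB : ∀ i j, i ≠ j → Disjoint (B i) (B j))
    (hBS : Finset.univ.biUnion B = S) (hP : ∀ i j, i ≠ j → Disjoint (P i) (P j))
    (hPT : Finset.univ.biUnion P = T) (hBP : ∀ i, (B i).card = (P i).card) :
    ∃ σ : V → V, Set.BijOn σ S T ∧ ∀ i, S.filter (fun g => σ g ∈ P i) = B i := by
  choose τ hτ using fun i => exists_bijOn_of_card_eq (hBP i)
  have hmem : ∀ g ∈ S, ∃ i, g ∈ B i := fun g hg => by
    rw [← hBS, Finset.mem_biUnion] at hg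
    obtain ⟨i, -, hi⟩ := hg
    exact ⟨i, hi⟩
  have hBsub : ∀ i, B i ⊆ S := fun i => hBS ▸ Finset.subset_biUnion_of_mem B (Finset.mem_univ i)
  have hPsub : ∀ i, P i ⊆ T := fun i => hPT ▸ Finset.subset_biUnion_of_mem P (Finset.mem_univ i)
  have huB : ∀ {g i j}, g ∈ B i → g ∈ B j → i = j := fun {g i j} hi hj => by
    by_contra h; exact Finset.disjoint_left.1 (hB i j h) hi hj
  have huP : ∀ {g i j}, g ∈ P i → g ∈ P j → i = j := fun {g i j} hi hj => by
    by_contra h; exact Finset.disjoint_left.1 (hP i j h) hi hj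
  classical
  set σ : V → V := fun g => if h : ∃ i, g ∈ B i then τ h.choose g else g with hσ
  have hσB : ∀ i, ∀ g ∈ B i, σ g = τ i g := fun i g hg => by
    have h : ∃ i, g ∈ B i := ⟨i, hg⟩
    rw [hσ]
    simp only [h, dif_pos]
    rw [huB h.choose_spec hg]
  have hσP : ∀ i, ∀ g ∈ B i, σ g ∈ P i := fun i g hg => by
    rw [hσB i g hg]; exact (hτ i).mapsTo hg
  refine ⟨σ, ⟨fun g hg => ?_, fun g hg g' hg' h => ?_, fun t ht => ?_⟩, fun i => ?_⟩
  · obtain ⟨i, hi⟩ := hmem g hg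
    exact hPsub i (hσP i g hi)
  · obtain ⟨i, hi⟩ := hmem g hg
    obtain ⟨j, hj⟩ := hmem g' hg'
    have hij : i = j := huP (hσP i g hi) (h ▸ hσP j g' hj)
    subst hij
    rw [hσB i g hi, hσB i g' hj] at h
    exact (hτ i).injOn hi hj h
  · rw [Finset.mem_coe, ← hPT, Finset.mem_biUnion] at ht
    obtain ⟨i, -, hi⟩ := ht
    obtain ⟨g, hg, rfl⟩ := (hτ i).surjOn hi
    exact ⟨g, hBsub i hg, hσB i g hg⟩
  · ext g
    rw [Finset.mem_filter]
    constructor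
    · rintro ⟨hg, hgP⟩
      obtain ⟨j, hj⟩ := hmem g hg
      rwa [huP hgP (hσP j g hj)]
    · exact fun hg => ⟨hBsub i hg, hσP i g hg⟩

theorem exchange_eq {G B : Finset (U ⊕ Fin d)} {σ : U ⊕ Fin d → U ⊕ Fin d} (h : Disjoint B G) :
    exchange G σ B = (G \ G.filter fun g => σ g ∈ B) ∪ B := by
  ext y
  have hy : y ∈ B → y ∉ G := fun hy => Finset.disjoint_left.1 h hy
  simp only [exchange, Finset.mem_sdiff, Finset.mem_union, Finset.mem_filter]
  tauto

/-- Summing `hgain` over `j` and solving bounds the sum of the f(G ∪ A j) from below. Passing to (G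
\ S j) ∪ A j removes disjoint parts of G: this costs at most f(G) in total, and at most f(O ∪ W ∪ G)
- f(O ∪ W) in the second coordinate. These costs are the extra 1/L in the coefficients and the
source of the term in f(O ∪ W). -/
theorem stepBound_of_exchange (hf0 : ∀ S, 0 ≤ f S) (hf : Submodular f) (hL : 1 ≤ L)
    {O : Finset U} {W G : Finset (U ⊕ Fin d)} {A S : Fin L → Finset (U ⊕ Fin d)}
    (hGW : Disjoint G.toLeft W.toLeft) (hAW : ∀ j, Disjoint (A j) (G ∪ W))
    (hA : ∀ i j, i ≠ j → Disjoint (A i) (A j)) (hS : ∀ i j, i ≠ j → Disjoint (S i) (S j))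
    (hSG : Finset.univ.biUnion S = G)
    (hgain : ∀ j, f (O \ W.toLeft ∪ (G ∪ A j).toLeft) - extend f (G ∪ A j) ≤
      ∑ l, (extend f (G ∪ A l) - extend f G))
    {new : Finset (Finset (U ⊕ Fin d))} (hnew : ∀ j, (G \ S j) ∪ A j ∈ new) :
    StepBound f O (L / (L + 1) - 1 / L) ((1 - 1 / L) * (1 / (L + 1))) (1 - 2 / L) (1 / L)
      (1 / (L + 1)) W G new := by
  intro α γ hα hγ
  have hLpos : (0 : ℝ) < L := by exact_mod_cast hL
  have hF := submodular_extend (d := d) hf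
  have hF0 : ∀ S : Finset (U ⊕ Fin d), 0 ≤ extend f S := fun S => hf0 _
  set w := W.toLeft with hw
  set D := f (O \ w) - f (O ∪ w) with hD
  set X : Finset (U ⊕ Fin d) := (O ∪ w).disjSum ∅ with hX
  have hXval : ∀ T : Finset (U ⊕ Fin d), extend f (X ∪ T) = f (O ∪ w ∪ T.toLeft) := fun T => by
    rw [extend, toLeft_union, hX, Finset.toLeft_disjSum]
  have hXval' : extend f X = f (O ∪ w) := extend_disjSum _ _
  have hSsub : ∀ j, S j ⊆ G := fun j => hSG ▸ Finset.subset_biUnion_of_mem S (Finset.mem_univ j)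
  have hAG : ∀ j, ∀ y ∈ A j, y ∉ G := fun j y hy hyG =>
    Finset.disjoint_left.1 (hAW j) hy (Finset.mem_union_left _ hyG)
  have hdisj : ∀ j, Disjoint (G ∪ A j).toLeft w := by
    intro j
    rw [toLeft_union, Finset.disjoint_union_left]
    refine ⟨hGW, Finset.disjoint_left.2 fun x hx hxw => ?_⟩
    exact Finset.disjoint_left.1 (hAW j) (Finset.mem_toLeft.1 hx)
      (Finset.mem_union_right _ (Finset.mem_toLeft.1 hxw))
  set u : Fin L → ℝ := fun j => extend f (G ∪ A j) with hu
  set c : Fin L → ℝ := fun j => extend f (X ∪ G ∪ A j) with hc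
  have hsumu : ∑ l, (u l - extend f G) = ∑ l, u l - L * extend f G := by
    rw [Finset.sum_sub_distrib, Finset.sum_const, Finset.card_univ, Fintype.card_fin,
      nsmul_eq_mul]
  have h1 : L * D + ∑ j, c j - ∑ j, u j ≤ L * (∑ l, u l - L * extend f G) := by
    have h : ∑ j, (D + c j - u j) ≤ ∑ _j : Fin L, (∑ l, u l - L * extend f G) := by
      refine Finset.sum_le_sum fun j _ => ?_
      rw [← hsumu]
      refine le_trans ?_ (hgain j)
      have h2 := hf.guided_le O w (G ∪ A j).toLeft (hdisj j)
      have h3 : c j = f (O ∪ w ∪ (G ∪ A j).toLeft) := by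
        rw [← hXval, hc, ← Finset.union_assoc]
      rw [h3]
      simp only [hD, hu]
      linarith
    rw [Finset.sum_sub_distrib, Finset.sum_add_distrib, Finset.sum_const, Finset.sum_const,
      Finset.card_univ, Fintype.card_fin, nsmul_eq_mul, nsmul_eq_mul] at h
    exact h
  have h2 : (L - 1) * extend f (X ∪ G) ≤ ∑ j, c j :=
    hF.sub_one_mul_le_sum hF0 (X ∪ G) A fun i j hij => by
      rw [Finset.disjoint_iff_inter_eq_empty.1 (hA i j hij)]; exact Finset.empty_subset _
  have h3 : ∑ j, u j - extend f G ≤ ∑ j, extend f (G \ S j ∪ A j) := by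
    have h := hF.sum_sdiff_le Finset.univ G S hS
    have h4 : ∑ j, u j - ∑ j, (extend f G - extend f (G \ S j)) ≤
        ∑ j, extend f (G \ S j ∪ A j) := by
      rw [← Finset.sum_sub_distrib]
      refine Finset.sum_le_sum fun j _ => ?_
      have h5 := hF.union_sub_le (A := G \ S j) (B := G) (D := A j) Finset.sdiff_subset (by
        intro y hy
        obtain ⟨h6, h7⟩ := Finset.mem_inter.1 hy
        exact absurd h7 (hAG j y h6))
      rw [Finset.union_comm (A j), Finset.union_comm (A j)] at h5
      simp only [hu]
      linarith
    have := hF0 (G \ Finset.univ.biUnion S)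
    linarith
  have h4 : (L - 2) * extend f (X ∪ G) + extend f X ≤ ∑ j, extend f (X ∪ (G \ S j ∪ A j)) := by
    -- Removing `S j \ X` instead of `S j` keeps X intact, so that removing all the parts leaves
    -- exactly X.
    have h := hF.sum_sdiff_le Finset.univ (X ∪ G) (fun j => S j \ X) fun i j hij =>
      (hS i j hij).mono Finset.sdiff_subset Finset.sdiff_subset
    have h5 : (X ∪ G) \ Finset.univ.biUnion (fun j => S j \ X) = X := by
      ext y
      have hy : y ∈ G ↔ ∃ j, y ∈ S j := by rw [← hSG]; simp
      simp only [Finset.mem_sdiff, Finset.mem_union, Finset.mem_biUnion, Finset.mem_univ, true_and,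
        hy]
      constructor
      · rintro ⟨h6 | ⟨j, h6⟩, h7⟩
        · exact h6
        · by_contra h8
          exact h7 ⟨j, h6, h8⟩
      · exact fun h6 => ⟨Or.inl h6, fun ⟨j, h7⟩ => h7.2 h6⟩
    have h6 : ∀ j, (X ∪ G) \ (S j \ X) = X ∪ G \ S j := fun j => by
      ext y; simp only [Finset.mem_sdiff, Finset.mem_union]; tauto
    rw [h5] at h
    simp only [h6] at h
    have h7 : ∑ j, (c j - extend f (X ∪ G)) - ∑ j, (extend f (X ∪ G) - extend f (X ∪ G \ S j)) ≤
        ∑ j, (extend f (X ∪ (G \ S j ∪ A j)) - extend f (X ∪ G)) := by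
      rw [← Finset.sum_sub_distrib]
      refine Finset.sum_le_sum fun j _ => ?_
      have h8 := hF.union_sub_le (A := X ∪ G \ S j) (B := X ∪ G) (D := A j)
        (Finset.union_subset_union_right Finset.sdiff_subset) (by
          intro y hy
          obtain ⟨h6, h7⟩ := Finset.mem_inter.1 hy
          have := hAG j y h6
          simp only [Finset.mem_union, Finset.mem_sdiff] at h7 ⊢
          tauto)
      rw [Finset.union_comm (A j), Finset.union_comm (A j), Finset.union_assoc X (G \ S j)] at h8
      simp only [hc]
      linarith
    rw [Finset.sum_sub_distrib, Finset.sum_sub_distrib (fun j => extend f (X ∪ (G \ S j ∪ A j))),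
      Finset.sum_const, Finset.card_univ, Fintype.card_fin, nsmul_eq_mul] at h7
    linarith
  have hne : (Finset.univ : Finset (Fin L)).Nonempty := ⟨⟨0, hL⟩, Finset.mem_univ _⟩
  obtain ⟨j, -, hj⟩ := Finset.exists_le_of_sum_le hne (s := Finset.univ)
    (f := fun _ => (L / (L + 1) - 1 / L) * α * extend f G +
      ((1 - 1 / L) * (1 / (L + 1)) * α + (1 - 2 / L) * γ) * extend f (X ∪ G) +
      1 / L * γ * extend f X + 1 / (L + 1) * α * D)
    (g := fun j => α * extend f (G \ S j ∪ A j) + γ * extend f (X ∪ (G \ S j ∪ A j))) (by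
      rw [Finset.sum_const, Finset.card_univ, Fintype.card_fin, nsmul_eq_mul,
        Finset.sum_add_distrib, ← Finset.mul_sum, ← Finset.mul_sum]
      have h5 : (L / (L + 1) * (L * extend f G) + (L - 1) / (L + 1) * extend f (X ∪ G) +
          L / (L + 1) * D) - extend f G ≤ ∑ j, extend f (G \ S j ∪ A j) := by
        refine le_trans (sub_le_sub_right ?_ _) h3
        have h6 : L / (L + 1) * (L * extend f G) + (L - 1) / (L + 1) * extend f (X ∪ G) +
            L / (L + 1) * D =
            (L * (L * extend f G) + (L - 1) * extend f (X ∪ G) + L * D) / (L + 1) := by ring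
        rw [h6, div_le_iff₀ (by positivity)]
        linarith
      have h7 := mul_le_mul_of_nonneg_left h5 hα
      have h8 := mul_le_mul_of_nonneg_left h4 hγ
      refine le_trans (le_of_eq ?_) (add_le_add h7 h8)
      field_simp
      ring)
  refine ⟨_, hnew j, ?_⟩
  rw [hXval, hXval, hXval'] at hj
  exact hj

/-- One call of the subroutine for the matroid constraint. -/
theorem runs_guidedIGM (hf0 : ∀ S, 0 ≤ f S) (hf : Submodular f) (τ : TieBreaking)
    {I : Constraint U} (hL : 1 ≤ L) (hk : 1 ≤ I.rank) {O : Finset U} (hO : I.Feasible O)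
    {W G : Finset (U ⊕ Fin d)} (hG : I.ExtFeasible G) (hGk : G.card = I.rank)
    (hd : W.card + 2 * I.rank ≤ d) :
    Runs f (guidedIGM τ I W G L) (fun new =>
      (∀ A ∈ new, (I.ExtFeasible A ∧ A.card = I.rank) ∧ ∀ x ∈ A, x ∈ G ∨ x ∉ W) ∧
      new.card ≤ L ∧ (Disjoint G.toLeft W.toLeft →
        StepBound f O (L / (L + 1) - 1 / L) ((1 - 1 / L) * (1 / (L + 1))) (1 - 2 / L) (1 / L)
          (1 / (L + 1)) W G new))
      (I.rank * (L * (Fintype.card U + d + 1))) := by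
  have : Nonempty (Fin L) := ⟨⟨0, hL⟩⟩
  refine Runs.mono (B := ∑ _i ∈ Finset.range I.rank, L * (Fintype.card U + d + 1) + 0) ?_
    (fun _ h => h) (by simp)
  refine (Runs.foldlM_range (IsGreedy f I W G) I.rank (fun i s hi hs =>
    runs_greedyStep hf τ hL hs hi (by omega)) (isGreedy_zero I W G)).bind fun s hs => ?_
  have hAsub : ∀ j, s.2 j ⊆ s.1 := fun j =>
    hs.biUnion_eq ▸ Finset.subset_biUnion_of_mem s.2 (Finset.mem_univ j)
  have hAW : ∀ j, Disjoint (s.2 j) (G ∪ W) := fun j => hs.avoid.mono_left (hAsub j)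
  have hAG : ∀ j, Disjoint (s.2 j) G := fun j => (hAW j).mono_right Finset.subset_union_left
  split
  next σ hσ =>
    obtain ⟨hbij, hmax⟩ := TieBreaking.pick?_eq_some hσ
    have hmem : ∀ A ∈ Finset.univ.image (fun j => exchange G σ (s.2 j)),
        ∃ j, A = exchange G σ (s.2 j) := fun A hA => by
      obtain ⟨j, -, rfl⟩ := Finset.mem_image.1 hA
      exact ⟨j, rfl⟩
    refine Runs.pure ⟨fun A hA => ?_, Finset.card_image_le.trans (by simp), fun hGW => ?_⟩
    · obtain ⟨j, rfl⟩ := hmem A hA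
      refine ⟨⟨(hmax j).1, Maximal.card_eq (hmax j) (by omega)⟩, fun x hx => ?_⟩
      rw [exchange_eq (hAG j), Finset.mem_union, Finset.mem_sdiff] at hx
      refine hx.imp (fun h => h.1) fun h hW => ?_
      exact Finset.disjoint_left.1 (hAW j) h (Finset.mem_union_right _ hW)
    · refine stepBound_of_exchange hf0 hf hL (A := s.2)
        (S := fun j => G.filter fun g => σ g ∈ s.2 j) hGW hAW hs.disjoint ?_ ?_ ?_ ?_
      · intro i j hij
        rw [Finset.disjoint_left]
        intro g hi hj
        exact Finset.disjoint_left.1 (hs.disjoint i j hij) (Finset.mem_filter.1 hi).2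
          (Finset.mem_filter.1 hj).2
      · ext g
        simp only [Finset.mem_biUnion, Finset.mem_univ, true_and, Finset.mem_filter]
        refine ⟨fun ⟨_, h, _⟩ => h, fun hg => ?_⟩
        have := hbij.mapsTo hg
        rw [Finset.mem_coe, ← hs.biUnion_eq, Finset.mem_biUnion] at this
        obtain ⟨j, -, hj⟩ := this
        exact ⟨j, hg, hj⟩
      · intro j
        exact hs.union_sub_le_sum hf (by omega) (hO.subset Finset.sdiff_subset)
          Finset.sdiff_disjoint j
      · intro j
        rw [← exchange_eq (hAG j)]
        exact Finset.mem_image_of_mem _ (Finset.mem_univ j)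
  -- The multiple exchange theorem supplies an admissible bijection, so this choice cannot fail.
  next hσ =>
    exfalso
    obtain ⟨B, hB, hBG, hBA⟩ := exists_exchange_partition (N := extMatroid I d)
      card_le_of_extMatroid_indep (extMatroid_indep.2 hG) (extMatroid_indep.2 hs.feasible) hGk
      hs.card_eq s.2 hs.biUnion_eq hs.disjoint
    obtain ⟨σ, hσ1, hσ2⟩ := exists_bijOn_of_partition hB hBG hs.disjoint hs.biUnion_eq
      fun j => (hBA j).1
    refine Set.eq_empty_iff_forall_notMem.1 (TieBreaking.pick?_eq_none hσ) σ ⟨hσ1, fun j => ?_⟩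
    rw [exchange_eq (hAG j), hσ2 j]
    exact maximal_extFeasible (extMatroid_indep.1 (hBA j).2.2) (hBA j).2.1

end Greedy


/-! ### Enumeration of all paths -/

/-- Lower bounds `u, w` (guided rounds) and `u', w'` (unguided rounds) for the values of `A` and
of `O ∪ W ∪ A` along a best path. -/
structure PathBound (T : ℕ) (a₁ a₂ a₃ a₄ a₅ x D o : ℝ) (u w u' w' : ℕ → ℝ) : Prop where
  nonneg₁ : 0 ≤ a₁
  nonneg₂ : 0 ≤ a₂
  nonneg₃ : 0 ≤ a₃
  u_zero : u 0 ≤ 0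
  w_zero : w 0 ≤ x
  u_succ : ∀ i < T, u (i + 1) ≤ a₁ * u i + a₂ * w i + a₅ * D
  w_succ : ∀ i < T, w (i + 1) ≤ a₃ * w i + a₄ * x
  u'_zero : u' 0 ≤ u T
  w'_zero : w' 0 ≤ w T + (o - x)
  u'_succ : ∀ j, u' (j + 1) ≤ a₁ * u' j + a₂ * w' j
  w'_succ : ∀ j, w' (j + 1) ≤ a₃ * w' j + a₄ * o

section Enumerate

variable {U : Type} [Fintype U] [DecidableEq U] {d : ℕ} {f : Finset U → ℝ}

/-- For all nonnegative weights, some set in the family is at least as good as `u` and `w`. -/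
def FamilyBound (f : Finset U → ℝ) (X : Finset U) (u w : ℝ)
    (𝒢 : Finset (Finset (U ⊕ Fin d))) : Prop :=
  ∀ α γ : ℝ, 0 ≤ α → 0 ≤ γ → ∃ A ∈ 𝒢, α * u + γ * w ≤ α * extend f A + γ * f (X ∪ A.toLeft)

/-- The weighting (α, γ) after the round pulls back to (a₁ α, a₂ α + a₃ γ) before it. A set G that
is good for the latter has a successor that is good for the former. -/
theorem FamilyBound.step {O : Finset U} {a₁ a₂ a₃ a₄ a₅ u w u' w' : ℝ}
    {W : Finset (U ⊕ Fin d)} {𝒢 𝒢' : Finset (Finset (U ⊕ Fin d))}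
    (h : FamilyBound f (O ∪ W.toLeft) u w 𝒢)
    (hstep : ∀ G ∈ 𝒢, StepBound f O a₁ a₂ a₃ a₄ a₅ W G 𝒢') (h₁ : 0 ≤ a₁) (h₂ : 0 ≤ a₂)
    (h₃ : 0 ≤ a₃)
    (hu : u' ≤ a₁ * u + a₂ * w + a₅ * (f (O \ W.toLeft) - f (O ∪ W.toLeft)))
    (hw : w' ≤ a₃ * w + a₄ * f (O ∪ W.toLeft)) :
    FamilyBound f (O ∪ W.toLeft) u' w' 𝒢' := by
  intro α γ hα hγ
  obtain ⟨G, hG, hGb⟩ := h (a₁ * α) (a₂ * α + a₃ * γ) (by positivity) (by positivity)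
  obtain ⟨A, hA, hAb⟩ := hstep G hG α γ hα hγ
  refine ⟨A, hA, ?_⟩
  have h1 := mul_le_mul_of_nonneg_left hu hα
  have h2 := mul_le_mul_of_nonneg_left hw hγ
  linarith

/-- Replacing O ∪ w by O costs f(O ∪ w) - f(O) for every set disjoint from `w`. The correction is
the same for all members, so the set chosen for given weights stays the same. -/
theorem FamilyBound.switch (hf : Submodular f) {O w : Finset U} {u v u' v' : ℝ}
    {𝒢 : Finset (Finset (U ⊕ Fin d))} (h : FamilyBound f (O ∪ w) u v 𝒢)
    (hdisj : ∀ A ∈ 𝒢, Disjoint A.toLeft w) (hu : u' ≤ u) (hv : v' ≤ v + (f O - f (O ∪ w))) :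
    FamilyBound f O u' v' 𝒢 := by
  intro α γ hα hγ
  obtain ⟨A, hA, hAb⟩ := h α γ hα hγ
  refine ⟨A, hA, ?_⟩
  have h1 := mul_le_mul_of_nonneg_left hu hα
  have h2 := mul_le_mul_of_nonneg_left hv hγ
  have h3 := mul_le_mul_of_nonneg_left (hf.union_guided_le O w A.toLeft (hdisj A hA)) hγ
  linarith

/-- One round of the enumeration. -/
theorem runs_expand {P P' : Finset (U ⊕ Fin d) → Prop} {O : Finset U} {a₁ a₂ a₃ a₄ a₅ : ℝ}
    {K B : ℕ} {W : Finset (U ⊕ Fin d)}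
    {body : Finset (U ⊕ Fin d) → Prog U (Finset (Finset (U ⊕ Fin d)))}
    (hsub : ∀ G, P G → Runs f (body G) (fun new =>
      (∀ A ∈ new, P' A ∧ ∀ x ∈ A, x ∈ G ∨ x ∉ W) ∧ new.card ≤ K ∧
      (Disjoint G.toLeft W.toLeft → StepBound f O a₁ a₂ a₃ a₄ a₅ W G new)) B)
    (𝒢 : Finset (Finset (U ⊕ Fin d))) (hP : ∀ G ∈ 𝒢, P G) :
    Runs f (𝒢.toList.foldlM (fun out A => do
      let new ← body A
      pure (out ∪ new)) ∅) (fun 𝒢' =>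
      (∀ A ∈ 𝒢', P' A ∧ ∃ G ∈ 𝒢, ∀ x ∈ A, x ∈ G ∨ x ∉ W) ∧ 𝒢'.card ≤ 𝒢.card * K ∧
      ∀ G ∈ 𝒢, Disjoint G.toLeft W.toLeft → StepBound f O a₁ a₂ a₃ a₄ a₅ W G 𝒢')
      (𝒢.card * B) := by
  refine (Runs.foldlM (cost := fun _ => B) (fun pre out =>
    (∀ A ∈ out, P' A ∧ ∃ G ∈ 𝒢, ∀ x ∈ A, x ∈ G ∨ x ∉ W) ∧ out.card ≤ pre.length * K ∧
      ∀ G ∈ pre, Disjoint G.toLeft W.toLeft → StepBound f O a₁ a₂ a₃ a₄ a₅ W G out)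
      𝒢.toList ?_ ?_).mono ?_ ?_
  · rintro pre G suf out hl ⟨h1, h2, h3⟩
    have hG : G ∈ 𝒢 := by
      rw [← Finset.mem_toList, hl]; simp
    refine ((hsub G (hP G hG)).bind (C := 0) fun new hnew => Runs.pure ?_).mono (fun _ h => h) le_rfl
    obtain ⟨k1, k2, k3⟩ := hnew
    refine ⟨fun A hA => ?_, ?_, fun G' hG' => ?_⟩
    · rcases Finset.mem_union.1 hA with hA | hA
      · exact h1 A hA
      · exact ⟨(k1 A hA).1, G, hG, (k1 A hA).2⟩
    · have := Finset.card_union_le out new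
      rw [List.length_append, List.length_singleton, Nat.succ_mul]
      omega
    · rw [List.mem_append, List.mem_singleton] at hG'
      rcases hG' with hG' | rfl
      · exact fun hd => (h3 G' hG' hd).mono Finset.subset_union_left
      · exact fun hd => (k3 hd).mono Finset.subset_union_right
  · simp
  · rintro 𝒢' ⟨h1, h2, h3⟩
    exact ⟨h1, by simpa using h2, fun G hG => h3 G (by simpa using hG)⟩
  · simp

/-- The enumeration of all paths, for a subroutine that satisfies the step bound. -/
theorem runs_enumerate (hf0 : ∀ S, 0 ≤ f S) (hf : Submodular f) {τ : TieBreaking}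
    {I : Constraint U} {O : Finset U} {a₁ a₂ a₃ a₄ a₅ : ℝ} {K B L : ℕ} {t : ℝ} (ht0 : 0 ≤ t)
    (ht1 : t ≤ 1) {P : ℕ → Finset (U ⊕ Fin d) → Prop}
    (hsub : ∀ i < L, ∀ W G, W.card ≤ I.rank → P i G →
      Runs f (guidedIG τ I W G L) (fun new =>
        (∀ A ∈ new, P (i + 1) A ∧ ∀ x ∈ A, x ∈ G ∨ x ∉ W) ∧ new.card ≤ K ∧
        (Disjoint G.toLeft W.toLeft → StepBound f O a₁ a₂ a₃ a₄ a₅ W G new)) B)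
    {Z S : Finset (U ⊕ Fin d)} (hZ : Z.card ≤ I.rank) (hS : P 0 S) (hS0 : S.toLeft = ∅) :
    Runs f ((List.range L).foldlM (fun (𝒢 : Finset (Finset (U ⊕ Fin d))) i => do
      let W := if ((i + 1 : ℕ) : ℝ) ≤ t * L then Z else ∅
      𝒢.toList.foldlM (fun out A => do
        let new ← guidedIG τ I W A L
        pure (out ∪ new)) ∅) {S}) (fun 𝒢 =>
      (∀ A ∈ 𝒢, P L A) ∧ 𝒢.card ≤ K ^ L ∧ ∀ u w u' w',
        PathBound ⌊t * L⌋₊ a₁ a₂ a₃ a₄ a₅ (f (O ∪ Z.toLeft))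
          (f (O \ Z.toLeft) - f (O ∪ Z.toLeft)) (f O) u w u' w' →
        ∃ A ∈ 𝒢, u' (L - ⌊t * L⌋₊) ≤ extend f A)
      (∑ i ∈ Finset.range L, K ^ i * B) := by
  set T := ⌊t * L⌋₊ with hT
  have htL : 0 ≤ t * L := by positivity
  have hTL : T ≤ L := by
    refine Nat.floor_le_of_le ?_
    calc t * L ≤ 1 * L := by gcongr
      _ = L := one_mul _
  -- Both bounds hold at `i = T`, where the guided bound is converted into the initial unguided one.
  -- Disjointness from `Z` is needed only up to that point.
  refine (Runs.foldlM_range (cost := fun i => K ^ i * B) (fun i 𝒢 =>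
    (∀ A ∈ 𝒢, P i A ∧ (i ≤ T → Disjoint A.toLeft Z.toLeft)) ∧ 𝒢.card ≤ K ^ i ∧
      ∀ u w u' w', PathBound T a₁ a₂ a₃ a₄ a₅ (f (O ∪ Z.toLeft))
          (f (O \ Z.toLeft) - f (O ∪ Z.toLeft)) (f O) u w u' w' →
        (i ≤ T → FamilyBound f (O ∪ Z.toLeft) (u i) (w i) 𝒢) ∧
        (T ≤ i → FamilyBound f O (u' (i - T)) (w' (i - T)) 𝒢)) L ?_ ?_).mono ?_ le_rfl
  · rintro i 𝒢 hi ⟨hP, hcard, hval⟩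
    have hiff : ((i + 1 : ℕ) : ℝ) ≤ t * L ↔ i + 1 ≤ T := (Nat.le_floor_iff htL).symm
    by_cases hiT : i + 1 ≤ T
    · have hrun := runs_expand (f := f) (W := Z) (hsub i hi Z · hZ) 𝒢 fun G hG => (hP G hG).1
      simp only [hiff, hiT, if_true]
      refine hrun.mono ?_ (Nat.mul_le_mul_right _ hcard)
      rintro 𝒢' ⟨h1, h2, h3⟩
      have hdisj : ∀ A ∈ 𝒢', Disjoint A.toLeft Z.toLeft := by
        intro A hA
        obtain ⟨-, G, hG, hGA⟩ := h1 A hA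
        rw [Finset.disjoint_left]
        intro x hx hxZ
        rcases hGA _ (Finset.mem_toLeft.1 hx) with h | h
        · exact Finset.disjoint_left.1 ((hP G hG).2 (by omega)) (Finset.mem_toLeft.2 h) hxZ
        · exact h (Finset.mem_toLeft.1 hxZ)
      refine ⟨fun A hA => ⟨(h1 A hA).1, fun _ => hdisj A hA⟩, ?_, fun u w u' w' hpb => ?_⟩
      · rw [pow_succ]
        exact h2.trans (Nat.mul_le_mul_right _ hcard)
      · have hguided : FamilyBound f (O ∪ Z.toLeft) (u (i + 1)) (w (i + 1)) 𝒢' :=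
          ((hval u w u' w' hpb).1 (by omega)).step
            (fun G hG => h3 G hG ((hP G hG).2 (by omega))) hpb.nonneg₁ hpb.nonneg₂ hpb.nonneg₃
            (hpb.u_succ i (by omega)) (hpb.w_succ i (by omega))
        refine ⟨fun _ => hguided, fun hTi => ?_⟩
        have hTi' : T = i + 1 := by omega
        have h0 : i + 1 - T = 0 := by omega
        rw [h0]
        exact hguided.switch hf hdisj (hTi' ▸ hpb.u'_zero) (hTi' ▸ hpb.w'_zero)
    · have hrun := runs_expand (f := f) (W := ∅) (hsub i hi ∅ · (by simp)) 𝒢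
        fun G hG => (hP G hG).1
      simp only [hiff, hiT, if_false]
      refine hrun.mono ?_ (Nat.mul_le_mul_right _ hcard)
      rintro 𝒢' ⟨h1, h2, h3⟩
      have hempty : (∅ : Finset (U ⊕ Fin d)).toLeft = ∅ := by ext; simp
      refine ⟨fun A hA => ⟨(h1 A hA).1, fun h => h.elim⟩, ?_, fun u w u' w' hpb =>
        ⟨fun h => h.elim, fun _ => ?_⟩⟩
      · rw [pow_succ]
        exact h2.trans (Nat.mul_le_mul_right _ hcard)
      · have h4 := (hval u w u' w' hpb).2 (by omega)
        have h5 : i + 1 - T = i - T + 1 := by omega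
        have h6 := FamilyBound.step (O := O) (W := ∅) (u' := u' (i + 1 - T))
          (w' := w' (i + 1 - T)) (u := u' (i - T)) (w := w' (i - T))
          (by rw [hempty, Finset.union_empty]; exact h4)
          (fun G hG => h3 G hG (by rw [hempty]; exact Finset.disjoint_empty_right _))
          hpb.nonneg₁ hpb.nonneg₂ hpb.nonneg₃
          (by
            rw [hempty, Finset.union_empty, Finset.sdiff_empty, sub_self, mul_zero, add_zero, h5]
            exact hpb.u'_succ _)
          (by rw [hempty, Finset.union_empty, h5]; exact hpb.w'_succ _)
        rwa [hempty, Finset.union_empty] at h6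
  · refine ⟨fun A hA => ?_, by simp, fun u w u' w' hpb => ?_⟩
    · rw [Finset.mem_singleton] at hA
      subst hA
      exact ⟨hS, fun _ => by rw [hS0]; exact Finset.disjoint_empty_left _⟩
    · have h0 : FamilyBound f (O ∪ Z.toLeft) (u 0) (w 0) {S} := by
        intro α γ hα hγ
        refine ⟨S, Finset.mem_singleton_self S, ?_⟩
        rw [hS0, Finset.union_empty]
        exact add_le_add (mul_le_mul_of_nonneg_left (hpb.u_zero.trans (hf0 _)) hα)
          (mul_le_mul_of_nonneg_left hpb.w_zero hγ)
      refine ⟨fun _ => h0, fun hT0 => ?_⟩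
      -- Without guided rounds the reference set changes at once, for the starting set.
      have hT0' : T = 0 := by omega
      rw [Nat.zero_sub]
      refine h0.switch hf (fun A hA => ?_) ?_ ?_
      · rw [Finset.mem_singleton] at hA
        rw [hA, hS0]; exact Finset.disjoint_empty_left _
      · have := hpb.u'_zero
        rwa [hT0'] at this
      · have := hpb.w'_zero
        rwa [hT0'] at this
  · rintro 𝒢 ⟨h1, h2, h3⟩
    refine ⟨fun A hA => (h1 A hA).1, h2, fun u w u' w' hpb => ?_⟩
    -- The final weights: only f(A) matters at the end.
    obtain ⟨A, hA, h⟩ := (h3 u w u' w' hpb).2 hTL 1 0 zero_le_one le_rfl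
    exact ⟨A, hA, by linarith⟩

end Enumerate

theorem toLeft_emptyStart {U : Type} [Fintype U] [DecidableEq U] {d : ℕ} (I : Constraint U) :
    (emptyStart I : Finset (U ⊕ Fin d)).toLeft = ∅ := by
  cases I with
  | size k => ext; simp [emptyStart]
  | matroid M => exact toLeft_pad _ _

/-- The whole algorithm, for a subroutine that satisfies the step bound. -/
theorem runs_guidedDet {U : Type} [Fintype U] [DecidableEq U] {f : Finset U → ℝ}
    (hf0 : ∀ S, 0 ≤ f S) (hf : Submodular f) {τ : TieBreaking} {I : Constraint U}
    {ε α₀ t : ℝ} {O Z₀ : Finset U} (hε : 0 < ε) (hα₀ : 0 < α₀) (hO : IsOptimal f I O)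
    (hfO : 0 < f O) (hZ₀ : I.Feasible Z₀) (hZO : α₀ * f O ≤ f Z₀) (hk : 1 ≤ I.rank)
    (ht0 : 0 ≤ t) (ht1 : t ≤ 1) {a₁ a₂ a₃ a₄ a₅ : ℝ} {K B : ℕ}
    {P : ℕ → Finset (U ⊕ Fin (3 * I.rank)) → Prop}
    (hsub : ∀ i < rounds ε, ∀ W G, W.card ≤ I.rank → P i G →
      Runs f (guidedIG τ I W G (rounds ε)) (fun new =>
        (∀ A ∈ new, P (i + 1) A ∧ ∀ x ∈ A, x ∈ G ∨ x ∉ W) ∧ new.card ≤ K ∧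
        (Disjoint G.toLeft W.toLeft → StepBound f O a₁ a₂ a₃ a₄ a₅ W G new)) B)
    (hstart : P 0 (emptyStart I)) (hend : ∀ A, P (rounds ε) A → I.Feasible A.toLeft) :
    Runs f (guidedDet τ I Z₀ t ε) (fun A => I.Feasible A ∧ ∃ Z : Finset U,
      f (O ∪ Z) + f (O ∩ Z) ≤ (2 + ε) * f Z ∧ f (O ∩ Z) ≤ (1 + ε) * f Z ∧ f Z ≤ f A ∧
      ∀ u w u' w', PathBound ⌊t * rounds ε⌋₊ a₁ a₂ a₃ a₄ a₅ (f (O ∪ Z))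
          (f (O \ Z) - f (O ∪ Z)) (f O) u w u' w' →
        u' (rounds ε - ⌊t * rounds ε⌋₊) ≤ f A)
      ((⌊I.rank / (ε * α₀)⌋₊ + 1) * (Fintype.card U + 3 * I.rank + 1) +
        (∑ i ∈ Finset.range (rounds ε), K ^ i * B + (K ^ rounds ε + 1))) := by
  refine (runs_fastLS τ hf0 hf hε hα₀ hO hfO hZ₀ hZO hk (by omega)).bind fun Z hZ => ?_
  obtain ⟨hZI, hZk, hZ1, hZ2⟩ := hZ
  refine (runs_enumerate hf0 hf ht0 ht1 hsub hZk.le hstart (toLeft_emptyStart I)).bind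
    fun 𝒢 h𝒢 => ?_
  obtain ⟨h1, h2, h3⟩ := h𝒢
  refine Runs.mono (B := (insert Z 𝒢).toList.length + 0) ?_ (fun _ h => h) ?_
  · refine (runs_queryAll _ _).bind fun v hv => ?_
    simp only [Finset.mem_toList, id] at hv
    split
    next A hA =>
      obtain ⟨hA1, hA2⟩ := TieBreaking.argmax_eq_some hA
      have hbest : ∀ B ∈ insert Z 𝒢, extend f B ≤ extend f A := fun B hB => by
        rw [← hv B hB, ← hv A hA1]; exact hA2 B hB
      refine Runs.pure ⟨?_, Z.toLeft, hZ1, hZ2, hbest Z (Finset.mem_insert_self _ _),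
        fun u w u' w' hpb => ?_⟩
      · rcases Finset.mem_insert.1 hA1 with rfl | hA1
        · exact hZI.1
        · exact hend A (h1 A hA1)
      · obtain ⟨B, hB, hB'⟩ := h3 u w u' w' hpb
        exact hB'.trans (hbest B (Finset.mem_insert_of_mem hB))
    next hA =>
      exact absurd (TieBreaking.argmax_eq_none hA) (Finset.insert_ne_empty _ _)
  · rw [Finset.length_toList, add_zero]
    exact (Finset.card_insert_le _ _).trans (Nat.succ_le_succ h2)


/-! ### Solving the recursions -/

/-- Let r = (L + 1)/(L + 2) and p = 1 - 1/L. The D-term and the second coordinate are solved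
exactly. In the term driven by the second coordinate, r is lowered to p, which only weakens the
bound and replaces a mixture of powers of r and p by i p^i. -/
theorem PathBound.size {L : ℕ} (hL : 1 ≤ L) (T : ℕ) {x D o : ℝ} (hx : 0 ≤ x) (hxo : x ≤ o) :
    PathBound T (((L : ℝ) + 1) / (L + 2)) ((1 - 1 / (L : ℝ)) * (1 / ((L : ℝ) + 2)))
      (1 - 1 / (L : ℝ)) 0 (1 / ((L : ℝ) + 2)) x D o
      (fun i => D * (1 - (((L : ℝ) + 1) / (L + 2)) ^ i) +
        1 / ((L : ℝ) + 2) * i * (1 - 1 / (L : ℝ)) ^ i * x)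
      (fun i => (1 - 1 / (L : ℝ)) ^ i * x)
      (fun j => (((L : ℝ) + 1) / (L + 2)) ^ j * (D * (1 - (((L : ℝ) + 1) / (L + 2)) ^ T) +
        1 / ((L : ℝ) + 2) * T * (1 - 1 / (L : ℝ)) ^ T * x) +
        1 / ((L : ℝ) + 2) * j * (1 - 1 / (L : ℝ)) ^ j * (o - (1 - (1 - 1 / (L : ℝ)) ^ T) * x))
      (fun j => (1 - 1 / (L : ℝ)) ^ j * (o - (1 - (1 - 1 / (L : ℝ)) ^ T) * x)) := by
  have hL' : (1 : ℝ) ≤ L := by exact_mod_cast hL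
  have hr : ((L : ℝ) + 1) / (L + 2) = 1 - 1 / (L + 2) := by field_simp; ring
  have hp0 : 0 ≤ 1 - 1 / (L : ℝ) := by
    rw [sub_nonneg, div_le_one (by linarith)]; exact hL'
  have hpr : 1 - 1 / (L : ℝ) ≤ 1 - 1 / ((L : ℝ) + 2) := by
    gcongr; linarith
  have hs : 0 ≤ 1 / ((L : ℝ) + 2) := by positivity
  rw [hr]
  generalize 1 / ((L : ℝ) + 2) = s at *
  have hp1 : 1 - 1 / (L : ℝ) ≤ 1 := by
    have : 0 ≤ 1 / (L : ℝ) := by positivity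
    linarith
  generalize 1 - 1 / (L : ℝ) = p at *
  have hw : 0 ≤ o - (1 - p ^ T) * x := by
    have : (1 - p ^ T) * x ≤ 1 * x := by
      gcongr; linarith [pow_nonneg hp0 T]
    linarith
  constructor
  · linarith
  · positivity
  · exact hp0
  · simp
  · simp
  · intro i _
    have : 0 ≤ (1 - s - p) * (s * i * p ^ i * x) :=
      mul_nonneg (by linarith) (by positivity)
    push_cast
    rw [pow_succ, pow_succ]
    linarith
  · intro i _
    rw [pow_succ]
    linarith
  · simp
  · simp; linarith
  · intro i
    have : 0 ≤ (1 - s - p) * (s * i * p ^ i * (o - (1 - p ^ T) * x)) :=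
      mul_nonneg (by linarith) (by positivity)
    push_cast
    rw [pow_succ, pow_succ]
    linarith
  · intro i
    rw [pow_succ]
    linarith

/-- The second coordinate tends geometrically to x/2 (then o/2), the fixed point of its recursion.
The factor L/(2L + 1) is (1/(L + 1))/(1 - a₁), which solves the D-term exactly. In the remaining
term a₁ is lowered to 1 - 2/L, so that only powers of one base occur. -/
theorem PathBound.matroid {L : ℕ} (hL : 2 ≤ L) (T : ℕ) {x D o : ℝ} (hx : 0 ≤ x) (hxo : x ≤ o) :
    PathBound T ((L : ℝ) / (L + 1) - 1 / L) ((1 - 1 / (L : ℝ)) * (1 / ((L : ℝ) + 1)))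
      (1 - 2 / (L : ℝ)) (1 / L) (1 / ((L : ℝ) + 1)) x D o
      (fun i => (L : ℝ) / (2 * L + 1) * D * (1 - ((L : ℝ) / (L + 1) - 1 / L) ^ i) +
        (1 - 1 / (L : ℝ)) * (1 / ((L : ℝ) + 1)) * (x / 2) *
          ((1 - (1 - 2 / (L : ℝ)) ^ i) * (L / 2) + i * (1 - 2 / (L : ℝ)) ^ (i - 1)))
      (fun i => x / 2 * (1 + (1 - 2 / (L : ℝ)) ^ i))
      (fun j => ((L : ℝ) / (L + 1) - 1 / L) ^ j *
          ((L : ℝ) / (2 * L + 1) * D * (1 - ((L : ℝ) / (L + 1) - 1 / L) ^ T) +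
            (1 - 1 / (L : ℝ)) * (1 / ((L : ℝ) + 1)) * (x / 2) *
              ((1 - (1 - 2 / (L : ℝ)) ^ T) * (L / 2) + T * (1 - 2 / (L : ℝ)) ^ (T - 1))) +
        (1 - 1 / (L : ℝ)) * (1 / ((L : ℝ) + 1)) *
          (o / 2 * ((1 - (1 - 2 / (L : ℝ)) ^ j) * (L / 2)) + j * (1 - 2 / (L : ℝ)) ^ (j - 1) *
            (o / 2 - x / 2 * (1 - (1 - 2 / (L : ℝ)) ^ T))))
      (fun j => o / 2 + (1 - 2 / (L : ℝ)) ^ j * (o / 2 - x / 2 * (1 - (1 - 2 / (L : ℝ)) ^ T))) := by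
  have hL' : (2 : ℝ) ≤ L := by exact_mod_cast hL
  have h1 : 0 ≤ 1 - 1 / (L : ℝ) := by
    rw [sub_nonneg, div_le_one (by linarith)]; linarith
  have hb0 : 0 ≤ 1 - 2 / (L : ℝ) := by
    rw [sub_nonneg, div_le_one (by linarith)]; linarith
  have hba : 1 - 2 / (L : ℝ) ≤ (L : ℝ) / (L + 1) - 1 / L := by
    have : (L : ℝ) / (L + 1) - 1 / L - (1 - 2 / (L : ℝ)) = 1 / (L * (L + 1)) := by
      field_simp; ring
    have : 0 ≤ 1 / ((L : ℝ) * (L + 1)) := by positivity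
    linarith
  have hc : (L : ℝ) / (2 * L + 1) * (1 - ((L : ℝ) / (L + 1) - 1 / L)) = 1 / ((L : ℝ) + 1) := by
    field_simp; ring
  have h2 : 0 ≤ (1 - 1 / (L : ℝ)) * (1 / ((L : ℝ) + 1)) := by positivity
  generalize (1 - 1 / (L : ℝ)) * (1 / ((L : ℝ) + 1)) = q at *
  rw [← hc]
  generalize (L : ℝ) / (2 * L + 1) = c at *
  generalize (L : ℝ) / (L + 1) - 1 / L = a at *
  have hb1 : 1 - 2 / (L : ℝ) ≤ 1 := by
    have : 0 ≤ 2 / (L : ℝ) := by positivity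
    linarith
  have hbL : (1 - (1 - 2 / (L : ℝ))) * (L / 2) = 1 := by field_simp; ring
  have hL2 : 1 / (L : ℝ) = (1 - (1 - 2 / (L : ℝ))) / 2 := by ring
  rw [hL2]
  clear hL2 hc h1
  generalize 1 - 2 / (L : ℝ) = b at *
  have hbp : ∀ i, b ^ i ≤ 1 := fun i => pow_le_one₀ hb0 hb1
  -- The truncated exponent at `i = 0` is harmless because of the factor `i`.
  have hi : ∀ i : ℕ, b * (i * b ^ (i - 1)) = i * b ^ i := by
    rintro (_ | i)
    · simp
    · rw [Nat.add_sub_cancel, pow_succ]; ring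
  have hw : 0 ≤ o / 2 - x / 2 * (1 - b ^ T) := by
    have : x / 2 * (1 - b ^ T) ≤ x / 2 * 1 := by
      gcongr; linarith [pow_nonneg hb0 T]
    linarith
  generalize (L : ℝ) / 2 = M at *
  have hM : 0 ≤ M := by nlinarith
  constructor
  · linarith
  · exact h2
  · exact hb0
  · simp
  · norm_num
  · intro i _
    have h3 : 0 ≤ (1 - b ^ i) * M := mul_nonneg (by linarith [hbp i]) hM
    have : 0 ≤ (a - b) * (q * (x / 2) * ((1 - b ^ i) * M + i * b ^ (i - 1))) :=
      mul_nonneg (by linarith) (by positivity)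
    have h4 := congrArg (fun z => q * (x / 2) * z) (hi i)
    have h5 := congrArg (fun z => q * (x / 2) * z) hbL
    rw [Nat.add_sub_cancel]
    push_cast
    rw [pow_succ, pow_succ]
    linarith
  · intro i _
    rw [pow_succ]
    linarith
  · simp
  · simp; linarith
  · intro i
    have h3 : 0 ≤ (1 - b ^ i) * M := mul_nonneg (by linarith [hbp i]) hM
    have ho : 0 ≤ o := hx.trans hxo
    generalize o / 2 - x / 2 * (1 - b ^ T) = w at *
    have : 0 ≤ (a - b) * (q * (o / 2 * ((1 - b ^ i) * M) + i * b ^ (i - 1) * w)) :=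
      mul_nonneg (by linarith) (by positivity)
    have h4 := congrArg (fun z => q * w * z) (hi i)
    have h5 := congrArg (fun z => q * (o / 2) * z) hbL
    rw [Nat.add_sub_cancel]
    push_cast
    rw [pow_succ, pow_succ]
    linarith
  · intro i
    rw [pow_succ]
    linarith


/-! ### Numerical estimates -/

/-- The four exponentials estimated here are the limits of the powers in the closed forms: base 1 -
1/L or (L + 1)/(L + 2) leads to exponents 0.372 and 0.628, base 1 - 2/L to 1.118 = 2 · 0.559 and
0.882 = 2 · 0.441. -/
theorem exp_372 : 0.68935 ≤ Real.exp (-0.372) ∧ Real.exp (-0.372) ≤ 0.68936 := by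
  have h := abs_le.1 (Real.exp_bound (x := -0.372) (by norm_num [abs_le]) (n := 8) (by norm_num))
  have : |(-0.372 : ℝ)| = 0.372 := by norm_num [abs_of_neg]
  rw [this] at h
  norm_num [Finset.sum_range_succ, Nat.factorial] at h ⊢
  exact ⟨by linarith [h.1], by linarith [h.2]⟩

theorem le_exp_628 : 0.53365 ≤ Real.exp (-0.628) := by
  have h := (abs_le.1 (Real.exp_bound (x := -0.628) (by norm_num [abs_le]) (n := 8) (by norm_num))).1
  have : |(-0.628 : ℝ)| = 0.628 := by norm_num [abs_of_neg]
  rw [this] at h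
  norm_num [Finset.sum_range_succ, Nat.factorial] at h ⊢
  linarith

theorem exp_1118 : 0.32693 ≤ Real.exp (-1.118) ∧ Real.exp (-1.118) ≤ 0.32694 := by
  -- The Taylor estimate needs an argument of absolute value at most 1, hence the detour through a
  -- square.
  have h := abs_le.1 (Real.exp_bound (x := -0.559) (by norm_num [abs_le]) (n := 8) (by norm_num))
  have : |(-0.559 : ℝ)| = 0.559 := by norm_num [abs_of_neg]
  rw [this] at h
  have h2 : Real.exp (-1.118) = Real.exp (-0.559) ^ 2 := by
    rw [← Real.exp_nat_mul]; norm_num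
  rw [h2]
  norm_num [Finset.sum_range_succ, Nat.factorial] at h ⊢
  constructor <;> nlinarith

theorem exp_882 : 0.41395 ≤ Real.exp (-0.882) ∧ Real.exp (-0.882) ≤ 0.41396 := by
  have h := abs_le.1 (Real.exp_bound (x := -0.882) (by norm_num [abs_le]) (n := 10) (by norm_num))
  have : |(-0.882 : ℝ)| = 0.882 := by norm_num [abs_of_neg]
  rw [this] at h
  norm_num [Finset.sum_range_succ, Nat.factorial] at h ⊢
  exact ⟨by linarith [h.1], by linarith [h.2]⟩

/-- exp(-z) ≤ 1/(1 + z) ≤ p, raised to the power `n`. -/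
theorem exp_neg_mul_le_pow {p z : ℝ} (hz : 0 ≤ z) (hp : 1 ≤ p * (1 + z)) (n : ℕ) :
    Real.exp (-(n * z)) ≤ p ^ n := by
  have h : Real.exp (-z) ≤ p := by
    rw [Real.exp_neg, inv_le_iff_one_le_mul₀ (Real.exp_pos _)]
    refine hp.trans (mul_le_mul_of_nonneg_left ?_ ?_)
    · linarith [Real.add_one_le_exp z]
    · by_contra! hp'
      nlinarith
  rw [← mul_neg, Real.exp_nat_mul]
  exact pow_le_pow_left₀ (Real.exp_pos _).le h n

theorem pow_le_exp_neg_mul {p z : ℝ} (hp0 : 0 ≤ p) (hp : p ≤ 1 - z) (n : ℕ) :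
    p ^ n ≤ Real.exp (-(n * z)) := by
  rw [← mul_neg, Real.exp_nat_mul]
  exact pow_le_pow_left₀ hp0 (by linarith [Real.add_one_le_exp (-z)]) n

/-- From exp(w) ≥ 1 + w. It replaces an exponential near exp(-a) by a lower bound linear in the
perturbation `w`. -/
theorem mul_le_exp_neg {a b e w : ℝ} (he : e ≤ Real.exp (-a)) (he0 : 0 ≤ e) (h : b ≤ a - w) :
    e * (1 + w) ≤ Real.exp (-b) := by
  have h1 : 1 + w ≤ Real.exp w := by linarith [Real.add_one_le_exp w]
  calc e * (1 + w) ≤ Real.exp (-a) * Real.exp w :=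
        (mul_le_mul_of_nonneg_left h1 he0).trans
          (mul_le_mul_of_nonneg_right he (Real.exp_pos _).le)
    _ ≤ Real.exp (-b) := by
        rw [← Real.exp_add]; exact Real.exp_le_exp.2 (by linarith)

/-- The upper counterpart, from exp(w) ≤ 1/(1 - w) ≤ m. -/
theorem exp_neg_le_mul {a b e w m : ℝ} (he : Real.exp (-a) ≤ e) (hm : 1 ≤ m * (1 - w))
    (hm0 : 0 ≤ m) (h : a - w ≤ b) : Real.exp (-b) ≤ e * m := by
  have h1 : Real.exp w ≤ m := by
    have h2 : m * (1 - w) ≤ m * Real.exp (-w) :=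
      mul_le_mul_of_nonneg_left (by linarith [Real.add_one_le_exp (-w)]) hm0
    have h3 := mul_le_mul_of_nonneg_right (hm.trans h2) (Real.exp_pos w).le
    rwa [mul_assoc, ← Real.exp_add, neg_add_cancel, Real.exp_zero, one_mul, mul_one] at h3
  calc Real.exp (-b) ≤ Real.exp (-a) * Real.exp w := by
        rw [← Real.exp_add]; exact Real.exp_le_exp.2 (by linarith)
    _ ≤ e * m := mul_le_mul he h1 (Real.exp_pos _).le ((Real.exp_pos _).le.trans he)

/-- Dictionary: h = 1/L, and d = 0.372 - T/L is the rounding loss; q and P are the powers of 1 - 1/L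
with exponents T and L - T, s and A those of (L + 1)/(L + 2); t = T/(L + 2), g = (L - T)/(L + 2),
and 1.058 h is a lower bound for ε. All factors enter through estimates linear in h and d. -/
theorem size_linear {h d s q P A t g x y D o v : ℝ} (hd : 0 ≤ d) (hdh : d ≤ h) (hh : h ≤ 1 / 20)
    (hq : 0.6893 - 0.27 * h + 0.6893 * d ≤ q)
    (hP : 0.5336 - 0.3528 * h - 0.5618 * d ≤ P)
    (hA : 0.5336 + 0.3191 * h - 0.5337 * d ≤ A)
    (hs : s ≤ 0.6894 + 0.5129 * h + 0.6894 * d)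
    (ht : 0.372 - 0.744 * h - d ≤ t) (hg : 0.628 - 1.256 * h + 0.9 * d ≤ g)
    (ho : 0 ≤ o) (hx : 0 ≤ x) (hxo : x ≤ o) (hD : o - x - y ≤ D) (hD0 : 0 ≤ D)
    (hxy : x + y ≤ (0.77 - 1.615 * (1.058 * h)) * o)
    (hy : y ≤ (0.385 - 0.615 * (1.058 * h)) * o) (hv : v ≤ (0.385 - 1.058 * h) * o) :
    v ≤ A * (D * (1 - s) + t * q * x) + g * P * (o - (1 - q) * x) := by
  have h0 : 0 ≤ h := hd.trans hdh
  -- These six facts trade quadratic terms in h and d for linear ones, so that products of linear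
  -- estimates are again bounded linearly.
  have e1 : h * h ≤ h / 20 := by nlinarith
  have e2 : h * d ≤ d / 20 := by nlinarith
  have e3 : d * d ≤ d / 20 := by nlinarith
  have e4 : 0 ≤ h * h := by positivity
  have e5 : 0 ≤ h * d := by positivity
  have e6 : 0 ≤ d * d := by positivity
  have hG : 0.3351 - 0.8918 * h + 0.1021 * d ≤ g * P := by
    refine le_trans ?_ (mul_le_mul hg hP (by linarith only [hd, hdh, hh, h0, hg, hP]) (by linarith only [hd, hdh, hh, h0, hg, hP]))
    linarith only [e1, e2, e3, e4, e5, e6, hd, hdh, hh, h0]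
  have htq : 0.2564 - 0.6133 * h - 0.4795 * d ≤ t * q := by
    refine le_trans ?_ (mul_le_mul ht hq (by linarith only [hd, hdh, hh, h0, ht, hq]) (by linarith only [hd, hdh, hh, h0, ht, hq]))
    linarith only [e1, e2, e3, e4, e5, e6, hd, hdh, hh, h0]
  have hAtq : 0.1368 - 0.2553 * h - 0.3928 * d ≤ A * (t * q) := by
    refine le_trans ?_ (mul_le_mul hA htq (by linarith only [hd, hdh, hh, h0, hA, htq]) (by linarith only [hd, hdh, hh, h0, hA, htq]))
    linarith only [e1, e2, e3, e4, e5, e6, hd, hdh, hh, h0]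
  have he : 0.1657 - 0.1828 * h - 0.5337 * d ≤ A * (1 - s) := by
    refine le_trans ?_ (mul_le_mul hA (sub_le_sub_left hs 1) (by linarith only [hd, hdh, hh, h0, hA, hs]) (by linarith only [hd, hdh, hh, h0, hA, hs]))
    linarith only [e1, e2, e3, e4, e5, e6, hd, hdh, hh, h0]
  have hGq : (0.3351 - 0.8918 * h + 0.1021 * d) * (1 - (0.6893 - 0.27 * h + 0.6893 * d)) ≤
      0.1042 - 0.1866 * h - 0.1671 * d := by linarith only [e1, e2, e3, e4, e5, e6, hd, hdh, hh, h0]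
  have f1 : (0.3351 - 0.8918 * h + 0.1021 * d) * (o - (1 - (0.6893 - 0.27 * h + 0.6893 * d)) * x) ≤
      g * P * (o - (1 - q) * x) := by
    have k1 : (1 - (0.6893 - 0.27 * h + 0.6893 * d)) * x ≤ 1 * o :=
      mul_le_mul (by linarith only [hd, hdh, hh, h0, hG, hq, hA, hs]) hxo hx zero_le_one
    have k2 : (1 - q) * x ≤ (1 - (0.6893 - 0.27 * h + 0.6893 * d)) * x :=
      mul_le_mul_of_nonneg_right (by linarith only [hd, hdh, hh, h0, hG, hq, hA, hs]) hx
    exact mul_le_mul hG (by linarith only [hd, hdh, hh, h0, k1, k2, hG, hq, hA, hs]) (by linarith only [hd, hdh, hh, h0, k1, k2, hG, hq, hA, hs]) (by linarith only [hd, hdh, hh, h0, k1, k2, hG, hq, hA, hs])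
  have f2 := mul_le_mul_of_nonneg_right he hD0
  have f3 := mul_le_mul_of_nonneg_right hAtq hx
  have f4 := mul_le_mul_of_nonneg_right hGq hx
  have f5 : (0.1657 - 0.1828 * h - 0.5337 * d) * (o - x - y) ≤
      (0.1657 - 0.1828 * h - 0.5337 * d) * D := mul_le_mul_of_nonneg_left hD (by linarith only [hd, hdh, hh, h0])
  -- After D is replaced by o - x - y, the coefficient of x is minus the factor in `f6`, that is
  -- 0.1657 - 0.1368 + 0.1042 = 0.1331 to leading order. The rest of the coefficient of y is in
  -- `f7`, so the bounds on x + y and on y finish the estimate.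
  have f6 : (0.1331 - 0.1141 * h - 0.308 * d) * (x + y) ≤
      (0.1331 - 0.1141 * h - 0.308 * d) * ((0.77 - 1.615 * (1.058 * h)) * o) :=
    mul_le_mul_of_nonneg_left hxy (by linarith only [hd, hdh, hh, h0])
  have f7 : (0.0326 - 0.0687 * h - 0.2257 * d) * y ≤
      (0.0326 - 0.0687 * h - 0.2257 * d) * ((0.385 - 0.615 * (1.058 * h)) * o) :=
    mul_le_mul_of_nonneg_left hy (by linarith only [hd, hdh, hh, h0])
  have f8 : 0.385 - 1.058 * h ≤ (0.3351 - 0.8918 * h + 0.1021 * d) +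
      (0.1657 - 0.1828 * h - 0.5337 * d) -
      (0.1331 - 0.1141 * h - 0.308 * d) * (0.77 - 1.615 * (1.058 * h)) -
      (0.0326 - 0.0687 * h - 0.2257 * d) * (0.385 - 0.615 * (1.058 * h)) := by linarith only [e1, e2, e3, e4, e5, e6, hd, hdh, hh, h0]
  have f9 := mul_le_mul_of_nonneg_right f8 ho
  linarith only [f1, f2, f3, f4, f5, f6, f7, f9, hv]

/-- Dictionary: h = 1/L, d = 0.559 - T/L; B and P are the powers of 1 - 2/L with exponents T and L -
T, β and Q have exponents smaller by one; a and A are the powers of a₁ with exponents T and L - T; ρ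
= (1 - h)/(1 + h) and m = 1/(2 + h). -/
theorem matroid_linear {h d a B P A Q β t g ρ m x y D o v : ℝ} (hd : 0 ≤ d) (hdh : d ≤ h)
    (hh : h ≤ 1 / 20)
    (hB : 0.3269 - 0.8123 * h + 0.6538 * d ≤ B)
    (ha : a ≤ 0.327 + 0.2097 * h + 0.7501 * d)
    (hP : P ≤ 0.414 - 0.7451 * d)
    (hP' : 0.4139 - 0.8114 * h - 0.9199 * d ≤ P) (hA : P ≤ A)
    (hβ : (1 + 2 * h) * B ≤ β) (hQ : (1 + 2 * h) * P ≤ Q)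
    (ht : t = 0.559 - d) (hg : g = 0.441 + d) (hρ : 1 - 2 * h ≤ ρ)
    (hm : 1 / 2 - h / 4 ≤ m)
    (ho : 0 ≤ o) (hx : 0 ≤ x) (hxo : x ≤ o) (hD : o - x - y ≤ D) (hD0 : 0 ≤ D)
    (hxy : x + y ≤ (0.61 - 1.695 * (1.058 * h)) * o)
    (hy : y ≤ (0.305 - 0.695 * (1.058 * h)) * o) (hv : v ≤ (0.305 - 1.058 * h) * o) :
    v ≤ A * (m * D * (1 - a) + ρ * (x / 2) * ((1 - B) / 2 + t * β)) +
      ρ * (o / 2 * ((1 - P) / 2) + g * Q * (o / 2 - x / 2 * (1 - B))) := by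
  subst ht hg
  have h0 : 0 ≤ h := hd.trans hdh
  have e1 : h * h ≤ h / 20 := by nlinarith
  have e2 : h * d ≤ d / 20 := by nlinarith
  have e3 : d * d ≤ d / 20 := by nlinarith
  have e4 : 0 ≤ h * h := by positivity
  have e5 : 0 ≤ h * d := by positivity
  have e6 : 0 ≤ d * d := by positivity
  have hA' := hP'.trans hA
  have hAa : 0.2785 - 0.6329 * h - 0.9296 * d ≤ A * (1 - a) := by
    refine le_trans ?_ (mul_le_mul hA' (sub_le_sub_left ha 1) (by linarith only [hd, hdh, hh, h0, hA', ha]) (by linarith only [hd, hdh, hh, h0, hA', ha]))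
    linarith only [e1, e2, e3, e4, e5, e6, hd, hdh, hh, h0]
  have he : 0.1392 - 0.3861 * h - 0.4648 * d ≤ A * (1 - a) * m := by
    refine le_trans ?_ (mul_le_mul hAa hm (by linarith only [hd, hdh, hh, h0, hA, hAa, hm]) (by linarith only [hd, hdh, hh, h0, hA, hAa, hm]))
    linarith only [e1, e2, e3, e4, e5, e6, hd, hdh, hh, h0]
  have ht : 0.559 + 1.118 * h - 1.1 * d ≤ (0.559 - d) * (1 + 2 * h) := by linarith only [e1, e2, e3, e4, e5, e6, hd, hdh, hh, h0]
  have htβ : (0.559 + 1.118 * h - 1.1 * d) * B ≤ (0.559 - d) * β := by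
    have k1 := mul_le_mul_of_nonneg_right ht (show 0 ≤ B by linarith only [hd, hdh, hh, h0, hB])
    have k2 := mul_le_mul_of_nonneg_left hβ (show 0 ≤ 0.559 - d by linarith only [hd, hdh, hh, h0, hB])
    linarith only [hd, hdh, hh, h0, k1, k2, hB, e1, e2, e3, e4, e5, e6]
  have hw1 : 0.5192 + 0.2721 * h - 0.357 * d ≤ (1 - B) / 2 + (0.559 - d) * β := by
    have k1 := mul_le_mul_of_nonneg_left hB (show 0 ≤ 0.059 + 1.118 * h - 1.1 * d by linarith only [hd, hdh, hh, h0])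
    linarith only [hd, hdh, hh, h0, k1, htβ, e1, e2, e3, e4, e5, e6]
  have hw2 : 0.5192 - 0.7936 * h - 0.357 * d ≤ ρ * ((1 - B) / 2 + (0.559 - d) * β) := by
    refine le_trans ?_ (mul_le_mul hρ hw1 (by linarith only [hd, hdh, hh, h0, hρ, hw1]) (by linarith only [hd, hdh, hh, h0, hρ, hw1]))
    linarith only [e1, e2, e3, e4, e5, e6, hd, hdh, hh, h0]
  have hW : 0.2148 - 0.7498 * h - 0.6254 * d ≤ A * (ρ * ((1 - B) / 2 + (0.559 - d) * β)) := by
    refine le_trans ?_ (mul_le_mul hA' hw2 (by linarith only [hd, hdh, hh, h0, hA', hw2]) (by linarith only [hd, hdh, hh, h0, hA', hw2]))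
    linarith only [e1, e2, e3, e4, e5, e6, hd, hdh, hh, h0]
  have hN : 0.586 - 1.172 * h + 0.6705 * d ≤ ρ * (1 - P) := by
    refine le_trans ?_ (mul_le_mul hρ (sub_le_sub_left hP 1) (by linarith only [hd, hdh, hh, h0, hρ, hP]) (by linarith only [hd, hdh, hh, h0, hρ, hP]))
    linarith only [e1, e2, e3, e4, e5, e6, hd, hdh, hh, h0]
  have hgQ : 0.1825 - 0.0286 * h - 0.119 * d ≤ (0.441 + d) * Q := by
    have k1 := mul_le_mul_of_nonneg_left hQ (show 0 ≤ 0.441 + d by linarith only [hd, hdh, hh, h0])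
    have k2 : 0.441 + 0.882 * h + d ≤ (0.441 + d) * (1 + 2 * h) := by linarith only [e1, e2, e3, e4, e5, e6, hd, hdh, hh, h0]
    have k3 := mul_le_mul k2 hP' (by linarith only [hd, hdh, hh, h0]) (by positivity)
    linarith only [hd, hdh, hh, h0, k1, k2, k3, e1, e2, e3, e4, e5, e6]
  have hM : 0.1825 - 0.3936 * h - 0.119 * d ≤ ρ * ((0.441 + d) * Q) := by
    refine le_trans ?_ (mul_le_mul hρ hgQ (by linarith only [hd, hdh, hh, h0, hρ, hgQ]) (by linarith only [hd, hdh, hh, h0, hρ, hgQ]))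
    linarith only [e1, e2, e3, e4, e5, e6, hd, hdh, hh, h0]
  have hMB : (0.1825 - 0.3936 * h - 0.119 * d) * (1 - (0.3269 - 0.8123 * h + 0.6538 * d)) ≤
      0.123 - 0.1166 * h - 0.1874 * d := by linarith only [e1, e2, e3, e4, e5, e6, hd, hdh, hh, h0]
  have f1 : (0.1825 - 0.3936 * h - 0.119 * d) *
      (o - (1 - (0.3269 - 0.8123 * h + 0.6538 * d)) * x) ≤
      ρ * ((0.441 + d) * Q) * (o - (1 - B) * x) := by
    have k1 : (1 - (0.3269 - 0.8123 * h + 0.6538 * d)) * x ≤ 1 * o :=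
      mul_le_mul (by linarith only [hd, hdh, hh, h0, hM, hB, hA]) hxo hx zero_le_one
    have k2 : (1 - B) * x ≤ (1 - (0.3269 - 0.8123 * h + 0.6538 * d)) * x :=
      mul_le_mul_of_nonneg_right (by linarith only [hd, hdh, hh, h0, hM, hB, hA]) hx
    exact mul_le_mul hM (by linarith only [hd, hdh, hh, h0, k1, k2, hM, hB, hA]) (by linarith only [hd, hdh, hh, h0, k1, k2, hM, hB, hA]) (by linarith only [hd, hdh, hh, h0, k1, k2, hM, hB, hA])
  have f2 := mul_le_mul_of_nonneg_right he hD0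
  have f3 := mul_le_mul_of_nonneg_right hW hx
  have f4 := mul_le_mul_of_nonneg_right hMB hx
  have f0 := mul_le_mul_of_nonneg_right hN ho
  have f5 : (0.1392 - 0.3861 * h - 0.4648 * d) * (o - x - y) ≤
      (0.1392 - 0.3861 * h - 0.4648 * d) * D := mul_le_mul_of_nonneg_left hD (by linarith only [hd, hdh, hh, h0])
  -- The same splitting as for the size constraint: x has coefficient -(0.1392 - 0.2148/2 + 0.123/2)
  -- to leading order, and the excess in the coefficient of y goes to `f7`.
  have f6 : (0.0933 - 0.0695 * h - 0.2458 * d) * (x + y) ≤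
      (0.0933 - 0.0695 * h - 0.2458 * d) * ((0.61 - 1.695 * (1.058 * h)) * o) :=
    mul_le_mul_of_nonneg_left hxy (by linarith only [hd, hdh, hh, h0])
  have f7 : (0.0459 - 0.3166 * h - 0.219 * d) * y ≤
      (0.0459 - 0.3166 * h - 0.219 * d) * ((0.305 - 0.695 * (1.058 * h)) * o) :=
    mul_le_mul_of_nonneg_left hy (by linarith only [hd, hdh, hh, h0])
  have f8 : 0.305 - 1.058 * h ≤ (0.1465 - 0.293 * h + 0.167625 * d) +
      (0.09125 - 0.1968 * h - 0.0595 * d) +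
      (0.1392 - 0.3861 * h - 0.4648 * d) -
      (0.0933 - 0.0695 * h - 0.2458 * d) * (0.61 - 1.695 * (1.058 * h)) -
      (0.0459 - 0.3166 * h - 0.219 * d) * (0.305 - 0.695 * (1.058 * h)) := by linarith only [e1, e2, e3, e4, e5, e6, hd, hdh, hh, h0]
  have f9 := mul_le_mul_of_nonneg_right f8 ho
  linarith only [f0, f1, f2, f3, f4, f5, f6, f7, f9, hv]


/-- For a fixed number of rounds all powers are rational. With ε o as a variable of its own, the
claim is then a linear inequality in o, x, y, D that follows from the linear hypotheses. -/
theorem size_value_of_lt {L : ℕ} (h2 : 2 ≤ L) (h20 : L < 20) {ε x y D o : ℝ} (ho : 0 < o)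
    (hx : 0 ≤ x) (hε : 10 / 9 / ((L : ℝ) + 1) ≤ ε) (hxy : x + y ≤ (0.77 - 1.615 * ε) * o)
    (hD : o - x - y ≤ D) :
    (0.385 - ε) * o ≤ (((L : ℝ) + 1) / (L + 2)) ^ (L - 372 * L / 1000) *
      (D * (1 - (((L : ℝ) + 1) / (L + 2)) ^ (372 * L / 1000)) + 1 / ((L : ℝ) + 2) *
        ((372 * L / 1000 : ℕ) : ℝ) * (1 - 1 / (L : ℝ)) ^ (372 * L / 1000) * x) +
      1 / ((L : ℝ) + 2) * ((L - 372 * L / 1000 : ℕ) : ℝ) * (1 - 1 / (L : ℝ)) ^ (L - 372 * L / 1000) *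
      (o - (1 - (1 - 1 / (L : ℝ)) ^ (372 * L / 1000)) * x) := by
  have h1 := mul_le_mul_of_nonneg_right hε ho.le
  rw [sub_mul] at hxy ⊢
  rw [mul_assoc] at hxy
  generalize ε * o = e at *
  clear hε
  interval_cases L <;> norm_num at h1 ⊢ <;> linarith

theorem matroid_value_of_lt {L : ℕ} (h3 : 3 ≤ L) (h20 : L < 20) {ε x y D o : ℝ} (ho : 0 < o)
    (hx : 0 ≤ x) (hε : 10 / 9 / ((L : ℝ) + 1) ≤ ε) (hxy : x + y ≤ (0.61 - 1.695 * ε) * o)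
    (hy : 0 ≤ y) (hD : o - x - y ≤ D) :
    (0.305 - ε) * o ≤ ((L : ℝ) / (L + 1) - 1 / L) ^ (L - 559 * L / 1000) *
          ((L : ℝ) / (2 * L + 1) * D * (1 - ((L : ℝ) / (L + 1) - 1 / L) ^ (559 * L / 1000)) +
            (1 - 1 / (L : ℝ)) * (1 / ((L : ℝ) + 1)) * (x / 2) *
              ((1 - (1 - 2 / (L : ℝ)) ^ (559 * L / 1000)) * (L / 2) +
                (559 * L / 1000 : ℕ) * (1 - 2 / (L : ℝ)) ^ (559 * L / 1000 - 1))) +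
        (1 - 1 / (L : ℝ)) * (1 / ((L : ℝ) + 1)) *
          (o / 2 * ((1 - (1 - 2 / (L : ℝ)) ^ (L - 559 * L / 1000)) * (L / 2)) +
            (L - 559 * L / 1000 : ℕ) * (1 - 2 / (L : ℝ)) ^ (L - 559 * L / 1000 - 1) *
            (o / 2 - x / 2 * (1 - (1 - 2 / (L : ℝ)) ^ (559 * L / 1000)))) := by
  have h1 := mul_le_mul_of_nonneg_right hε ho.le
  rw [sub_mul] at hxy ⊢
  rw [mul_assoc] at hxy
  generalize ε * o = e at *
  clear hε
  interval_cases L <;> norm_num at h1 ⊢ <;> linarith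


/-- Reciprocal coordinates for a number of rounds `L ≥ 20` of which `T = ⌊t L⌋` are guided. -/
theorem reciprocal_coordinates {L T : ℕ} (hL : 20 ≤ L) {t : ℝ} (ht0 : 0 ≤ t) (ht1 : t ≤ 1)
    (hT : T = ⌊t * L⌋₊) : ∃ h d : ℝ, 0 < h ∧ h ≤ 1 / 20 ∧ 0 ≤ d ∧ d ≤ h ∧ (L : ℝ) = 1 / h ∧
      (T : ℝ) = (t - d) / h ∧ ((L - T : ℕ) : ℝ) = (1 - t + d) / h := by
  have hL' : (20 : ℝ) ≤ L := by exact_mod_cast hL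
  have hL0 : (0 : ℝ) < L := by linarith
  have h1 : (T : ℝ) ≤ t * L := hT ▸ Nat.floor_le (by positivity)
  have h2 : t * L < T + 1 := hT ▸ Nat.lt_floor_add_one _
  have h3 : T ≤ L := by
    have : (T : ℝ) ≤ L := by nlinarith
    exact_mod_cast this
  refine ⟨1 / L, t - T / L, by positivity, one_div_le_one_div_of_le (by norm_num) hL', ?_, ?_,
    by field_simp, by field_simp; ring, ?_⟩
  · rw [sub_nonneg, div_le_iff₀ hL0]; exact h1
  · rw [sub_le_iff_le_add, ← add_div, le_div_iff₀ hL0]; linarith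
  · rw [Nat.cast_sub h3]; field_simp; ring

/-- For h ≤ 1/20 the left side of `hε` is h (10/9)/(1 + h), and (10/9) · (20/21) > 1.058. -/
theorem one_div_le_of_rounds {h ε : ℝ} (h0 : 0 < h) (h20 : h ≤ 1 / 20)
    (hε : 10 / 9 / (1 / h + 1) ≤ ε) : 1.058 * h ≤ ε := by
  refine le_trans ?_ hε
  rw [le_div_iff₀ (by positivity)]
  have : 1.058 * h * (1 / h + 1) = 1.058 * (1 + h) := by field_simp
  rw [this]
  linarith

set_option maxHeartbeats 1000000 in
theorem size_value_of_ge {L T : ℕ} (hL : 20 ≤ L) (hT : T = ⌊(0.372 : ℝ) * L⌋₊) {ε x y D o : ℝ}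
    (ho : 0 ≤ o) (hx : 0 ≤ x) (hxo : x ≤ o) (hε : 10 / 9 / ((L : ℝ) + 1) ≤ ε)
    (hxy : x + y ≤ (0.77 - 1.615 * ε) * o) (hy : y ≤ (0.385 - 0.615 * ε) * o)
    (hD : o - x - y ≤ D) (hD0 : 0 ≤ D) :
    (0.385 - ε) * o ≤ (((L : ℝ) + 1) / (L + 2)) ^ (L - T) *
      (D * (1 - (((L : ℝ) + 1) / (L + 2)) ^ T) + 1 / ((L : ℝ) + 2) *
        T * (1 - 1 / (L : ℝ)) ^ T * x) +
      1 / ((L : ℝ) + 2) * (L - T : ℕ) * (1 - 1 / (L : ℝ)) ^ (L - T) *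
      (o - (1 - (1 - 1 / (L : ℝ)) ^ T) * x) := by
  obtain ⟨h, d, h0, h20, hd0, hdh, hL1, hT1, hJ1⟩ :=
    reciprocal_coordinates hL (by norm_num) (by norm_num) hT
  rw [hL1] at hε ⊢
  have hε' := one_div_le_of_rounds h0 h20 hε
  have e1 : h * h ≤ h / 20 := by nlinarith
  have e2 : h * d ≤ d / 20 := by nlinarith
  have e3 : d * d ≤ h * d := by nlinarith
  have e4 : 0 ≤ h * h := by positivity
  have e5 : 0 ≤ h * d := by positivity
  have e6 : 0 ≤ d * d := by positivity
  have hp : 1 - 1 / (1 / h) = 1 - h := by rw [one_div_one_div]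
  have hr : (1 / h + 1) / (1 / h + 2) = (1 + h) / (1 + 2 * h) := by field_simp
  have hr2 : (1 + h) / (1 + 2 * h) = 1 - h / (1 + 2 * h) := by field_simp; ring
  have hz : 1 ≤ (1 - h) * (1 + h / (1 - h)) := by
    have : 1 - h ≠ 0 := by linarith
    rw [mul_add, mul_div_cancel₀ _ this]; linarith only [h0]
  have hh1 : 0 ≤ h / (1 - h) := div_nonneg h0.le (by linarith only [h0, h20, hd0, hdh])
  have hq := exp_neg_mul_le_pow hh1 hz T
  have hP := exp_neg_mul_le_pow hh1 hz (L - T)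
  have hA := exp_neg_mul_le_pow (p := (1 + h) / (1 + 2 * h)) (z := h / (1 + h)) (by positivity)
    (by field_simp; linarith) (L - T)
  have hs := pow_le_exp_neg_mul (p := (1 + h) / (1 + 2 * h)) (by positivity) hr2.le T
  rw [hT1] at hq hs
  rw [hJ1] at hP hA
  have g1 : (0.372 - d) / h * (h / (1 - h)) = (0.372 - d) / (1 - h) := by field_simp
  have g2 : (1 - 0.372 + d) / h * (h / (1 - h)) = (1 - 0.372 + d) / (1 - h) := by field_simp
  have g3 : (1 - 0.372 + d) / h * (h / (1 + h)) = (1 - 0.372 + d) / (1 + h) := by field_simp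
  have g4 : (0.372 - d) / h * (h / (1 + 2 * h)) = (0.372 - d) / (1 + 2 * h) := by field_simp
  rw [g1] at hq
  rw [g2] at hP
  rw [g3] at hA
  rw [g4] at hs
  -- The slopes linearise the exponents on 0 ≤ h ≤ 1/20: 0.39158 ≥ 0.372 · 20/19, 0.66106 ≥ 0.628 ·
  -- 20/19, 1.05264 ≥ 20/19 and 0.59809 ≤ 0.628 · 20/21.
  have k1 := mul_le_exp_neg (w := d - 0.39158 * h) (b := (0.372 - d) / (1 - h)) exp_372.1
    (by norm_num) (by rw [div_le_iff₀ (by linarith only [h0, h20, hd0, hdh])]; linarith only [e1, e5, h0])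
  have k2 := mul_le_exp_neg (w := -(0.66106 * h + 1.05264 * d)) (b := (1 - 0.372 + d) / (1 - h))
    le_exp_628 (by norm_num) (by rw [div_le_iff₀ (by linarith only [h0, h20, hd0, hdh])]; linarith only [e1, e2, h0, hd0])
  have k3 := mul_le_exp_neg (w := 0.59809 * h - d) (b := (1 - 0.372 + d) / (1 + h)) le_exp_628
    (by norm_num) (by rw [div_le_iff₀ (by linarith only [h0, h20, hd0, hdh])]; linarith only [e1, e5, h0])
  have k4 := exp_neg_le_mul (w := (0.744 * h + d) / (1 + 2 * h)) (b := (0.372 - d) / (1 + 2 * h))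
    (m := 1 + 0.744 * h + d) exp_372.2 (by
      have : 1 - (0.744 * h + d) / (1 + 2 * h) = (1 + 1.256 * h - d) / (1 + 2 * h) := by
        field_simp; ring
      rw [this, ← mul_div_assoc, le_div_iff₀ (by linarith only [h0, h20, hd0, hdh])]
      have : d * h ≤ h * h := by nlinarith
      linarith only [this, e3, e4, e5]) (by linarith only [h0, h20, hd0, hdh]) (by
      have : 0.372 - (0.744 * h + d) / (1 + 2 * h) = (0.372 - d) / (1 + 2 * h) := by
        field_simp; ring
      rw [this])
  rw [hp, hr]
  have hT2 : (1 / (1 / h + 2)) * (T : ℝ) = (0.372 - d) / (1 + 2 * h) := by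
    rw [hT1]; field_simp
  have hJ2 : (1 / (1 / h + 2)) * ((L - T : ℕ) : ℝ) = (1 - 0.372 + d) / (1 + 2 * h) := by
    rw [hJ1]; field_simp
  rw [hT2, hJ2]
  have m1 : ε * o ≥ 1.058 * h * o := mul_le_mul_of_nonneg_right hε' ho
  refine size_linear hd0 hdh h20 (hq.trans' (k1.trans' ?_)) (hP.trans' (k2.trans' ?_))
    (hA.trans' (k3.trans' ?_)) (hs.trans (k4.trans ?_)) ?_ ?_ ho hx hxo hD hD0
    (hxy.trans ?_) (hy.trans ?_) ?_
  · linarith only [h0, hd0, hdh]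
  · linarith only [h0, hd0, hdh]
  · linarith only [h0, hd0, hdh]
  · linarith only [h0, hd0, hdh]
  · rw [le_div_iff₀ (by linarith only [h0, h20, hd0, hdh])]; linarith only [e4, e5]
  · rw [le_div_iff₀ (by linarith only [h0, h20, hd0, hdh])]; linarith only [e4, e5, e2, hd0]
  · linarith only [m1]
  · linarith only [m1]
  · linarith only [m1]

set_option maxHeartbeats 1000000 in
theorem matroid_value_of_ge {L T : ℕ} (hL : 20 ≤ L) (hT : T = ⌊(0.559 : ℝ) * L⌋₊)
    {ε x y D o : ℝ} (ho : 0 ≤ o) (hx : 0 ≤ x) (hxo : x ≤ o) (hε : 10 / 9 / ((L : ℝ) + 1) ≤ ε)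
    (hxy : x + y ≤ (0.61 - 1.695 * ε) * o) (hy : y ≤ (0.305 - 0.695 * ε) * o)
    (hD : o - x - y ≤ D) (hD0 : 0 ≤ D) :
    (0.305 - ε) * o ≤ ((L : ℝ) / (L + 1) - 1 / L) ^ (L - T) *
          ((L : ℝ) / (2 * L + 1) * D * (1 - ((L : ℝ) / (L + 1) - 1 / L) ^ T) +
            (1 - 1 / (L : ℝ)) * (1 / ((L : ℝ) + 1)) * (x / 2) *
              ((1 - (1 - 2 / (L : ℝ)) ^ T) * (L / 2) + T * (1 - 2 / (L : ℝ)) ^ (T - 1))) +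
        (1 - 1 / (L : ℝ)) * (1 / ((L : ℝ) + 1)) *
          (o / 2 * ((1 - (1 - 2 / (L : ℝ)) ^ (L - T)) * (L / 2)) +
            (L - T : ℕ) * (1 - 2 / (L : ℝ)) ^ (L - T - 1) *
            (o / 2 - x / 2 * (1 - (1 - 2 / (L : ℝ)) ^ T))) := by
  obtain ⟨h, d, h0, h20, hd0, hdh, hL1, hT1, hJ1⟩ :=
    reciprocal_coordinates hL (by norm_num) (by norm_num) hT
  -- Both parts of the run are nonempty, so the exponents T - 1 and L - T - 1 are not truncated.
  have hTpos : T ≠ 0 := by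
    rintro rfl
    rw [eq_comm, Nat.cast_zero, div_eq_zero_iff] at hT1
    rcases hT1 with h | h <;> linarith
  have hJpos : L - T ≠ 0 := by
    intro h
    rw [h, eq_comm, Nat.cast_zero, div_eq_zero_iff] at hJ1
    rcases hJ1 with h | h <;> linarith
  rw [hL1] at hε ⊢
  have hε' := one_div_le_of_rounds h0 h20 hε
  have e1 : h * h ≤ h / 20 := by nlinarith
  have e2 : h * d ≤ d / 20 := by nlinarith
  have e3 : d * d ≤ h * d := by nlinarith
  have e4 : 0 ≤ h * h := by positivity
  have e5 : 0 ≤ h * d := by positivity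
  have e6 : 0 ≤ d * d := by positivity
  have hb : 1 - 2 / (1 / h) = 1 - 2 * h := by rw [div_div_eq_mul_div, div_one]
  have ha : 1 / h / (1 / h + 1) - 1 / (1 / h) = 1 / (1 + h) - h := by field_simp
  have ha1 : 1 / (1 + h) - h ≤ 1 - (2 * h - h * h) := by
    have : 1 / (1 + h) ≤ 1 - h + h * h := by
      rw [div_le_iff₀ (by linarith only [h0, h20, hd0, hdh])]
      have : 0 ≤ h * h * h := by positivity
      linarith
    linarith
  have ha2 : 1 - 2 * h ≤ 1 / (1 + h) - h := by
    have : 1 - h ≤ 1 / (1 + h) := by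
      rw [le_div_iff₀ (by linarith only [h0, h20, hd0, hdh])]; linarith
    linarith
  have hz : 1 ≤ (1 - 2 * h) * (1 + 2 * h / (1 - 2 * h)) := by
    have : 1 - 2 * h ≠ 0 := by linarith
    rw [mul_add, mul_div_cancel₀ _ this]; linarith only [h0]
  have hh1 : 0 ≤ 2 * h / (1 - 2 * h) := div_nonneg (by linarith only [h0, h20, hd0, hdh]) (by linarith only [h0, h20, hd0, hdh])
  have hB := exp_neg_mul_le_pow hh1 hz T
  have hP' := exp_neg_mul_le_pow hh1 hz (L - T)
  have hP := pow_le_exp_neg_mul (p := 1 - 2 * h) (by linarith only [h0, h20, hd0, hdh]) le_rfl (L - T)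
  have haT := pow_le_exp_neg_mul (by linarith only [h0, h20, ha2]) ha1 T
  rw [hT1] at hB haT
  rw [hJ1] at hP hP'
  have g1 : (0.559 - d) / h * (2 * h / (1 - 2 * h)) = (1.118 - 2 * d) / (1 - 2 * h) := by
    field_simp; ring
  have g2 : (1 - 0.559 + d) / h * (2 * h / (1 - 2 * h)) = (0.882 + 2 * d) / (1 - 2 * h) := by
    field_simp; ring
  have g3 : (1 - 0.559 + d) / h * (2 * h) = 0.882 + 2 * d := by field_simp; ring
  have g4 : (0.559 - d) / h * (2 * h - h * h) = (0.559 - d) * (2 - h) := by field_simp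
  rw [g1] at hB
  rw [g2] at hP'
  rw [g3] at hP
  rw [g4] at haT
  -- Here 1 - 2h ≥ 0.9, so 2.48445 ≥ 2 · 1.118/0.9, 1.9601 ≥ 2 · 0.882/0.9 and 2.22223 ≥ 2/0.9. In
  -- `k4` the perturbation is at most 0.559/20 + 2/20 = 0.12795, and up to there 1 + 1.147 w ≥ 1/(1
  -- - w).
  have k1 := mul_le_exp_neg (w := 2 * d - 2.48445 * h) (b := (1.118 - 2 * d) / (1 - 2 * h))
    exp_1118.1 (by norm_num) (by rw [div_le_iff₀ (by linarith only [h0, h20, hd0, hdh])]; linarith only [e1, e5, h0])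
  have k2 := mul_le_exp_neg (w := -(1.9601 * h + 2.22223 * d))
    (b := (0.882 + 2 * d) / (1 - 2 * h)) exp_882.1 (by norm_num)
    (by rw [div_le_iff₀ (by linarith only [h0, h20, hd0, hdh])]; linarith only [e1, e2, h0, hd0])
  have k3 := exp_neg_le_mul (w := -(2 * d)) (b := 0.882 + 2 * d) (m := 1 - 1.8 * d) exp_882.2
    (by linarith only [e2, e3, hd0]) (by linarith only [h0, h20, hd0, hdh]) (by linarith only [h0, h20, hd0, hdh])
  have k4 := exp_neg_le_mul (w := 0.559 * h + 2 * d) (b := (0.559 - d) * (2 - h))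
    (m := 1 + 1.147 * (0.559 * h + 2 * d)) exp_1118.2 (by
      have : 0 ≤ (0.559 * h + 2 * d) * (0.12795 - (0.559 * h + 2 * d)) :=
        mul_nonneg (by linarith only [h0, h20, hd0, hdh]) (by linarith only [h0, h20, hd0, hdh])
      linarith) (by linarith only [h0, h20, hd0, hdh]) (by linarith only [e5])
  have hpow : ∀ n : ℕ, n ≠ 0 → (1 + 2 * h) * (1 - 2 * h) ^ n ≤ (1 - 2 * h) ^ (n - 1) := by
    intro n hn
    obtain ⟨n, rfl⟩ := Nat.exists_eq_succ_of_ne_zero hn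
    rw [Nat.succ_sub_one, pow_succ]
    have h1 : 0 ≤ (1 - 2 * h) ^ n := pow_nonneg (by linarith only [h0, h20, hd0, hdh]) n
    have h2 : 0 ≤ h * h * (1 - 2 * h) ^ n := by positivity
    linarith
  have hm : 1 / h / (2 * (1 / h) + 1) = 1 / (2 + h) := by field_simp
  have hq : (1 - 1 / (1 / h)) * (1 / (1 / h + 1)) = (1 - h) / (1 + h) * h := by field_simp
  rw [hb, ha, hm, hq, hT1, hJ1]
  have m1 : ε * o ≥ 1.058 * h * o := mul_le_mul_of_nonneg_right hε' ho
  refine (matroid_linear (ρ := (1 - h) / (1 + h)) (m := 1 / (2 + h)) hd0 hdh h20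
    (hB.trans' (k1.trans' ?_)) (haT.trans (k4.trans ?_)) (hP.trans (k3.trans ?_)) (hP'.trans' (k2.trans' ?_))
    (pow_le_pow_left₀ (by linarith only [h0, h20, hd0, hdh]) ha2 (L - T)) (hpow T hTpos) (hpow (L - T) hJpos) rfl rfl
    ?_ ?_ ho hx hxo hD hD0 (hxy.trans ?_) (hy.trans ?_) (v := (0.305 - ε) * o) ?_).trans_eq ?_
  · linarith only [h0, hd0, hdh]
  · linarith only [h0, hd0, hdh]
  · linarith only [h0, hd0, hdh]
  · linarith only [h0, hd0, hdh]
  · rw [le_div_iff₀ (by linarith only [h0, h20, hd0, hdh])]; linarith only [e4]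
  · rw [le_div_iff₀ (by linarith only [h0, h20, hd0, hdh])]; linarith only [e4]
  · linarith only [m1]
  · linarith only [m1]
  · linarith only [m1]
  · generalize (1 - 2 * h) ^ (T - 1) = β
    generalize (1 - 2 * h) ^ (L - T - 1) = Q
    field_simp
    ring


/-! ### Approximation ratios -/

theorem le_rounds {ε : ℝ} (hε : 0 < ε) {n : ℕ} (h : n * (9 * ε) ≤ 10) : n ≤ rounds ε :=
  Nat.le_floor ((le_div_iff₀ (by positivity)).2 h)

theorem div_rounds_le {ε : ℝ} (hε : 0 < ε) : 10 / 9 / ((rounds ε : ℝ) + 1) ≤ ε := by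
  have h : 10 / (9 * ε) < rounds ε + 1 := Nat.lt_floor_add_one _
  rw [div_lt_iff₀ (by positivity)] at h
  rw [div_le_iff₀ (by positivity)]
  linarith

theorem floor_thousandths_mul (n L : ℕ) : ⌊(n / 1000 : ℝ) * L⌋₊ = n * L / 1000 := by
  have h := Nat.floor_div_eq_div (K := ℝ) (n * L) 1000
  rw [← h]
  congr 1
  push_cast
  ring

/-- By contradiction: if v < (0.385 - ε) o, then z ≤ v turns the guarantees of the local search into
x + y ≤ (0.77 - 1.615 ε) o and y ≤ (0.385 - 0.615 ε) o, where a term -ε² o is dropped. The path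
bound then exceeds v. Only ε < 0.385 matters, so there are at least two rounds. -/
theorem size_ratio {ε x y z o D v : ℝ} (hε : 0 < ε) (ho : 0 < o) (hx : 0 ≤ x) (hy : 0 ≤ y)
    (hv0 : 0 ≤ v) (hxy : x + y ≤ (2 + ε) * z) (hyz : y ≤ (1 + ε) * z) (hzv : z ≤ v)
    (hD : o - x - y ≤ D)
    (hv : ∀ u w u' w', PathBound ⌊0.372 * (rounds ε : ℝ)⌋₊ (((rounds ε : ℝ) + 1) / (rounds ε + 2))
      ((1 - 1 / (rounds ε : ℝ)) * (1 / ((rounds ε : ℝ) + 2))) (1 - 1 / (rounds ε : ℝ)) 0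
      (1 / ((rounds ε : ℝ) + 2)) x D o u w u' w' →
      u' (rounds ε - ⌊0.372 * (rounds ε : ℝ)⌋₊) ≤ v) :
    (0.385 - ε) * o ≤ v := by
  rcases le_or_gt 0.385 ε with h | h
  · exact (mul_nonpos_of_nonpos_of_nonneg (by linarith) ho.le).trans hv0
  by_contra! hlt
  have hz := hzv.trans hlt.le
  have hεε : 0 ≤ ε * ε * o := by positivity
  have h1 := hxy.trans (mul_le_mul_of_nonneg_left hz (by linarith))
  have h2 := hyz.trans (mul_le_mul_of_nonneg_left hz (by linarith))
  have hεo : 0 < ε * o := by positivity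
  have hxo : x ≤ o := by linarith
  have hL : 2 ≤ rounds ε := le_rounds hε (by push_cast; linarith)
  have h3 := hv _ _ _ _ (PathBound.size (by omega) _ hx hxo)
  refine hlt.not_ge (le_trans ?_ h3)
  have hε' := div_rounds_le hε
  rcases lt_or_ge (rounds ε) 20 with h20 | h20
  · have hfl := floor_thousandths_mul 372 (rounds ε)
    norm_num only at hfl
    norm_num only
    rw [hfl]
    have := size_value_of_lt hL h20 ho hx hε' (by linarith) hD
    norm_num only at this
    exact this
  · exact size_value_of_ge h20 rfl ho.le hx hxo hε' (by linarith) (by linarith) hD (by linarith)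

theorem matroid_ratio {ε x y z o D v : ℝ} (hε : 0 < ε) (ho : 0 < o) (hx : 0 ≤ x) (hy : 0 ≤ y)
    (hv0 : 0 ≤ v) (hxy : x + y ≤ (2 + ε) * z) (hyz : y ≤ (1 + ε) * z) (hzv : z ≤ v)
    (hD : o - x - y ≤ D)
    (hv : ∀ u w u' w', PathBound ⌊0.559 * (rounds ε : ℝ)⌋₊
      ((rounds ε : ℝ) / (rounds ε + 1) - 1 / rounds ε)
      ((1 - 1 / (rounds ε : ℝ)) * (1 / ((rounds ε : ℝ) + 1))) (1 - 2 / (rounds ε : ℝ))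
      (1 / rounds ε) (1 / ((rounds ε : ℝ) + 1)) x D o u w u' w' →
      u' (rounds ε - ⌊0.559 * (rounds ε : ℝ)⌋₊) ≤ v) :
    (0.305 - ε) * o ≤ v := by
  rcases le_or_gt 0.305 ε with h | h
  · exact (mul_nonpos_of_nonpos_of_nonneg (by linarith) ho.le).trans hv0
  by_contra! hlt
  have hz := hzv.trans hlt.le
  have hεε : 0 ≤ ε * ε * o := by positivity
  have h1 := hxy.trans (mul_le_mul_of_nonneg_left hz (by linarith))
  have h2 := hyz.trans (mul_le_mul_of_nonneg_left hz (by linarith))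
  have hεo : 0 < ε * o := by positivity
  have hxo : x ≤ o := by linarith
  have hL : 3 ≤ rounds ε := le_rounds hε (by push_cast; linarith)
  have h3 := hv _ _ _ _ (PathBound.matroid (by omega) _ hx hxo)
  refine hlt.not_ge (le_trans ?_ h3)
  have hε' := div_rounds_le hε
  rcases lt_or_ge (rounds ε) 20 with h20 | h20
  · have hfl := floor_thousandths_mul 559 (rounds ε)
    norm_num only at hfl
    norm_num only
    rw [hfl]
    have := matroid_value_of_lt hL h20 ho hx hε' (by linarith) hy hD
    norm_num only at this
    exact this
  · exact matroid_value_of_ge h20 rfl ho.le hx hxo hε' (by linarith) (by linarith) hD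
      (by linarith)


/-! ### The number of queries -/

theorem geom_sum_le_two_mul_pow {K : ℕ} (hK : 2 ≤ K) (n : ℕ) :
    ∑ i ∈ Finset.range (n + 1), K ^ i ≤ 2 * K ^ n := by
  induction n with
  | zero => simp
  | succ n ih =>
    rw [Finset.sum_range_succ, pow_succ]
    have : 2 * K ^ n ≤ K ^ n * K := by rw [mul_comm]; exact Nat.mul_le_mul_left _ hK
    omega

/-- (1 + 1/L)^m ≤ exp(m/L) ≤ e < 3. Hence powers of the branching number (L + 1) L are those of L²,
up to a factor 3. -/
theorem succ_pow_le {L m : ℕ} (hL : 1 ≤ L) (hm : m ≤ L) : (L + 1) ^ m ≤ 3 * L ^ m := by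
  have hL' : (0 : ℝ) < L := by exact_mod_cast hL
  have h1 : (1 + 1 / (L : ℝ)) ^ m ≤ 3 := by
    calc (1 + 1 / (L : ℝ)) ^ m ≤ Real.exp (1 / L) ^ m :=
          pow_le_pow_left₀ (by positivity) (by linarith [Real.add_one_le_exp (1 / (L : ℝ))]) m
      _ = Real.exp (m * (1 / L)) := (Real.exp_nat_mul _ _).symm
      _ ≤ Real.exp 1 := by
          rw [Real.exp_le_exp, mul_one_div, div_le_one hL']
          exact_mod_cast hm
      _ ≤ 3 := Real.exp_one_lt_three.le
  have h2 : ((L : ℝ) + 1) ^ m ≤ 3 * (L : ℝ) ^ m := by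
    calc ((L : ℝ) + 1) ^ m = (1 + 1 / (L : ℝ)) ^ m * (L : ℝ) ^ m := by
          rw [← mul_pow]; congr 1; field_simp
      _ ≤ 3 * (L : ℝ) ^ m := mul_le_mul_of_nonneg_right h1 (by positivity)
  exact_mod_cast h2

/-- The rounds cost at most 6 L^(2L - 2) · 15 k n L, the final comparison at most 3 L · L^(2L - 1) +
1, and 94 = 90 + 3 + 1. The surplus factor L is absorbed by k n, since L ≤ k. -/
theorem size_enumeration_le {k n L : ℕ} (hk : 1 ≤ k) (hkn : k ≤ n) (hL : 1 ≤ L) (hLk : L ≤ k) :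
    ∑ i ∈ Finset.range L, ((L + 1) * L) ^ i * ((n + 3 * k + 1) * (1 + (L + 1) * k)) +
      (((L + 1) * L) ^ L + 1) ≤ 94 * (k * n * L ^ (2 * L - 1)) := by
  obtain ⟨m, rfl⟩ : ∃ m, L = m + 1 := ⟨L - 1, by omega⟩
  have hB : (n + 3 * k + 1) * (1 + (m + 1 + 1) * k) ≤ 15 * (k * n) * (m + 1) := by
    have h1 : n + 3 * k + 1 ≤ 5 * n := by omega
    have h2 : 1 + (m + 1 + 1) * k ≤ 3 * (k * (m + 1)) := by nlinarith
    calc _ ≤ 5 * n * (3 * (k * (m + 1))) := Nat.mul_le_mul h1 h2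
      _ = _ := by ring
  have hK : ∑ i ∈ Finset.range (m + 1), ((m + 1 + 1) * (m + 1)) ^ i ≤
      6 * ((m + 1) ^ m * (m + 1) ^ m) := by
    refine (geom_sum_le_two_mul_pow (by nlinarith) m).trans ?_
    have h := Nat.mul_le_mul_right ((m + 1) ^ m) (succ_pow_le hL (m := m) (by omega))
    rw [mul_pow]
    linarith
  have hF : ((m + 1 + 1) * (m + 1)) ^ (m + 1) ≤ 3 * ((m + 1) * (m + 1) ^ (2 * m + 1)) := by
    rw [mul_pow]
    calc _ ≤ 3 * (m + 1) ^ (m + 1) * (m + 1) ^ (m + 1) :=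
          Nat.mul_le_mul_right _ (succ_pow_le hL le_rfl)
      _ = _ := by ring
  have hkL : (m + 1) * (m + 1) ^ (2 * m + 1) ≤ k * n * (m + 1) ^ (2 * m + 1) :=
    Nat.mul_le_mul_right _ (by nlinarith)
  have h1 : 1 ≤ (m + 1) * (m + 1) ^ (2 * m + 1) := Nat.mul_pos (by omega) (by positivity)
  have hS := Nat.mul_le_mul hK hB
  rw [Finset.sum_mul] at hS
  have e : 6 * ((m + 1) ^ m * (m + 1) ^ m) * (15 * (k * n) * (m + 1)) =
      90 * (k * n * (m + 1) ^ (2 * m + 1)) := by ring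
  rw [e] at hS
  have : 2 * (m + 1) - 1 = 2 * m + 1 := by omega
  rw [this]
  linarith

theorem matroid_enumeration_le {k n L : ℕ} (hk : 1 ≤ k) (hkn : k ≤ n) (hL : 1 ≤ L) :
    ∑ i ∈ Finset.range L, L ^ i * (k * (L * (n + 3 * k + 1))) + (L ^ L + 1) ≤
      94 * (k * n * L ^ (2 * L - 1)) := by
  obtain ⟨m, rfl⟩ : ∃ m, L = m + 1 := ⟨L - 1, by omega⟩
  have hB : k * ((m + 1) * (n + 3 * k + 1)) ≤ 5 * (k * n) * (m + 1) := by
    have h1 : n + 3 * k + 1 ≤ 5 * n := by omega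
    calc _ ≤ k * ((m + 1) * (5 * n)) := by gcongr
      _ = _ := by ring
  have hK : ∑ i ∈ Finset.range (m + 1), (m + 1) ^ i ≤ 2 * (m + 1) ^ m := by
    -- One round has branching number 1, where the sum is not dominated by ratio 2 but has a single
    -- term.
    rcases m with _ | m
    · simp
    · exact geom_sum_le_two_mul_pow (by omega) _
  have hS := Nat.mul_le_mul hK hB
  rw [Finset.sum_mul] at hS
  have e : 2 * (m + 1) ^ m * (5 * (k * n) * (m + 1)) = 10 * (k * n * (m + 1) ^ (m + 1)) := by ring
  rw [e] at hS
  have hp : (m + 1) ^ (m + 1) ≤ (m + 1) ^ (2 * m + 1) := Nat.pow_le_pow_right (by omega) (by omega)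
  have h1 : 1 ≤ (m + 1) ^ (2 * m + 1) := Nat.pos_of_ne_zero (by positivity)
  have hkn1 : 1 ≤ k * n := Nat.mul_pos hk (hk.trans hkn)
  have h2 := Nat.mul_le_mul_left (k * n) hp
  have h3 := Nat.mul_le_mul_right ((m + 1) ^ (2 * m + 1)) hkn1
  have : 2 * (m + 1) - 1 = 2 * m + 1 := by omega
  rw [this]
  linarith

/-- The exponent is at least 1 for l ≥ 1 and at most 1 for l ≤ 1. This lets the factor 1/ε in the
number of swaps be absorbed. -/
theorem le_rpow_two_mul_sub_one {l : ℝ} (hl : 0 < l) : l ≤ l ^ (2 * l - 1) := by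
  rcases le_total 1 l with h | h
  · calc l = l ^ (1 : ℝ) := (Real.rpow_one l).symm
      _ ≤ _ := Real.rpow_le_rpow_of_exponent_le h (by linarith)
  · calc l = l ^ (1 : ℝ) := (Real.rpow_one l).symm
      _ ≤ _ := Real.rpow_le_rpow_of_exponent_ge hl h (by linarith)

/-- Needed when `l` is small, possibly with no rounds at all: the right side of the query bound must
still dominate constants. -/
theorem one_le_two_mul_rpow {l : ℝ} (hl : 0 < l) : 1 ≤ 2 * l ^ (2 * l - 1) := by
  rcases le_total (1 / 2) l with h | h
  · linarith [le_rpow_two_mul_sub_one hl]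
  · have := Real.one_le_rpow_of_pos_of_le_one_of_nonpos hl (by linarith)
      (show 2 * l - 1 ≤ 0 by linarith)
    linarith

theorem floor_pow_le_rpow {l : ℝ} (hl : 0 < l) (h : 1 ≤ ⌊l⌋₊) :
    (⌊l⌋₊ : ℝ) ^ (2 * ⌊l⌋₊ - 1) ≤ l ^ (2 * l - 1) := by
  have h1 : (⌊l⌋₊ : ℝ) ≤ l := Nat.floor_le hl.le
  have h2 : (1 : ℝ) ≤ ⌊l⌋₊ := by exact_mod_cast h
  calc (⌊l⌋₊ : ℝ) ^ (2 * ⌊l⌋₊ - 1) ≤ l ^ (2 * ⌊l⌋₊ - 1) :=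
        pow_le_pow_left₀ (by positivity) h1 _
    _ = l ^ (((2 * ⌊l⌋₊ - 1 : ℕ)) : ℝ) := (Real.rpow_natCast _ _).symm
    _ ≤ l ^ (2 * l - 1) := by
        refine Real.rpow_le_rpow_of_exponent_le (h2.trans h1) ?_
        rw [Nat.cast_sub (by omega)]
        push_cast
        linarith

/-- The swaps contribute a factor k E (1/α₀ + 2), each loop test costs at most 5 n queries, and the
enumeration adds 94; so 5 (1/α₀ + 2) + 94 = 5/α₀ + 104. -/
theorem queries_le {ε α₀ : ℝ} (hε : 0 < ε) (hα₀ : 0 < α₀) {k n q S : ℕ} (hk : 1 ≤ k) (hkn : k ≤ n)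
    (hS₀ : rounds ε = 0 → S ≤ 2)
    (hS : 1 ≤ rounds ε → S ≤ 94 * (k * n * rounds ε ^ (2 * rounds ε - 1)))
    (hq : q ≤ (⌊k / (ε * α₀)⌋₊ + 1) * (n + 3 * k + 1) + S) :
    (q : ℝ) ≤ (5 / α₀ + 104) * (k * n * (10 / (9 * ε)) ^ (2 * (10 / (9 * ε)) - 1)) := by
  have hl : 0 < 10 / (9 * ε) := by positivity
  have h1 := le_rpow_two_mul_sub_one hl
  have h2 := one_le_two_mul_rpow hl
  have h3 := floor_pow_le_rpow hl
  have hr : rounds ε = ⌊10 / (9 * ε)⌋₊ := rfl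
  rw [← hr] at h3
  have hinv : k / (ε * α₀) ≤ k * (10 / (9 * ε)) / α₀ := by
    have : k * (10 / (9 * ε)) / α₀ = 10 / 9 * (k / (ε * α₀)) := by field_simp
    have : 0 ≤ k / (ε * α₀) := by positivity
    linarith
  generalize (10 / (9 * ε)) ^ (2 * (10 / (9 * ε)) - 1) = E at *
  have hk' : (1 : ℝ) ≤ k := by exact_mod_cast hk
  have hkn' : (k : ℝ) ≤ n := by exact_mod_cast hkn
  have hkn1 : (1 : ℝ) ≤ k * n := by nlinarith
  have hE : 0 ≤ E := by linarith
  have hS' : (S : ℝ) ≤ 94 * (k * n * E) := by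
    rcases Nat.eq_zero_or_pos (rounds ε) with h | h
    · have h4 : (S : ℝ) ≤ 2 := by exact_mod_cast hS₀ h
      have h5 : 1 * E ≤ k * n * E := mul_le_mul_of_nonneg_right hkn1 hE
      linarith
    · have h4 : (S : ℝ) ≤ 94 * (k * n * (rounds ε : ℝ) ^ (2 * rounds ε - 1)) := by
        exact_mod_cast hS h
      have h5 : k * n * (rounds ε : ℝ) ^ (2 * rounds ε - 1) ≤ k * n * E :=
        mul_le_mul_of_nonneg_left (h3 h) (by positivity)
      linarith
  have hfl : (⌊k / (ε * α₀)⌋₊ : ℝ) ≤ k * E / α₀ :=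
    (Nat.floor_le (by positivity)).trans (hinv.trans (by gcongr))
  have h6 : (⌊k / (ε * α₀)⌋₊ + 1 : ℝ) ≤ k * E * (1 / α₀ + 2) := by
    have : 1 * (2 * E) ≤ k * (2 * E) := mul_le_mul_of_nonneg_right hk' (by linarith)
    rw [mul_add, mul_one_div]
    linarith
  have h7 : (n + 3 * k + 1 : ℝ) ≤ 5 * n := by linarith
  have h8 := mul_le_mul h6 h7 (by positivity) (by positivity)
  have hq' : (q : ℝ) ≤ (⌊k / (ε * α₀)⌋₊ + 1) * (n + 3 * k + 1) + S := by exact_mod_cast hq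
  have e : k * E * (1 / α₀ + 2) * (5 * n) = (5 / α₀ + 10) * (k * n * E) := by ring
  linarith

/-- One extra copy of the quotient must cover the remainder. The remainder is zero in the first
case, and smaller than L ≤ k / L in the second. -/
theorem le_div_mul_succ {k L : ℕ} (hL : 1 ≤ L) (h : L ∣ k ∨ L ^ 2 ≤ k) :
    k ≤ k / L * (L + 1) := by
  rcases h with h | h
  · have := Nat.div_mul_cancel h
    rw [mul_add]
    omega
  · have h1 : L ≤ k / L := (Nat.le_div_iff_mul_le hL).2 (by rwa [← sq])
    have h2 := Nat.lt_div_mul_add (a := k) hL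
    rw [mul_add]
    omega

theorem le_of_dvd_or_sq_le {k L : ℕ} (hk : 1 ≤ k) (h : L ∣ k ∨ L ^ 2 ≤ k) : L ≤ k :=
  h.elim (Nat.le_of_dvd hk) fun h => (Nat.le_self_pow two_ne_zero L).trans h

/-- Subadditivity of f on O = (O \ Z) ∪ (O ∩ Z), using f ≥ 0; this is the lower bound for D. -/
theorem Submodular.sub_sub_le {U : Type} [DecidableEq U] {f : Finset U → ℝ} (hf : Submodular f)
    (hf0 : ∀ S, 0 ≤ f S) (O Z : Finset U) :
    f O - f (O ∪ Z) - f (O ∩ Z) ≤ f (O \ Z) - f (O ∪ Z) := by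
  have h := hf.union_add_inter_le (O \ Z) (O ∩ Z)
  rw [Finset.sdiff_union_inter] at h
  linarith [hf0 ((O \ Z) ∩ (O ∩ Z))]

end GuidedSM

/-! ### The theorem for both constraints. -/

theorem mainTheorem2 (α₀ : ℝ) (hα₀ : 0 < α₀) :
    ∃ C : ℝ, ∀ (U : Type) [Fintype U] [DecidableEq U] (f : Finset U → ℝ),
      (∀ S, 0 ≤ f S) → GuidedSM.Submodular f →
      ∀ (τ : GuidedSM.TieBreaking) (ε : ℝ), 0 < ε →
      ∀ O Z₀ : Finset U, 0 < f O → α₀ * f O ≤ f Z₀ →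
      -- size constraint, `t = 0.372`
      (∀ k : ℕ, 1 ≤ k → k ≤ Fintype.card U →
        (GuidedSM.rounds ε ∣ k ∨ GuidedSM.rounds ε ^ 2 ≤ k) →
        GuidedSM.IsOptimal f (.size k) O → (GuidedSM.Constraint.size k).Feasible Z₀ →
        ∃ (A : Finset U) (q : ℕ),
          GuidedSM.Eval f (GuidedSM.guidedDet τ (.size k) Z₀ 0.372 ε) A q ∧
          (∀ A' q', GuidedSM.Eval f (GuidedSM.guidedDet τ (.size k) Z₀ 0.372 ε) A' q' →
            A' = A ∧ q' = q) ∧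
          (GuidedSM.Constraint.size k).Feasible A ∧
          (0.385 - ε) * f O ≤ f A ∧
          (q : ℝ) ≤ C * (k * Fintype.card U *
            (10 / (9 * ε)) ^ (2 * (10 / (9 * ε)) - 1))) ∧
      -- matroid constraint, `t = 0.559`
      (∀ (M : Matroid U) (k : ℕ), M.eRank = k → 1 ≤ k →
        GuidedSM.IsOptimal f (.matroid M) O → (GuidedSM.Constraint.matroid M).Feasible Z₀ →
        ∃ (A : Finset U) (q : ℕ),
          GuidedSM.Eval f (GuidedSM.guidedDet τ (.matroid M) Z₀ 0.559 ε) A q ∧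
          (∀ A' q', GuidedSM.Eval f (GuidedSM.guidedDet τ (.matroid M) Z₀ 0.559 ε) A' q' →
            A' = A ∧ q' = q) ∧
          (GuidedSM.Constraint.matroid M).Feasible A ∧
          (0.305 - ε) * f O ≤ f A ∧
          (q : ℝ) ≤ C * (k * Fintype.card U *
            (10 / (9 * ε)) ^ (2 * (10 / (9 * ε)) - 1))) := by
  refine ⟨5 / α₀ + 104, fun U _ _ f hf0 hf τ ε hε O Z₀ hfO hZO => ⟨?_, ?_⟩⟩
  · intro k hk hkn hLk hO hZ₀
    have hLk' := GuidedSM.le_of_dvd_or_sq_le hk hLk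
    obtain ⟨A, q, hev, ⟨hA, Z, h1, h2, h3, h4⟩, hq⟩ :=
      GuidedSM.runs_guidedDet hf0 hf (τ := τ) hε hα₀ hO hfO hZ₀ hZO hk
        (t := 0.372) (by norm_num) (by norm_num)
        (P := fun i G => G.card = i * (k / GuidedSM.rounds ε))
        (fun i hi W G hW hG => by
          have hL : 1 ≤ GuidedSM.rounds ε := by omega
          -- Before the last round ends, `G` has i (k / L) < k elements, so W, G and the elements
          -- added in one round leave one of the 3 k dummies unused.
          have hd : W.card + G.card + GuidedSM.rounds ε * (k / GuidedSM.rounds ε) < 3 * k := by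
            have e1 : (i + 1) * (k / GuidedSM.rounds ε) ≤
                GuidedSM.rounds ε * (k / GuidedSM.rounds ε) := Nat.mul_le_mul_right _ hi
            have e2 := Nat.mul_div_le k (GuidedSM.rounds ε)
            have e3 : 1 ≤ k / GuidedSM.rounds ε := Nat.div_pos hLk' hL
            have e4 : W.card ≤ k := hW
            rw [add_mul] at e1
            omega
          refine (GuidedSM.runs_guidedIGS hf0 hf τ hL hLk' (GuidedSM.le_div_mul_succ hL hLk)
            hO.1 hd).mono (fun new h => ⟨fun A hA => ⟨?_, (h.1 A hA).2⟩, h.2⟩) le_rfl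
          rw [(h.1 A hA).1, hG, add_mul, one_mul])
        (by simp [GuidedSM.emptyStart])
        (fun A hA => (Finset.card_toLeft_le.trans hA.le).trans (Nat.mul_div_le _ _))
    refine ⟨A, q, hev, fun A' q' h => h.unique hev, hA,
      GuidedSM.size_ratio hε hfO (hf0 _) (hf0 _) (hf0 _) h1 h2 h3 (hf.sub_sub_le hf0 O Z) h4,
      GuidedSM.queries_le hε hα₀ hk hkn (fun h => ?_)
        (fun h => GuidedSM.size_enumeration_le hk hkn h hLk') hq⟩
    simp [h]
  · intro M k hM hk hO hZ₀
    have hr : (GuidedSM.Constraint.matroid M).rank = k := by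
      simp [GuidedSM.Constraint.rank, hM]
    have hkn : k ≤ Fintype.card U := by
      have h := M.eRank_le_encard_ground.trans Set.encard_le_card
      rw [hM, ENat.card_eq_coe_fintype_card] at h
      exact_mod_cast h
    obtain ⟨A, q, hev, ⟨hA, Z, h1, h2, h3, h4⟩, hq⟩ :=
      GuidedSM.runs_guidedDet hf0 hf (τ := τ) hε hα₀ hO hfO hZ₀ hZO (hr.symm ▸ hk)
        (t := 0.559) (by norm_num) (by norm_num)
        (P := fun _ G => (GuidedSM.Constraint.matroid M).ExtFeasible G ∧
          G.card = (GuidedSM.Constraint.matroid M).rank)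
        (fun i hi W G hW hG => GuidedSM.runs_guidedIGM hf0 hf τ (by omega) (hr.symm ▸ hk)
          hO.1 hG.1 hG.2 (by omega))
        ⟨GuidedSM.extFeasible_pad (GuidedSM.Constraint.feasible_empty _) (by omega),
          GuidedSM.card_pad (by simp) (by omega)⟩
        (fun A hA => hA.1.1)
    rw [hr] at hq
    refine ⟨A, q, hev, fun A' q' h => h.unique hev, hA,
      GuidedSM.matroid_ratio hε hfO (hf0 _) (hf0 _) (hf0 _) h1 h2 h3 (hf.sub_sub_le hf0 O Z) h4,
      GuidedSM.queries_le hε hα₀ hk hkn (fun h => ?_)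
        (fun h => GuidedSM.matroid_enumeration_le hk hkn h) hq⟩
    simp [h]
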